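/- Let $\mathcal H$ be a finite set of $k$ distinct integers. For a prime $p$ let $\Omega(p)$ be the set of residue classes $-h \bmod p$ with $h\in\mathcal H$; $\mathcal H$ is called admissible if $|\Omega(p)|<p$ for every prime $p$. For $h\in\mathcal H$ put $\Omega^*(p)=\Omega(p)\setminus\{-h \bmod p\}$. For square-free $q\ge 1$ let $\Omega^*(q)$ be the set of residue classes $r \bmod q$ with $r \bmod p\in\Omega^*(p)$ for all primes $p\mid q$, and let $\Omega^*(q)=\emptyset$ if $q$ is not square-free. Put $$E^*(N;a,q)=\sum_{\substack{N<p\le 2N,\ p\ \mathrm{prime}\\ p\equiv a\,(\mathrm{mod}\ q)}}\log p-\frac{N}{\varphi(q)},$$ and, for real $A,B\ge 1$, $$\mathcal E_h(N;\mathcal H)=\mathcal E_h(N;\mathcal H;A,B)=\sup_{\alpha,\beta}\Bigl|\sum_{a\le A,\ b\le B}\alpha_a\beta_b\sum_{r\in\Omega^*(ab)}E^*(N;r+h,ab)\Bigr|,$$ where $\alpha,\beta$ run over real vectors with $|\alpha_a|\le 1$, $|\beta_b|\le 1$. For $R$ sufficiently large put $R_0=\exp\bigl(\log R/(\log\log R)^{1/5}\bigr)$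 and $\tau=(\log\log R)^{1/10}$. Theorem. For every constant $\theta>\frac12$ there are $k_0,\ell_0$ depending only on $\theta$ such that the following holds for all integers $k\ge k_0$ and $\ell\ge\ell_0$ with $1\le\ell\le k$, all real $\omega$ with $3\log k\le k\omega\le\frac12 k$ (in particular $\omega=3(\log k)/k$), all $C_1\ge 2(k+\ell+1)$, and every admissible $\mathcal H$ with $|\mathcal H|=k$. Suppose that for each $h\in\mathcal H$, with $R=N^{\theta/2}$, there are $A=A(N)\ge 1$ and $B=B(N)\ge 1$ with $AB=R_0^{2\tau}R^{2+\omega}$ for all large $N$, such that $$\mathcal E_h(N;\mathcal H;A,B)\ll\frac{N}{(\log N)^{C_1}}\qquad(N\to\infty).$$ Then $\liminf_{n\to\infty}(p_{n+1}-p_n)<\infty$, where $p_n$ denotes the $n$th prime. -/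

import Mathlib

open Filter Asymptotics

noncomputable section

namespace SmoothedGPY

/-- `Ω(p)`: the set of residue classes `-h mod p` with `h ∈ 𝓗`. -/
def Omega (H : Finset ℤ) (p : ℕ) : Finset (ZMod p) :=
  H.image (fun h : ℤ => -(h : ZMod p))

/-- `𝓗` is admissible: `|Ω(p)| < p` for every prime `p`. -/
def Admissible (H : Finset ℤ) : Prop :=
  ∀ p : ℕ, p.Prime → (Omega H p).card < p

/-- `Ω*(q)`, as a set of representatives in `[0, q)`: the multiplicative extension of
`Ω*(p) = Ω(p) \ {-h mod p}` to square-free `q`; it is empty when `q` is not square-free. -/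
def OmegaStar (H : Finset ℤ) (h : ℤ) (q : ℕ) : Finset ℕ :=
  (Finset.range q).filter (fun r : ℕ => Squarefree q ∧
    ∀ p ∈ q.primeFactors, (r : ZMod p) ∈ Omega H p \ {-(h : ZMod p)})

/-- `ϑ*(N; a, q)`: the sum of `log n` over the primes `N < n ≤ 2N` with `n ≡ a (mod q)`. -/
def thetaStar (N : ℕ) (a : ℤ) (q : ℕ) : ℝ :=
  ∑ n ∈ (Finset.Ioc N (2 * N)).filter (fun n : ℕ => n.Prime ∧ (n : ℤ) ≡ a [ZMOD (q : ℤ)]),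
    Real.log n

/-- `E*(N; a, q) = ϑ*(N; a, q) - N / φ(q)`. -/
def EStar (N : ℕ) (a : ℤ) (q : ℕ) : ℝ :=
  thetaStar N a q - (N : ℝ) / (Nat.totient q : ℝ)

/-- The bilinear form `∑_{a ≤ A, b ≤ B} α_a β_b ∑_{r ∈ Ω*(ab)} E*(N; r + h, ab)`. -/
def bilinearSum (H : Finset ℤ) (h : ℤ) (N : ℕ) (A B : ℝ) (α β : ℕ → ℝ) : ℝ :=
  ∑ a ∈ Finset.Icc 1 ⌊A⌋₊, ∑ b ∈ Finset.Icc 1 ⌊B⌋₊,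
    α a * β b * ∑ r ∈ OmegaStar H h (a * b), EStar N ((r : ℤ) + h) (a * b)

/-- The values `|bilinearSum|` for coefficient vectors bounded by `1`. -/
def bilinearValues (H : Finset ℤ) (h : ℤ) (N : ℕ) (A B : ℝ) : Set ℝ :=
  {x : ℝ | ∃ α β : ℕ → ℝ, (∀ a, |α a| ≤ 1) ∧ (∀ b, |β b| ≤ 1) ∧
    x = |bilinearSum H h N A B α β|}

/-- `𝓔_h(N; 𝓗)` with respect to `A`, `B`: the supremum of the absolute value of the bilinear
form over all coefficient vectors bounded by `1`. -/
def bilinearError (H : Finset ℤ) (h : ℤ) (N : ℕ) (A B : ℝ) : ℝ :=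
  sSup (bilinearValues H h N A B)

/-- The supremum defining `bilinearError` is that of a bounded set. -/
theorem bddAbove_bilinearValues (H : Finset ℤ) (h : ℤ) (N : ℕ) (A B : ℝ) :
    BddAbove (bilinearValues H h N A B) := by
  refine ⟨∑ a ∈ Finset.Icc 1 ⌊A⌋₊, ∑ b ∈ Finset.Icc 1 ⌊B⌋₊,
    |∑ r ∈ OmegaStar H h (a * b), EStar N ((r : ℤ) + h) (a * b)|, ?_⟩
  rintro x ⟨α, β, hα, hβ, rfl⟩
  refine (Finset.abs_sum_le_sum_abs _ _).trans (Finset.sum_le_sum fun a _ => ?_)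
  refine (Finset.abs_sum_le_sum_abs _ _).trans (Finset.sum_le_sum fun b _ => ?_)
  rw [abs_mul, abs_mul]
  exact mul_le_of_le_one_left (abs_nonneg _)
    (mul_le_one₀ (hα a) (abs_nonneg _) (hβ b))

/-- `R₀ = exp(log R / (log log R)^{1/5})`. -/
def R0 (R : ℝ) : ℝ :=
  Real.exp (Real.log R / Real.log (Real.log R) ^ ((1 : ℝ) / 5))

/-- `τ = (log log R)^{1/10}`. -/
def tau (R : ℝ) : ℝ :=
  Real.log (Real.log R) ^ ((1 : ℝ) / 10)

/-- The level `R₀^{2τ} R^{2+ω}`, to be split as `A * B`. -/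
def level (R ω : ℝ) : ℝ :=
  R0 R ^ (2 * tau R) * R ^ (2 + ω)

/-- For every `h ∈ 𝓗`, with `R = N^{θ/2}` and some `A, B ≥ 1` such that `A B = R₀^{2τ} R^{2+ω}`
(both may vary with `N`), `𝓔_h(N; 𝓗) ≪ N / (log N)^{C₁}` as `N → ∞`. -/
def BilinearErrorBound (H : Finset ℤ) (θ ω C₁ : ℝ) : Prop :=
  ∀ h ∈ H, ∃ A B : ℕ → ℝ,
    (∀ᶠ N : ℕ in atTop, 1 ≤ A N ∧ 1 ≤ B N ∧ A N * B N = level ((N : ℝ) ^ (θ / 2)) ω) ∧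
    (fun N : ℕ => bilinearError H h N (A N) (B N)) =O[atTop]
      (fun N : ℕ => (N : ℝ) / Real.log N ^ C₁)

end SmoothedGPY

end

/-! Let w(m) ≥ 0. If the sum of (log q) w(q − h) over h in 𝓗 and primes q in (N, 2N] exceeds log(2N)
times the sum of w(m) over a slightly enlarged interval, then two primes above N lie within a
distance depending only on 𝓗 (`exists_two_primes_of_sum_lt`). The task is to find such a w for all
large N.

The weight has two factors. The first handles primes up to z = N^ε: a Brun–Hooley upper bound sieve
(`exists_brun_hooley_weights`), which is non-negative and, over the integers, within a factor 1.01
of the sieve product V. The second is the square of a polynomial in the counts X_l(m) of primes p in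
the cell (N^(ερ^l), N^(ερ^(l+1))] with m mod p in Ω(p). The polynomial is a combination of products
of binomials C(X_l, n_l) over types n of weight Σ n_l t_l ≤ 1/4, where t_l = ερ^(l+1). Expanding the
square produces types of weight at most 1/2, hence moduli at most N^(1/2 + c), where N^c bounds the
sieve moduli and all cell primes. Over integers this is elementary. Over shifted primes the error is
a bilinear form: as every cell prime is at most N^c, the modulus can be split greedily between the
ranges A and B, because AB ≥ N^θ ≥ N^(1/2 + 4c) (`abs_primeMoment_error_le`).

In the limit the X_l have the factorial moments of independent Poisson variables, of mean k log ρ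
over integers and (k − 1) log ρ over shifted primes (`tendsto_intMoment`, `tendsto_primeMoment`).
The quadratic form of a Poisson vector is diagonal in suitable coordinates (`sqForm_expMono`). With
diagonal coordinates ∏ (−g_l)^(n_l), and L = log ρ, the two forms are, up to truncation, exp(Σ kLg²)
and exp(Σ (k − 1)Lg² + 2 Σ Lg). The primes gain a further sieve factor ∏ (1 − 1/p)⁻¹ ≥ 1.61 log z
(`prod_primes_ge`).

So it is enough that 1.61 k ερ^J exp(−Σ L(1 − g)²) exceeds 1 with some room, J being the number of
cells. Take g = 1/(1 + u) with u = 4kt/0.99 up to u = 1000. The mean weight is then about 0.99/4,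
just below the cap 1/4, and for large k the Poisson weight concentrates there, so truncation is
harmless. The sum in the exponent is close to log 1001 + 1/1001 − 1, and the product is about 1.61 ·
0.99 · e/4 > 1.07 (`exists_sieve_parameters`). -/

open SmoothedGPY

/-! ### Mertens' first and second theorems -/

/-- `log p / p` on primes, `0` elsewhere. -/
noncomputable def logPrimeDiv (p : ℕ) : ℝ := if p.Prime then Real.log p / p else 0

lemma log_factorial_eq_sum (n : ℕ) :
    Real.log (n.factorial : ℝ) =
      ∑ p ∈ (Finset.Icc 0 n).filter Nat.Prime, (n.factorial.factorization p : ℝ) * Real.log p := by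
  rw [Real.log_nat_eq_sum_factorization]
  refine Finsupp.sum_of_support_subset _ ?_ _ (by simp)
  intro p hp
  simp only [Nat.support_factorization, Nat.mem_primeFactors] at hp
  simp [hp.1, (hp.1.dvd_factorial).1 hp.2.1]

lemma log_factorial_ge (n : ℕ) (hn : 1 ≤ n) :
    n * Real.log n - n ≤ Real.log (n.factorial : ℝ) := by
  have h := Real.pow_div_factorial_le_exp (x := (n : ℝ)) (by positivity) n
  have hn' : (0 : ℝ) < n := by exact_mod_cast hn
  have hf : (0 : ℝ) < n.factorial := by exact_mod_cast n.factorial_pos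
  have h2 := Real.log_le_log (by positivity) h
  rw [Real.log_exp, Real.log_div (by positivity) hf.ne', Real.log_pow] at h2
  linarith

lemma log_factorial_le (n : ℕ) : Real.log (n.factorial : ℝ) ≤ n * Real.log n := by
  rw [← Real.log_pow]
  exact Real.log_le_log (by exact_mod_cast n.factorial_pos)
    (by exact_mod_cast Nat.factorial_le_pow n)

/-- The difference is log m / (m(m − 1)), and log m ≤ 2√m makes it summable. This is the cost of
replacing p − 1 by p in Legendre's formula. -/
lemma log_div_pred_sub_le {m : ℕ} (hm : 2 ≤ m) :
    Real.log m / ((m : ℝ) - 1) - Real.log m / m ≤ 4 * ((m : ℝ) ^ (-(3 / 2) : ℝ)) := by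
  have h2 : (2 : ℝ) ≤ m := by exact_mod_cast hm
  have hl : Real.log m ≤ 2 * (m : ℝ) ^ (1 / 2 : ℝ) := by
    have := Real.log_le_rpow_div (x := (m : ℝ)) (by positivity) (show (0 : ℝ) < 1 / 2 by norm_num)
    linarith
  have e1 : Real.log m / ((m : ℝ) - 1) - Real.log m / m = Real.log m / (m * (m - 1)) := by
    have : (m : ℝ) - 1 ≠ 0 := by linarith
    field_simp; ring
  have e2 : (m : ℝ) ^ (-(3 / 2) : ℝ) = (m : ℝ) ^ (1 / 2 : ℝ) / m ^ 2 := by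
    rw [← Real.rpow_natCast (m : ℝ) 2, ← Real.rpow_sub (by linarith)]; norm_num
  rw [e1, e2, ← mul_div_assoc, div_le_div_iff₀ (by nlinarith) (by positivity)]
  have hp : (0 : ℝ) ≤ (m : ℝ) ^ (1 / 2 : ℝ) := by positivity
  nlinarith [mul_le_mul_of_nonneg_right hl (show (0 : ℝ) ≤ m ^ 2 by positivity),
    mul_nonneg hp (show (0 : ℝ) ≤ m * (m - 2) by nlinarith)]

/-- Mertens' first theorem. -/
theorem mertens_first_nat : ∃ C : ℝ, ∀ n : ℕ, 1 ≤ n →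
    |∑ p ∈ Finset.Icc 0 n, logPrimeDiv p - Real.log n| ≤ C := by
  have hs : Summable (fun m : ℕ => 4 * ((m : ℝ) ^ (-(3 / 2) : ℝ))) :=
    (Real.summable_nat_rpow.2 (by norm_num)).mul_left 4
  refine ⟨max (1 + ∑' m : ℕ, 4 * ((m : ℝ) ^ (-(3 / 2) : ℝ))) (Real.log 4), fun n hn => ?_⟩
  have hn' : (0 : ℝ) < n := by exact_mod_cast hn
  have hsum : ∑ p ∈ Finset.Icc 0 n, logPrimeDiv p =
      ∑ p ∈ (Finset.Icc 0 n).filter Nat.Prime, Real.log p / p := by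
    rw [Finset.sum_filter]; rfl
  rw [hsum, abs_le]
  constructor
  -- Lower bound: v_p(n!) ≤ n/(p − 1), set against log n! ≥ n log n − n.
  · have h1 : Real.log (n.factorial : ℝ) ≤
        n * ∑ p ∈ (Finset.Icc 0 n).filter Nat.Prime, Real.log p / ((p : ℝ) - 1) := by
      rw [log_factorial_eq_sum, Finset.mul_sum]
      refine Finset.sum_le_sum fun p hp => ?_
      have hpp : p.Prime := (Finset.mem_filter.1 hp).2
      have hp2 : (2 : ℝ) ≤ p := by exact_mod_cast hpp.two_le
      have h3 : (n.factorial.factorization p : ℝ) ≤ n / ((p : ℝ) - 1) := by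
        have h4 : (n.factorial.factorization p : ℝ) ≤ ((n / (p - 1) : ℕ) : ℝ) := by
          exact_mod_cast Nat.factorization_factorial_le_div_pred hpp n
        have h5 : ((n / (p - 1) : ℕ) : ℝ) ≤ n / ((p - 1 : ℕ) : ℝ) := Nat.cast_div_le
        rw [Nat.cast_sub hpp.one_le] at h5
        simpa using h4.trans h5
      calc _ ≤ n / ((p : ℝ) - 1) * Real.log p :=
            mul_le_mul_of_nonneg_right h3 (Real.log_natCast_nonneg _)
        _ = _ := by ring
    have h2 : ∑ p ∈ (Finset.Icc 0 n).filter Nat.Prime, Real.log p / ((p : ℝ) - 1) -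
        ∑ p ∈ (Finset.Icc 0 n).filter Nat.Prime, Real.log p / p ≤
        ∑' m : ℕ, 4 * ((m : ℝ) ^ (-(3 / 2) : ℝ)) := by
      rw [← Finset.sum_sub_distrib]
      refine le_trans (Finset.sum_le_sum fun p hp => ?_)
        (hs.sum_le_tsum ((Finset.Icc 0 n).filter Nat.Prime) (fun _ _ => by positivity))
      exact log_div_pred_sub_le (Finset.mem_filter.1 hp).2.two_le
    have h3 := log_factorial_ge n hn
    have h4 : Real.log n - 1 ≤
        ∑ p ∈ (Finset.Icc 0 n).filter Nat.Prime, Real.log p / ((p : ℝ) - 1) := by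
      have : n * (Real.log n - 1) ≤
        n * ∑ p ∈ (Finset.Icc 0 n).filter Nat.Prime, Real.log p / ((p : ℝ) - 1) := by linarith
      exact le_of_mul_le_mul_left this hn'
    have := le_max_left (1 + ∑' m : ℕ, 4 * ((m : ℝ) ^ (-(3 / 2) : ℝ))) (Real.log 4)
    linarith
  -- Upper bound: v_p(n!) > n/p − 1, and the subtracted ones add up to θ(n) ≤ n log 4.
  · have h1 : n * ∑ p ∈ (Finset.Icc 0 n).filter Nat.Prime, Real.log p / p ≤
        Real.log (n.factorial : ℝ) + Chebyshev.theta n := by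
      rw [log_factorial_eq_sum, Chebyshev.theta_eq_sum_Icc, Nat.floor_natCast, Finset.mul_sum,
        ← Finset.sum_add_distrib]
      refine Finset.sum_le_sum fun p hp => ?_
      have hpp : p.Prime := (Finset.mem_filter.1 hp).2
      have hpn : p ≤ n := (Finset.mem_Icc.1 (Finset.mem_filter.1 hp).1).2
      have h3 : n / p ≤ n.factorial.factorization p := by
        rw [Nat.factorization_factorial hpp (Nat.lt_add_one (Nat.log p n))]
        have hl : 1 ≤ Nat.log p n := Nat.log_pos hpp.one_lt hpn
        have := Finset.single_le_sum (f := fun i => n / p ^ i)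
          (s := Finset.Ico 1 (Nat.log p n + 1)) (fun _ _ => Nat.zero_le _)
          (Finset.mem_Ico.2 ⟨le_rfl, by omega⟩)
        simpa using this
      have h4 : (n : ℝ) / p ≤ (n.factorial.factorization p : ℝ) + 1 := by
        have : (n : ℝ) / p < ((n / p : ℕ) : ℝ) + 1 := by
          rw [← Nat.floor_div_eq_div (K := ℝ)]; exact Nat.lt_floor_add_one _
        have h5 : ((n / p : ℕ) : ℝ) ≤ (n.factorial.factorization p : ℝ) := by exact_mod_cast h3
        linarith
      calc _ = (n : ℝ) / p * Real.log p := by ring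
        _ ≤ ((n.factorial.factorization p : ℝ) + 1) * Real.log p :=
            mul_le_mul_of_nonneg_right h4 (Real.log_natCast_nonneg _)
        _ = _ := by ring
    have h2 := log_factorial_le n
    have h3 := Chebyshev.theta_le_log4_mul_x (x := (n : ℝ)) (by positivity)
    have h4 : ∑ p ∈ (Finset.Icc 0 n).filter Nat.Prime, Real.log p / p ≤
        Real.log n + Real.log 4 := by
      have : n * ∑ p ∈ (Finset.Icc 0 n).filter Nat.Prime, Real.log p / p ≤
        n * (Real.log n + Real.log 4) := by linarith
      exact le_of_mul_le_mul_left this hn'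
    have := le_max_right (1 + ∑' m : ℕ, 4 * ((m : ℝ) ^ (-(3 / 2) : ℝ))) (Real.log 4)
    linarith

theorem mertens_first : ∃ C : ℝ, 0 ≤ C ∧ ∀ x : ℝ, 1 ≤ x →
    |∑ p ∈ Finset.Icc 0 ⌊x⌋₊, logPrimeDiv p - Real.log x| ≤ C := by
  obtain ⟨C, hC⟩ := mertens_first_nat
  have hC0 : 0 ≤ C := (abs_nonneg _).trans (hC 1 le_rfl)
  refine ⟨C + Real.log 2, add_nonneg hC0 (Real.log_nonneg (by norm_num)), fun x hx => ?_⟩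
  have hf : 1 ≤ ⌊x⌋₊ := Nat.le_floor (by simpa using hx)
  have hf' : (1 : ℝ) ≤ (⌊x⌋₊ : ℝ) := by exact_mod_cast hf
  have h1 := hC _ hf
  have h2 : Real.log ⌊x⌋₊ ≤ Real.log x :=
    Real.log_le_log (by linarith) (Nat.floor_le (by linarith))
  have h3 : Real.log x ≤ Real.log 2 + Real.log ⌊x⌋₊ := by
    rw [← Real.log_mul (by norm_num) (by linarith)]
    exact Real.log_le_log (by linarith) (by linarith [Nat.lt_floor_add_one x])
  rw [abs_le] at h1 ⊢
  constructor <;> linarith [h1.1, h1.2]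

/-- Mertens' second theorem, in the form of sums over intervals. -/
theorem mertens_second : ∃ C : ℝ, 0 ≤ C ∧ ∀ x y : ℝ, 2 ≤ x → x ≤ y →
    |∑ p ∈ (Finset.Ioc ⌊x⌋₊ ⌊y⌋₊).filter Nat.Prime, (1 : ℝ) / p
      - Real.log (Real.log y / Real.log x)| ≤ C / Real.log x := by
  obtain ⟨C, hC0, hC⟩ := mertens_first
  refine ⟨2 * C, by positivity, fun x y hx hxy => ?_⟩
  set f : ℝ → ℝ := fun t => (Real.log t)⁻¹ with hf
  have hpos : ∀ t ∈ Set.Icc x y, 0 < Real.log t := fun t ht => Real.log_pos (by linarith [ht.1])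
  have hd : ∀ t ∈ Set.Icc x y, HasDerivAt f (-t⁻¹ / Real.log t ^ 2) t := fun t ht => by
    have := (Real.hasDerivAt_log (x := t) (by linarith [ht.1])).inv (hpos t ht).ne'
    exact this
  have hcont : ContinuousOn (fun t : ℝ => -t⁻¹ / Real.log t ^ 2) (Set.Icc x y) := by
    refine ContinuousOn.div (ContinuousOn.neg (continuousOn_inv₀.mono ?_))
      ((Real.continuousOn_log.mono ?_).pow 2) (fun t ht => (pow_pos (hpos t ht) 2).ne')
    · intro t ht; simp; linarith [ht.1]
    · intro t ht; simp; linarith [ht.1]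
  have hderiv : Set.EqOn (deriv f) (fun t : ℝ => -t⁻¹ / Real.log t ^ 2) (Set.Icc x y) :=
    fun t ht => (hd t ht).deriv
  have hint : MeasureTheory.IntegrableOn (deriv f) (Set.Icc x y) :=
    (hcont.integrableOn_Icc).congr_fun hderiv.symm measurableSet_Icc
  -- Abel summation of (log p / p) · (1 / log p).
  have key := sum_mul_eq_sub_sub_integral_mul logPrimeDiv (f := f) (by linarith) hxy
    (fun t ht => (hd t ht).differentiableAt) hint
  have hlhs : ∑ k ∈ Finset.Ioc ⌊x⌋₊ ⌊y⌋₊, f k * logPrimeDiv k =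
      ∑ p ∈ (Finset.Ioc ⌊x⌋₊ ⌊y⌋₊).filter Nat.Prime, (1 : ℝ) / p := by
    rw [Finset.sum_filter]
    refine Finset.sum_congr rfl fun p _ => ?_
    unfold logPrimeDiv
    split_ifs with hp
    · have : Real.log p ≠ 0 := (Real.log_pos (by exact_mod_cast hp.one_lt)).ne'
      simp only [hf]; field_simp
    · simp
  rw [hlhs] at key
  rw [key]
  -- the integral
  set A : ℝ → ℝ := fun t => ∑ k ∈ Finset.Icc 0 ⌊t⌋₊, logPrimeDiv k with hA
  have hintA : MeasureTheory.IntegrableOn (fun t => deriv f t * A t) (Set.Icc x y) :=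
    integrableOn_mul_sum_Icc logPrimeDiv (m := 0) (by linarith) hint
  -- With the partial sum replaced by log t + c the integral is explicit; c = ±C brackets the true
  -- one, since f' is negative. The integral contributes C(f x − f y) to the error and the boundary
  -- terms C(f x + f y), in all 2C / log x.
  have hFT : ∀ c : ℝ, ∫ t in Set.Ioc x y, (-t⁻¹ / Real.log t ^ 2) * (Real.log t + c) =
      - Real.log (Real.log y / Real.log x) + c * (f y - f x) := by
    intro c
    rw [← intervalIntegral.integral_of_le hxy]
    have hx0 := hpos x ⟨le_rfl, hxy⟩
    have hy0 := hpos y ⟨hxy, le_rfl⟩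
    rw [intervalIntegral.integral_eq_sub_of_hasDerivAt
      (f := fun t => - Real.log (Real.log t) + c * f t)]
    · rw [Real.log_div hy0.ne' hx0.ne']; ring
    · intro t ht
      rw [Set.uIcc_of_le hxy] at ht
      have ht0 := hpos t ht
      have h1 := (((Real.hasDerivAt_log (x := t) (by linarith [ht.1])).log ht0.ne').neg).add
        ((hd t ht).const_mul c)
      convert! h1 using 1
      have : t ≠ 0 := by linarith [ht.1]
      field_simp
      ring
    · rw [intervalIntegrable_iff_integrableOn_Icc_of_le hxy]
      exact (hcont.mul ((Real.continuousOn_log.mono (by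
        intro t ht; simp; linarith [ht.1])).add continuousOn_const)).integrableOn_Icc
  have hle : ∀ c : ℝ, MeasureTheory.IntegrableOn
      (fun t => (-t⁻¹ / Real.log t ^ 2) * (Real.log t + c)) (Set.Ioc x y) := fun c =>
    ((hcont.mul ((Real.continuousOn_log.mono (by
        intro t ht; simp; linarith [ht.1])).add continuousOn_const)).integrableOn_Icc).mono_set
      Set.Ioc_subset_Icc_self
  have hI1 : ∫ t in Set.Ioc x y, deriv f t * A t ≤
      ∫ t in Set.Ioc x y, (-t⁻¹ / Real.log t ^ 2) * (Real.log t + (-C)) := by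
    refine MeasureTheory.setIntegral_mono_on (hintA.mono_set Set.Ioc_subset_Icc_self) (hle _)
      measurableSet_Ioc fun t ht => ?_
    have ht' := Set.Ioc_subset_Icc_self ht
    rw [hderiv ht']
    have h1 := (abs_le.1 (hC t (by linarith [ht.1]))).1
    refine mul_le_mul_of_nonpos_left (by simp only [hA]; linarith) ?_
    simp only [neg_div]; exact neg_nonpos.2 (div_nonneg (by
      rw [inv_nonneg]; linarith [ht.1]) (by positivity))
  have hI2 : ∫ t in Set.Ioc x y, (-t⁻¹ / Real.log t ^ 2) * (Real.log t + C) ≤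
      ∫ t in Set.Ioc x y, deriv f t * A t := by
    refine MeasureTheory.setIntegral_mono_on (hle _) (hintA.mono_set Set.Ioc_subset_Icc_self)
      measurableSet_Ioc fun t ht => ?_
    have ht' := Set.Ioc_subset_Icc_self ht
    rw [hderiv ht']
    have h1 := (abs_le.1 (hC t (by linarith [ht.1]))).2
    refine mul_le_mul_of_nonpos_left (by simp only [hA]; linarith) ?_
    simp only [neg_div]; exact neg_nonpos.2 (div_nonneg (by
      rw [inv_nonneg]; linarith [ht.1]) (by positivity))
  rw [hFT] at hI1 hI2
  have hx0 := hpos x ⟨le_rfl, hxy⟩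
  have hy0 := hpos y ⟨hxy, le_rfl⟩
  have hb : ∀ t ∈ Set.Icc x y, 1 - C * f t ≤ f t * A t ∧ f t * A t ≤ 1 + C * f t := by
    intro t ht
    have h0 := hpos t ht
    have h1 := abs_le.1 (hC t (by linarith [ht.1]))
    have hft : 0 < f t := inv_pos.2 h0
    have hft1 : f t * Real.log t = 1 := inv_mul_cancel₀ h0.ne'
    constructor
    · have := mul_le_mul_of_nonneg_left (show Real.log t - C ≤ A t by simp only [hA]; linarith)
        hft.le
      linarith
    · have := mul_le_mul_of_nonneg_left (show A t ≤ Real.log t + C by simp only [hA]; linarith)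
        hft.le
      linarith
  have hbx := hb x ⟨le_rfl, hxy⟩
  have hby := hb y ⟨hxy, le_rfl⟩
  have e : 2 * C / Real.log x = 2 * (C * f x) := by simp only [hf]; ring
  rw [e, abs_le]
  constructor <;> linarith [hbx.1, hbx.2, hby.1, hby.2]

/-! ### Sums and products over primes in an interval -/

/-- The primes in the half-open interval `(x, y]`. -/
noncomputable def primesIoc (x y : ℝ) : Finset ℕ := (Finset.Ioc ⌊x⌋₊ ⌊y⌋₊).filter Nat.Prime

lemma mem_primesIoc {x y : ℝ} (hx : 0 ≤ x) {p : ℕ} :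
    p ∈ primesIoc x y ↔ p.Prime ∧ x < p ∧ (p : ℝ) ≤ y := by
  unfold primesIoc
  rw [Finset.mem_filter, Finset.mem_Ioc, Nat.floor_lt hx]
  constructor
  · rintro ⟨⟨h1, h2⟩, hp⟩
    exact ⟨hp, h1, (Nat.le_floor_iff' hp.ne_zero).1 h2⟩
  · rintro ⟨hp, h1, h2⟩
    exact ⟨⟨h1, (Nat.le_floor_iff' hp.ne_zero).2 h2⟩, hp⟩

lemma prime_of_mem_primesIoc {x y : ℝ} {p : ℕ} (h : p ∈ primesIoc x y) : p.Prime :=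
  (Finset.mem_filter.1 h).2

/-- Expanding the geometric series turns the product into the sum of 1/m over all m built from the
primes of P; a finite part of a non-negative series is at most the whole. -/
lemma sum_le_prod_euler (P : Finset ℕ) (hP : ∀ p ∈ P, p.Prime) (S : Finset ℕ)
    (hS : ∀ m ∈ S, m ∈ Nat.factoredNumbers P) :
    ∑ m ∈ S, (1 : ℝ) / m ≤ ∏ p ∈ P, (1 - 1 / (p : ℝ))⁻¹ := by
  let f : ℕ →* ℝ := { toFun := fun n => ((n : ℝ))⁻¹, map_one' := by simp,
                      map_mul' := fun a b => by push_cast; exact mul_inv _ _ }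
  have h := EulerProduct.summable_and_hasSum_factoredNumbers_prod_filter_prime_geometric (f := f)
    (fun {p} hp => by
      simp only [f, MonoidHom.coe_mk, OneHom.coe_mk, Real.norm_eq_abs]
      rw [abs_of_nonneg (by positivity)]
      exact inv_lt_one_of_one_lt₀ (by exact_mod_cast hp.one_lt)) P
  have h2 := h.2
  rw [Finset.filter_true_of_mem hP] at h2
  have h3 : ∏ p ∈ P, (1 - 1 / (p : ℝ))⁻¹ = ∏ p ∈ P, (1 - f p)⁻¹ := by
    refine Finset.prod_congr rfl fun p _ => by simp [f]
  rw [h3]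
  have hinj : Set.InjOn (fun m : ℕ => m) (S : Set ℕ) := fun _ _ _ _ h => h
  have h4 := sum_le_hasSum (S.subtype (fun m => m ∈ Nat.factoredNumbers P))
    (fun i _ => by simp [f]) h2
  refine le_trans (le_of_eq ?_) h4
  rw [Finset.sum_subtype_of_mem (f := fun m : ℕ => f m) hS]
  exact Finset.sum_congr rfl fun m _ => by simp [f]

lemma sum_Icc_one_div_ge (y : ℝ) (hy : 0 ≤ y) :
    Real.log y ≤ ∑ m ∈ Finset.Icc 1 ⌊y⌋₊, (1 : ℝ) / m := by
  have h := log_le_harmonic_floor y hy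
  rw [harmonic_eq_sum_Icc] at h
  simpa using h

lemma sum_Icc_one_div_le (y : ℝ) (hy : 1 ≤ y) :
    ∑ m ∈ Finset.Icc 1 ⌊y⌋₊, (1 : ℝ) / m ≤ 1 + Real.log y := by
  have h := harmonic_floor_le_one_add_log y hy
  rw [harmonic_eq_sum_Icc] at h
  simpa using h

lemma sum_biUnion_le_sum {ι α : Type*} [DecidableEq ι] [DecidableEq α] (s : Finset ι)
    (t : ι → Finset α) (f : α → ℝ) (hf : ∀ a, 0 ≤ f a) :
    ∑ a ∈ s.biUnion t, f a ≤ ∑ i ∈ s, ∑ a ∈ t i, f a := by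
  induction s using Finset.induction_on with
  | empty => simp
  | insert i s hi ih =>
    rw [Finset.biUnion_insert, Finset.sum_insert hi]
    have h := Finset.sum_union_inter (s₁ := t i) (s₂ := s.biUnion t) (f := f)
    have h0 : 0 ≤ ∑ a ∈ t i ∩ s.biUnion t, f a := Finset.sum_nonneg fun a _ => hf a
    linarith

/-- Such an m has a prime factor p in (z, z²]; write m = pj with j ≤ z²/p and bound the harmonic sum
over j. -/
lemma sum_rough_le (z : ℝ) (hz : 1 ≤ z) :
    ∑ m ∈ (Finset.Icc 1 ⌊z ^ 2⌋₊).filter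
        (fun m => m ∉ Nat.factoredNumbers (primesIoc 0 z)), (1 : ℝ) / m ≤
      ∑ p ∈ primesIoc z (z ^ 2), (1 : ℝ) / p * (1 + Real.log (z ^ 2 / p)) := by
  have hz0 : (0 : ℝ) < z := by linarith
  have hsub : (Finset.Icc 1 ⌊z ^ 2⌋₊).filter
        (fun m => m ∉ Nat.factoredNumbers (primesIoc 0 z)) ⊆
      (primesIoc z (z ^ 2)).biUnion
        (fun p => (Finset.Icc 1 ⌊z ^ 2 / p⌋₊).image (fun j => p * j)) := by
    intro m hm
    rw [Finset.mem_filter, Finset.mem_Icc] at hm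
    obtain ⟨⟨hm1, hm2⟩, hm3⟩ := hm
    rw [Nat.mem_factoredNumbers_iff_primeFactors_subset] at hm3
    push Not at hm3
    obtain ⟨p, hp, hpz⟩ := Finset.not_subset.1 (hm3 (by omega))
    have hpp := Nat.prime_of_mem_primeFactors hp
    have hpm := Nat.dvd_of_mem_primeFactors hp
    obtain ⟨j, rfl⟩ := hpm
    have hmz : ((p * j : ℕ) : ℝ) ≤ z ^ 2 := (Nat.le_floor_iff (by positivity)).1 hm2
    have hj1 : 1 ≤ j := Nat.pos_of_ne_zero (by rintro rfl; simp at hm1)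
    have hp0 : (0 : ℝ) < p := by exact_mod_cast hpp.pos
    have hj1' : (1 : ℝ) ≤ j := by exact_mod_cast hj1
    push_cast at hmz
    rw [Finset.mem_biUnion]
    refine ⟨p, (mem_primesIoc hz0.le).2 ⟨hpp, ?_, by nlinarith⟩, ?_⟩
    · by_contra hlt
      exact hpz ((mem_primesIoc le_rfl).2 ⟨hpp, hp0, not_lt.1 hlt⟩)
    · refine Finset.mem_image.2 ⟨j, Finset.mem_Icc.2 ⟨hj1, Nat.le_floor ?_⟩, rfl⟩
      rw [le_div_iff₀ hp0]; linarith
  calc _ ≤ ∑ m ∈ (primesIoc z (z ^ 2)).biUnion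
        (fun p => (Finset.Icc 1 ⌊z ^ 2 / p⌋₊).image (fun j => p * j)), (1 : ℝ) / m :=
        Finset.sum_le_sum_of_subset_of_nonneg hsub (fun _ _ _ => by positivity)
    _ ≤ ∑ p ∈ primesIoc z (z ^ 2), ∑ m ∈ (Finset.Icc 1 ⌊z ^ 2 / p⌋₊).image (fun j => p * j),
        (1 : ℝ) / m := sum_biUnion_le_sum _ _ _ (fun _ => by positivity)
    _ ≤ _ := by
      refine Finset.sum_le_sum fun p hp => ?_
      obtain ⟨hpp, _, h2⟩ := (mem_primesIoc hz0.le).1 hp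
      have hp0 : (0 : ℝ) < p := by exact_mod_cast hpp.pos
      rw [Finset.sum_image (fun a _ b _ h => Nat.eq_of_mul_eq_mul_left hpp.pos h)]
      have := sum_Icc_one_div_le (z ^ 2 / p) (by rw [le_div_iff₀ hp0]; linarith)
      calc _ = (1 : ℝ) / p * ∑ j ∈ Finset.Icc 1 ⌊z ^ 2 / p⌋₊, (1 : ℝ) / j := by
            rw [Finset.mul_sum]
            exact Finset.sum_congr rfl fun j _ => by push_cast; rw [div_mul_div_comm, one_mul]
        _ ≤ _ := mul_le_mul_of_nonneg_left this (by positivity)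

/-- A weak form of Mertens' third theorem: `1.61` replaces `e^γ`. -/
theorem prod_primes_ge : ∀ᶠ z : ℝ in atTop,
    1.61 * Real.log z ≤ ∏ p ∈ primesIoc 0 z, (1 - 1 / (p : ℝ))⁻¹ := by
  obtain ⟨C₁, hC₁, h1⟩ := mertens_first
  obtain ⟨C₂, hC₂, h2⟩ := mertens_second
  -- Up to bounded terms the harmonic sum to z² gives 2 log z and the rough integers take away (2
  -- log 2 − 1) log z, which leaves (3 − 2 log 2) log z > 1.6137 log z. For z this large the bounded
  -- terms cost at most 0.003 log z.
  have hev := Real.tendsto_log_atTop.eventually_ge_atTop (max 1 ((2 + 3 * C₂ + 2 * C₁) / 0.003))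
  filter_upwards [hev, eventually_ge_atTop 2] with z hz hz2
  have hl1 : 1 ≤ Real.log z := (le_max_left _ _).trans hz
  have hl2 : 2 + 3 * C₂ + 2 * C₁ ≤ 0.003 * Real.log z := by
    have := (le_max_right _ _).trans hz
    rw [div_le_iff₀ (by norm_num)] at this; linarith
  have hlog2 : Real.log (z ^ 2) = 2 * Real.log z := by rw [Real.log_pow]; norm_num
  have hzz : z ≤ z ^ 2 := by nlinarith
  refine le_trans ?_ (sum_le_prod_euler (primesIoc 0 z) (fun p hp => prime_of_mem_primesIoc hp)
    ((Finset.Icc 1 ⌊z ^ 2⌋₊).filter (fun m => m ∈ Nat.factoredNumbers (primesIoc 0 z)))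
    (fun m hm => (Finset.mem_filter.1 hm).2))
  have hsplit := Finset.sum_filter_add_sum_filter_not (Finset.Icc 1 ⌊z ^ 2⌋₊)
    (fun m => m ∈ Nat.factoredNumbers (primesIoc 0 z)) (fun m : ℕ => (1 : ℝ) / m)
  have htot := sum_Icc_one_div_ge (z ^ 2) (by positivity)
  have hr := sum_rough_le z (by linarith)
  have hr2 : ∑ p ∈ primesIoc z (z ^ 2), (1 : ℝ) / p * (1 + Real.log (z ^ 2 / p)) =
      (1 + 2 * Real.log z) * ∑ p ∈ primesIoc z (z ^ 2), (1 : ℝ) / p -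
      ∑ p ∈ primesIoc z (z ^ 2), Real.log p / p := by
    rw [Finset.mul_sum, ← Finset.sum_sub_distrib]
    refine Finset.sum_congr rfl fun p hp => ?_
    have hp0 : (p : ℝ) ≠ 0 := by exact_mod_cast (prime_of_mem_primesIoc hp).ne_zero
    rw [Real.log_div (by positivity) hp0, hlog2]; ring
  have h2' := (abs_le.1 (h2 z (z ^ 2) hz2 hzz)).2
  have hl0 : Real.log z ≠ 0 := by linarith
  rw [hlog2, mul_div_assoc, div_self hl0, mul_one] at h2'
  have h3 : Real.log z - 2 * C₁ ≤ ∑ p ∈ primesIoc z (z ^ 2), Real.log p / p := by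
    have e : ∑ p ∈ primesIoc z (z ^ 2), Real.log p / p =
        ∑ p ∈ Finset.Icc 0 ⌊z ^ 2⌋₊, logPrimeDiv p - ∑ p ∈ Finset.Icc 0 ⌊z⌋₊, logPrimeDiv p := by
      have hfl : ⌊z⌋₊ ≤ ⌊z ^ 2⌋₊ := Nat.floor_le_floor hzz
      have : Finset.Icc 0 ⌊z ^ 2⌋₊ = Finset.Icc 0 ⌊z⌋₊ ∪ Finset.Ioc ⌊z⌋₊ ⌊z ^ 2⌋₊ := by
        ext a; simp only [Finset.mem_union, Finset.mem_Icc, Finset.mem_Ioc]; omega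
      rw [this, Finset.sum_union (by
        rw [Finset.disjoint_left]; intro a; simp only [Finset.mem_Icc, Finset.mem_Ioc]; omega)]
      unfold primesIoc
      rw [Finset.sum_filter]
      simp only [logPrimeDiv]; ring
    have a1 := (abs_le.1 (h1 (z ^ 2) (by nlinarith))).1
    have a2 := (abs_le.1 (h1 z (by linarith))).2
    rw [e]; linarith
  have h4 : (1 + 2 * Real.log z) * ∑ p ∈ primesIoc z (z ^ 2), (1 : ℝ) / p ≤
      (1 + 2 * Real.log z) * (Real.log 2 + C₂ / Real.log z) := by
    refine mul_le_mul_of_nonneg_left ?_ (by linarith)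
    unfold primesIoc; linarith
  have h5 : (1 + 2 * Real.log z) * (Real.log 2 + C₂ / Real.log z) ≤
      2 * Real.log 2 * Real.log z + 1 + 3 * C₂ := by
    have : C₂ / Real.log z ≤ C₂ := div_le_self hC₂ hl1
    have e : (1 + 2 * Real.log z) * (Real.log 2 + C₂ / Real.log z) =
      Real.log 2 + C₂ / Real.log z + 2 * Real.log 2 * Real.log z + 2 * C₂ := by
      field_simp; ring
    rw [e]; linarith [Real.log_two_lt_d9]
  have h6 : 2 * Real.log 2 * Real.log z ≤ 1.3863 * Real.log z :=
    mul_le_mul_of_nonneg_right (by linarith [Real.log_two_lt_d9]) (by linarith)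
  linarith

theorem sum_primes_le : ∃ C : ℝ, 0 ≤ C ∧ ∀ z : ℝ, 2 ≤ z →
    ∑ p ∈ primesIoc 0 z, (1 : ℝ) / p ≤ Real.log (Real.log z) + C := by
  obtain ⟨C₂, hC₂, h2⟩ := mertens_second
  have hl2 : 0 < Real.log 2 := Real.log_pos (by norm_num)
  refine ⟨1 + C₂ / Real.log 2 + |Real.log (Real.log 2)|, by positivity, fun z hz => ?_⟩
  have h := (abs_le.1 (h2 2 z le_rfl hz)).2
  have hlz : 0 < Real.log z := Real.log_pos (by linarith)
  rw [Real.log_div hlz.ne' hl2.ne'] at h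
  have hsub : ∑ p ∈ primesIoc 0 z, (1 : ℝ) / p ≤
      1 / 2 + ∑ p ∈ (Finset.Ioc ⌊(2 : ℝ)⌋₊ ⌊z⌋₊).filter Nat.Prime, (1 : ℝ) / p := by
    have : primesIoc 0 z ⊆ insert 2 ((Finset.Ioc ⌊(2 : ℝ)⌋₊ ⌊z⌋₊).filter Nat.Prime) := by
      intro p hp
      unfold primesIoc at hp
      have := (prime_of_mem_primesIoc hp).two_le
      simp only [Nat.floor_ofNat, Finset.mem_insert, Finset.mem_filter, Finset.mem_Ioc] at hp ⊢
      rcases this.eq_or_lt with h | h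
      · left; omega
      · right; exact ⟨⟨h, hp.1.2⟩, hp.2⟩
    refine (Finset.sum_le_sum_of_subset_of_nonneg this (fun _ _ _ => by positivity)).trans ?_
    rw [Finset.sum_insert (by simp)]
    norm_num
  have := neg_abs_le (Real.log (Real.log 2))
  linarith

/-! ### Sums over sets of primes, block by block -/

section Combinatorics

variable {α ι R : Type*} [DecidableEq α] [CommRing R]

lemma sum_powerset_union {A B : Finset α} (h : Disjoint A B) (F G : Finset α → R) :
    ∑ S ∈ (A ∪ B).powerset, F (S ∩ A) * G (S ∩ B) =
      (∑ S ∈ A.powerset, F S) * ∑ S ∈ B.powerset, G S := by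
  rw [Finset.sum_mul_sum, ← Finset.sum_product']
  refine Finset.sum_bij' (fun S _ => (S ∩ A, S ∩ B)) (fun T _ => T.1 ∪ T.2) ?_ ?_ ?_ ?_ ?_
  · intro S _
    simp [Finset.inter_subset_right]
  · intro T hT
    simp only [Finset.mem_product, Finset.mem_powerset] at hT ⊢
    exact Finset.union_subset_union hT.1 hT.2
  · intro S hS
    simp only [Finset.mem_powerset] at hS
    rw [← Finset.inter_union_distrib_left, Finset.inter_eq_left.2 hS]
  · intro T hT
    simp only [Finset.mem_product, Finset.mem_powerset] at hT
    have h1 : (T.1 ∪ T.2) ∩ A = T.1 := by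
      rw [Finset.union_inter_distrib_right, Finset.inter_eq_left.2 hT.1,
        (Finset.disjoint_iff_inter_eq_empty.1 (h.symm.mono_left hT.2)), Finset.union_empty]
    have h2 : (T.1 ∪ T.2) ∩ B = T.2 := by
      rw [Finset.union_inter_distrib_right, Finset.inter_eq_left.2 hT.2,
        (Finset.disjoint_iff_inter_eq_empty.1 (h.mono_left hT.1)), Finset.empty_union]
    simp [h1, h2]
  · intro S _; rfl

lemma sum_powerset_biUnion [DecidableEq ι] (I : Finset ι) (B : ι → Finset α)
    (hB : (I : Set ι).PairwiseDisjoint B) (F : ι → Finset α → R) :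
    ∑ S ∈ (I.biUnion B).powerset, ∏ i ∈ I, F i (S ∩ B i) =
      ∏ i ∈ I, ∑ S ∈ (B i).powerset, F i S := by
  induction I using Finset.induction_on with
  | empty => simp
  | insert i I hi ih =>
    have hd : Disjoint (B i) (I.biUnion B) := by
      rw [Finset.disjoint_biUnion_right]
      intro j hj
      exact hB (by simp) (by simp [hj]) (by rintro rfl; exact hi hj)
    rw [Finset.prod_insert hi, ← ih (hB.subset (by simp)), Finset.biUnion_insert,
      ← sum_powerset_union hd]
    refine Finset.sum_congr rfl fun S _ => ?_
    rw [Finset.prod_insert hi]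
    congr 1
    refine Finset.prod_congr rfl fun j hj => ?_
    rw [Finset.inter_assoc, Finset.inter_eq_right.2 (Finset.subset_biUnion_of_mem B hj)]

/-- The subsets of `⋃ i ∈ I, B i` whose intersection with each `B i` has a size allowed by `A i`. -/
def blockFamily [DecidableEq ι] (I : Finset ι) (B : ι → Finset α) (A : ι → Finset ℕ) :
    Finset (Finset α) :=
  (I.biUnion B).powerset.filter (fun S => ∀ i ∈ I, (S ∩ B i).card ∈ A i)

lemma mem_blockFamily [DecidableEq ι] {I : Finset ι} {B : ι → Finset α} {A : ι → Finset ℕ}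
    {S : Finset α} :
    S ∈ blockFamily I B A ↔ S ⊆ I.biUnion B ∧ ∀ i ∈ I, (S ∩ B i).card ∈ A i := by
  simp [blockFamily]

lemma prod_inter_biUnion {M : Type*} [CommMonoid M] [DecidableEq ι] {I : Finset ι}
    {B : ι → Finset α}
    (hB : (I : Set ι).PairwiseDisjoint B) {S : Finset α} (hS : S ⊆ I.biUnion B) (x : α → M) :
    ∏ p ∈ S, x p = ∏ i ∈ I, ∏ p ∈ S ∩ B i, x p := by
  rw [← Finset.prod_biUnion (fun i hi j hj hij =>
    (hB hi hj hij).mono Finset.inter_subset_right Finset.inter_subset_right),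
    ← Finset.inter_biUnion, Finset.inter_eq_left.2 hS]

/-- The size conditions are imposed block by block, so both the indicator of the family and the
product over S factor over the blocks. -/
lemma sum_blockFamily [DecidableEq ι] (I : Finset ι) (B : ι → Finset α)
    (hB : (I : Set ι).PairwiseDisjoint B) (A : ι → Finset ℕ) (x : α → R) :
    ∑ S ∈ blockFamily I B A, ∏ p ∈ S, x p =
      ∏ i ∈ I, ∑ S ∈ (B i).powerset.filter (fun S => S.card ∈ A i), ∏ p ∈ S, x p := by
  simp_rw [Finset.sum_filter]
  rw [← sum_powerset_biUnion I B hB, blockFamily, Finset.sum_filter]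
  refine Finset.sum_congr rfl fun S hS => ?_
  rw [Finset.mem_powerset] at hS
  split_ifs with h
  · rw [prod_inter_biUnion hB hS]
    exact Finset.prod_congr rfl fun i hi => by rw [if_pos (h i hi)]
  · push Not at h
    obtain ⟨i, hi, hh⟩ := h
    exact (Finset.prod_eq_zero hi (by rw [if_neg hh])).symm

/-- Count the pairs (T, p) with p ∈ T in two ways: each T has n + 1 elements, and removing p leaves
a set of size n avoiding p. -/
lemma esymm_succ_mul (B : Finset α) (n : ℕ) (x : α → R) :
    ((n : R) + 1) * ∑ T ∈ B.powersetCard (n + 1), ∏ p ∈ T, x p =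
      ∑ S ∈ B.powersetCard n, ∑ p ∈ B \ S, (∏ q ∈ S, x q) * x p := by
  have h1 : ((n : R) + 1) * ∑ T ∈ B.powersetCard (n + 1), ∏ p ∈ T, x p =
      ∑ T ∈ B.powersetCard (n + 1), ∑ p ∈ T, (∏ q ∈ T.erase p, x q) * x p := by
    rw [Finset.mul_sum]
    refine Finset.sum_congr rfl fun T hT => ?_
    have hc := (Finset.mem_powersetCard.1 hT).2
    rw [Finset.sum_congr rfl (fun p hp => Finset.prod_erase_mul T x hp), Finset.sum_const, hc]
    simp
  rw [h1, Finset.sum_sigma', Finset.sum_sigma']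
  refine Finset.sum_bij' (fun a _ => ⟨a.1.erase a.2, a.2⟩) (fun a _ => ⟨insert a.2 a.1, a.2⟩)
    ?_ ?_ ?_ ?_ ?_
  · rintro ⟨T, p⟩ h
    simp only [Finset.mem_sigma, Finset.mem_powersetCard, Finset.mem_sdiff] at h ⊢
    refine ⟨⟨(Finset.erase_subset _ _).trans h.1.1, ?_⟩, h.1.1 h.2, by simp⟩
    rw [Finset.card_erase_of_mem h.2, h.1.2]; simp
  · rintro ⟨S, p⟩ h
    simp only [Finset.mem_sigma, Finset.mem_powersetCard, Finset.mem_sdiff] at h ⊢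
    refine ⟨⟨Finset.insert_subset h.2.1 h.1.1, ?_⟩, by simp⟩
    rw [Finset.card_insert_of_notMem h.2.2, h.1.2]
  · rintro ⟨T, p⟩ h
    simp only [Finset.mem_sigma] at h
    simp [Finset.insert_erase h.2]
  · rintro ⟨S, p⟩ h
    simp only [Finset.mem_sigma, Finset.mem_sdiff] at h
    simp [Finset.erase_insert h.2.2]
  · rintro ⟨T, p⟩ _; rfl

end Combinatorics

lemma esymm_succ_le {α : Type*} [DecidableEq α] (B : Finset α) (n : ℕ) (x : α → ℝ)
    (hx : ∀ p ∈ B, 0 ≤ x p) :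
    ((n : ℝ) + 1) * ∑ T ∈ B.powersetCard (n + 1), ∏ p ∈ T, x p ≤
      (∑ S ∈ B.powersetCard n, ∏ p ∈ S, x p) * ∑ p ∈ B, x p := by
  rw [esymm_succ_mul, Finset.sum_mul]
  refine Finset.sum_le_sum fun S hS => ?_
  rw [← Finset.mul_sum]
  refine mul_le_mul_of_nonneg_left (Finset.sum_le_sum_of_subset_of_nonneg Finset.sdiff_subset
    fun p hp _ => hx p hp) (Finset.prod_nonneg fun p hp =>
      hx p ((Finset.mem_powersetCard.1 hS).1 hp))

/-- Excluding from the inner sum the n elements already in S costs at most nM. With `esymm_succ_le`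
this squeezes the elementary symmetric functions when M tends to 0. -/
lemma esymm_succ_ge {α : Type*} [DecidableEq α] (B : Finset α) (n : ℕ) (x : α → ℝ) {M : ℝ}
    (hx : ∀ p ∈ B, 0 ≤ x p) (hM : ∀ p ∈ B, x p ≤ M) :
    (∑ S ∈ B.powersetCard n, ∏ p ∈ S, x p) * (∑ p ∈ B, x p - n * M) ≤
      ((n : ℝ) + 1) * ∑ T ∈ B.powersetCard (n + 1), ∏ p ∈ T, x p := by
  rw [esymm_succ_mul, Finset.sum_mul]
  refine Finset.sum_le_sum fun S hS => ?_
  obtain ⟨hSB, hSc⟩ := Finset.mem_powersetCard.1 hS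
  rw [← Finset.mul_sum]
  refine mul_le_mul_of_nonneg_left ?_ (Finset.prod_nonneg fun p hp => hx p (hSB hp))
  have h1 := Finset.sum_sdiff hSB (f := x)
  have h2 : ∑ p ∈ S, x p ≤ n * M := by
    refine (Finset.sum_le_card_nsmul S x M fun p hp => hM p (hSB hp)).trans ?_
    rw [hSc, nsmul_eq_mul]
  linarith

lemma esymm_le {α : Type*} [DecidableEq α] (B : Finset α) (n : ℕ) (x : α → ℝ)
    (hx : ∀ p ∈ B, 0 ≤ x p) :
    ∑ S ∈ B.powersetCard n, ∏ p ∈ S, x p ≤ (∑ p ∈ B, x p) ^ n / n.factorial := by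
  induction n with
  | zero => simp
  | succ n ih =>
    have h := esymm_succ_le B n x hx
    have hs : 0 ≤ ∑ p ∈ B, x p := Finset.sum_nonneg hx
    have h2 := mul_le_mul_of_nonneg_right ih hs
    rw [Nat.factorial_succ, pow_succ]
    have hf : (0 : ℝ) < n.factorial := by exact_mod_cast n.factorial_pos
    push_cast
    rw [le_div_iff₀ (by positivity)]
    have h3 : (∑ p ∈ B, x p) ^ n / n.factorial * (∑ p ∈ B, x p) * n.factorial =
      (∑ p ∈ B, x p) ^ n * ∑ p ∈ B, x p := by field_simp
    rw [← h3]
    have := mul_le_mul_of_nonneg_right (h.trans h2) hf.le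
    linarith

/-- The convergence of elementary symmetric functions of uniformly small quantities. -/
lemma tendsto_esymm {α : Type*} [DecidableEq α] (B : ℕ → Finset α) (x : ℕ → α → ℝ) (M : ℕ → ℝ)
    (a : ℝ)
    (hx : ∀ᶠ N in atTop, ∀ p ∈ B N, 0 ≤ x N p ∧ x N p ≤ M N) (hM : Tendsto M atTop (nhds 0))
    (ha : Tendsto (fun N => ∑ p ∈ B N, x N p) atTop (nhds a)) (n : ℕ) :
    Tendsto (fun N => ∑ S ∈ (B N).powersetCard n, ∏ p ∈ S, x N p) atTop
      (nhds (a ^ n / n.factorial)) := by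
  induction n with
  | zero => simp
  | succ n ih =>
    have hlim : a ^ (n + 1) / (n + 1).factorial = (a ^ n / n.factorial * a) / ((n : ℝ) + 1) := by
      rw [Nat.factorial_succ, pow_succ]; push_cast
      have hf : (n.factorial : ℝ) ≠ 0 := by exact_mod_cast n.factorial_ne_zero
      field_simp
    rw [hlim]
    have hup := (ih.mul ha).div_const ((n : ℝ) + 1)
    have hlo := (ih.mul (ha.sub (hM.const_mul (n : ℝ)))).div_const ((n : ℝ) + 1)
    rw [mul_zero, sub_zero] at hlo
    refine tendsto_of_tendsto_of_tendsto_of_le_of_le' hlo hup ?_ ?_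
    · filter_upwards [hx] with N hN
      rw [div_le_iff₀ (by positivity), mul_comm _ ((n : ℝ) + 1)]
      exact esymm_succ_ge _ _ _ (fun p hp => (hN p hp).1) (fun p hp => (hN p hp).2)
    · filter_upwards [hx] with N hN
      rw [le_div_iff₀ (by positivity), mul_comm _ ((n : ℝ) + 1)]
      exact esymm_succ_le _ _ _ (fun p hp => (hN p hp).1)

/-! ### The Brun–Hooley sieve -/

/-- The truncated inclusion-exclusion sum. -/
def bonferroni {α : Type*} (B : Finset α) (c : ℕ) (g : α → ℝ) : ℝ :=
  ∑ S ∈ B.powerset.filter (fun S => S.card ≤ c), ∏ p ∈ S, (-g p)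

lemma bonferroni_zero {α : Type*} (B : Finset α) (g : α → ℝ) : bonferroni B 0 g = 1 := by
  unfold bonferroni
  have : B.powerset.filter (fun S => S.card ≤ 0) = {∅} := by
    ext S
    simp only [Finset.mem_filter, Finset.mem_powerset, Nat.le_zero, Finset.card_eq_zero,
      Finset.mem_singleton]
    constructor
    · exact fun h => h.2
    · rintro rfl; simp
  rw [this]; simp

lemma bonferroni_insert {α : Type*} [DecidableEq α] {B : Finset α} {p : α} (hp : p ∉ B) (c : ℕ)
    (g : α → ℝ) :
    bonferroni (insert p B) (c + 1) g = bonferroni B (c + 1) g - g p * bonferroni B c g := by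
  unfold bonferroni
  simp_rw [Finset.sum_filter]
  rw [Finset.sum_powerset_insert hp, Finset.mul_sum, sub_eq_add_neg, ← Finset.sum_neg_distrib]
  congr 1
  refine Finset.sum_congr rfl fun S hS => ?_
  have hpS : p ∉ S := fun h => hp (Finset.mem_powerset.1 hS h)
  rw [Finset.card_insert_of_notMem hpS, Finset.prod_insert hpS]
  simp only [add_le_add_iff_right]
  split_ifs <;> ring

/-- By `bonferroni_insert` the signed error for p together with B at level c + 1 is the one for B at
level c + 1 plus g p times the one for B at level c, so non-negativity passes through an induction
on B. -/
lemma bonferroni_sign {α : Type*} [DecidableEq α] (B : Finset α) (g : α → ℝ)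
    (hg : ∀ p ∈ B, 0 ≤ g p ∧ g p ≤ 1) (c : ℕ) :
    0 ≤ (-1) ^ c * (bonferroni B c g - ∏ p ∈ B, (1 - g p)) := by
  induction B using Finset.induction_on generalizing c with
  | empty =>
    have : bonferroni (∅ : Finset α) c g = 1 := by
      unfold bonferroni
      rw [Finset.powerset_empty, Finset.filter_singleton]; simp
    rw [this]; simp
  | insert p B hp ih =>
    have hgB : ∀ q ∈ B, 0 ≤ g q ∧ g q ≤ 1 := fun q hq => hg q (Finset.mem_insert_of_mem hq)
    have hgp := hg p (Finset.mem_insert_self _ _)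
    cases c with
    | zero =>
      rw [bonferroni_zero]
      have : ∏ q ∈ insert p B, (1 - g q) ≤ 1 := by
        refine Finset.prod_le_one (fun q hq => ?_) (fun q hq => ?_) <;>
        have := hg q hq <;> linarith
      simpa using this
    | succ c =>
      rw [bonferroni_insert hp, Finset.prod_insert hp]
      have h1 := ih hgB (c + 1)
      have h2 := mul_nonneg hgp.1 (ih hgB c)
      have e : (-1 : ℝ) ^ (c + 1) * (bonferroni B (c + 1) g - g p * bonferroni B c g -
          (1 - g p) * ∏ q ∈ B, (1 - g q)) =
          (-1) ^ (c + 1) * (bonferroni B (c + 1) g - ∏ q ∈ B, (1 - g q)) +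
          g p * ((-1) ^ c * (bonferroni B c g - ∏ q ∈ B, (1 - g q))) := by
        rw [pow_succ]; ring
      rw [e]; exact add_nonneg h1 h2

lemma le_bonferroni_even {α : Type*} [DecidableEq α] (B : Finset α) (g : α → ℝ)
    (hg : ∀ p ∈ B, 0 ≤ g p ∧ g p ≤ 1) (b : ℕ) :
    ∏ p ∈ B, (1 - g p) ≤ bonferroni B (2 * b) g := by
  have := bonferroni_sign B g hg (2 * b)
  rw [pow_mul] at this; simpa using this

lemma bonferroni_succ {α : Type*} (B : Finset α) (c : ℕ) (g : α → ℝ) :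
    bonferroni B (c + 1) g =
      bonferroni B c g + (-1) ^ (c + 1) * ∑ S ∈ B.powersetCard (c + 1), ∏ p ∈ S, g p := by
  classical
  unfold bonferroni
  have h : B.powerset.filter (fun S => S.card ≤ c + 1) =
      B.powerset.filter (fun S => S.card ≤ c) ∪ B.powersetCard (c + 1) := by
    ext S
    simp only [Finset.mem_filter, Finset.mem_powerset, Finset.mem_union, Finset.mem_powersetCard]
    constructor
    · rintro ⟨h1, h2⟩
      rcases Nat.le_succ_iff.1 h2 with h | h
      · exact Or.inl ⟨h1, h⟩
      · exact Or.inr ⟨h1, h⟩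
    · rintro (⟨h1, h2⟩ | ⟨h1, h2⟩)
      · exact ⟨h1, by omega⟩
      · exact ⟨h1, by omega⟩
  rw [h, Finset.sum_union, Finset.mul_sum]
  · congr 1
    refine Finset.sum_congr rfl fun S hS => ?_
    rw [Finset.prod_neg, (Finset.mem_powersetCard.1 hS).2]
  · rw [Finset.disjoint_left]
    intro S hS hS'
    have h1 := (Finset.mem_filter.1 hS).2
    have h2 := (Finset.mem_powersetCard.1 hS').2
    omega

/-- One further term makes the sum a lower bound, so the excess is at most the first omitted
symmetric function. -/
lemma bonferroni_even_le {α : Type*} [DecidableEq α] (B : Finset α) (g : α → ℝ)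
    (hg : ∀ p ∈ B, 0 ≤ g p ∧ g p ≤ 1) (b : ℕ) :
    bonferroni B (2 * b) g ≤ ∏ p ∈ B, (1 - g p) +
      (∑ p ∈ B, g p) ^ (2 * b + 1) / (2 * b + 1).factorial := by
  have h := bonferroni_sign B g hg (2 * b + 1)
  have h2 := bonferroni_succ B (2 * b) g
  have h3 := esymm_le B (2 * b + 1) g (fun p hp => (hg p hp).1)
  have e : (-1 : ℝ) ^ (2 * b + 1) = -1 := by rw [pow_succ, pow_mul]; simp
  rw [e] at h h2
  linarith

lemma bonferroni_of_card_le {α : Type*} [DecidableEq α] (B : Finset α) (c : ℕ) (g : α → ℝ)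
    (hc : B.card ≤ c) : bonferroni B c g = ∏ p ∈ B, (1 - g p) := by
  unfold bonferroni
  rw [Finset.filter_true_of_mem fun S hS =>
    (Finset.card_le_card (Finset.mem_powerset.1 hS)).trans hc]
  simp_rw [sub_eq_add_neg]
  rw [Finset.prod_one_add]

/-- The blocks of primes of the Brun–Hooley sieve: the primes up to `D`, followed by the primes
above `D` in the intervals `(z ^ (1 / 2 ^ (i + 1)), z ^ (1 / 2 ^ i)]`. -/
noncomputable def bhBlock (D z : ℝ) : ℕ → Finset ℕ
  | 0 => primesIoc 0 D
  | (i + 1) => primesIoc (max D (z ^ ((1 / 2 : ℝ) ^ (i + 1)))) (z ^ ((1 / 2 : ℝ) ^ i))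

/-- The admissible number of prime factors in each block. -/
noncomputable def bhCap (D : ℝ) (b : ℕ) : ℕ → ℕ
  | 0 => (primesIoc 0 D).card
  | (i + 1) => 2 * (b + i + 1)

/-- The support of the Brun–Hooley sieve weights. -/
noncomputable def bhFamily (D z : ℝ) (b r : ℕ) : Finset (Finset ℕ) :=
  blockFamily (Finset.range (r + 1)) (bhBlock D z) (fun i => Finset.range (bhCap D b i + 1))

lemma mem_bhBlock_succ {D z : ℝ} (hD : 0 ≤ D) {i p : ℕ} :
    p ∈ bhBlock D z (i + 1) ↔ p.Prime ∧ D < p ∧ z ^ ((1 / 2 : ℝ) ^ (i + 1)) < p ∧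
      (p : ℝ) ≤ z ^ ((1 / 2 : ℝ) ^ i) := by
  unfold bhBlock
  rw [mem_primesIoc (hD.trans (le_max_left _ _)), max_lt_iff]
  tauto

lemma rpow_half_pow_anti {z : ℝ} (hz : 1 ≤ z) {i j : ℕ} (h : i ≤ j) :
    z ^ ((1 / 2 : ℝ) ^ j) ≤ z ^ ((1 / 2 : ℝ) ^ i) :=
  Real.rpow_le_rpow_of_exponent_le hz (pow_le_pow_of_le_one (by norm_num) (by norm_num) h)

lemma bhBlock_disjoint {D z : ℝ} (hD : 0 ≤ D) (hz : 1 ≤ z) (I : Set ℕ) :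
    I.PairwiseDisjoint (bhBlock D z) := by
  have key : ∀ i j : ℕ, i < j → Disjoint (bhBlock D z i) (bhBlock D z j) := by
    intro i j hij
    rw [Finset.disjoint_left]
    intro p hi hj
    obtain ⟨j, rfl⟩ : ∃ j', j = j' + 1 := ⟨j - 1, by omega⟩
    rw [mem_bhBlock_succ hD] at hj
    cases i with
    | zero =>
      have := ((mem_primesIoc le_rfl).1 hi).2.2
      linarith [hj.2.1]
    | succ i =>
      rw [mem_bhBlock_succ hD] at hi
      have := rpow_half_pow_anti hz (show i + 1 ≤ j by omega)
      linarith [hi.2.2.1, hj.2.2.2]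
  intro i _ j _ hij
  rcases lt_or_gt_of_ne hij with h | h
  · exact key i j h
  · exact (key j i h).symm

lemma biUnion_bhBlock {D z : ℝ} (hD : 0 ≤ D) (hz : 1 ≤ z) (hDz : D ≤ z) {r : ℕ}
    (hr : z ^ ((1 / 2 : ℝ) ^ r) ≤ D) :
    (Finset.range (r + 1)).biUnion (bhBlock D z) = primesIoc 0 z := by
  ext p
  rw [Finset.mem_biUnion, mem_primesIoc le_rfl]
  constructor
  · rintro ⟨i, _, hi⟩
    cases i with
    | zero =>
      have := (mem_primesIoc le_rfl).1 hi
      exact ⟨this.1, this.2.1, this.2.2.trans hDz⟩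
    | succ i =>
      rw [mem_bhBlock_succ hD] at hi
      refine ⟨hi.1, by exact_mod_cast hi.1.pos, hi.2.2.2.trans ?_⟩
      simpa using rpow_half_pow_anti hz (Nat.zero_le i)
  · rintro ⟨hp, hp0, hpz⟩
    by_cases hpD : (p : ℝ) ≤ D
    · exact ⟨0, by simp, (mem_primesIoc le_rfl).2 ⟨hp, hp0, hpD⟩⟩
    · push Not at hpD
      -- The least i with z^(1/2^i) < p is positive and identifies the block of p.
      have hex : ∃ i, z ^ ((1 / 2 : ℝ) ^ i) < p := ⟨r, by linarith⟩
      have hs := Nat.find_spec hex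
      have hr' : Nat.find hex ≤ r := Nat.find_min' hex (by linarith)
      have h0 : Nat.find hex ≠ 0 := by
        intro h; rw [h] at hs; simp at hs; linarith
      obtain ⟨i, hi⟩ := Nat.exists_eq_succ_of_ne_zero h0
      rw [hi] at hs hr'
      have hmin := Nat.find_min hex (m := i) (by omega)
      exact ⟨i + 1, by simp; omega,
        (mem_bhBlock_succ hD).2 ⟨hp, hpD, hs, not_lt.1 hmin⟩⟩

lemma sum_bhFamily {D z : ℝ} (hD : 0 ≤ D) (hz : 1 ≤ z) (b r : ℕ) (g : ℕ → ℝ) :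
    ∑ e ∈ bhFamily D z b r, ∏ p ∈ e, (-g p) =
      ∏ i ∈ Finset.range (r + 1), bonferroni (bhBlock D z i) (bhCap D b i) g := by
  unfold bhFamily
  rw [sum_blockFamily _ _ (bhBlock_disjoint hD hz _)]
  refine Finset.prod_congr rfl fun i _ => ?_
  unfold bonferroni
  simp only [Finset.mem_range, Nat.lt_succ_iff]

lemma bhCap_bonferroni_le {D z : ℝ} (b : ℕ) (g : ℕ → ℝ) (i : ℕ)
    (hg : ∀ p ∈ bhBlock D z i, 0 ≤ g p ∧ g p ≤ 1) :
    ∏ p ∈ bhBlock D z i, (1 - g p) ≤ bonferroni (bhBlock D z i) (bhCap D b i) g := by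
  cases i with
  | zero => exact (bonferroni_of_card_le _ _ _ (le_of_eq rfl)).ge
  | succ i => exact le_bonferroni_even _ _ hg _

lemma one_sub_ge_exp {x : ℝ} (h0 : 0 ≤ x) (h1 : x ≤ 1 / 2) : Real.exp (-(2 * x)) ≤ 1 - x := by
  rw [Real.exp_neg, inv_le_iff_one_le_mul₀ (Real.exp_pos _)]
  have := Real.add_one_le_exp (2 * x)
  nlinarith

lemma prod_one_sub_ge_exp {α : Type*} (B : Finset α) (g : α → ℝ) {Λ : ℝ}
    (hg : ∀ p ∈ B, 0 ≤ g p ∧ g p ≤ 1 / 2) (hs : ∑ p ∈ B, g p ≤ Λ) :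
    Real.exp (-(2 * Λ)) ≤ ∏ p ∈ B, (1 - g p) := by
  calc Real.exp (-(2 * Λ)) ≤ Real.exp (∑ p ∈ B, -(2 * g p)) := by
        apply Real.exp_le_exp.2
        rw [Finset.sum_neg_distrib, ← Finset.mul_sum]; linarith
    _ = ∏ p ∈ B, Real.exp (-(2 * g p)) := Real.exp_sum _ _
    _ ≤ _ := Finset.prod_le_prod (fun _ _ => (Real.exp_pos _).le)
        (fun p hp => one_sub_ge_exp (hg p hp).1 (hg p hp).2)

/-- The additive excess t becomes a factor: the product is at least exp(−2Λ), so t is at most the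
product times exp(2Λ) t. A multiplicative error can be accumulated over blocks. -/
lemma bonferroni_even_le_mul {α : Type*} [DecidableEq α] (B : Finset α) (g : α → ℝ) {Λ : ℝ}
    (hg : ∀ p ∈ B, 0 ≤ g p ∧ g p ≤ 1 / 2) (hs : ∑ p ∈ B, g p ≤ Λ) (b : ℕ) :
    bonferroni B (2 * b) g ≤ (∏ p ∈ B, (1 - g p)) *
      Real.exp (Real.exp (2 * Λ) * (Λ ^ (2 * b + 1) / (2 * b + 1).factorial)) := by
  have h1 := bonferroni_even_le B g (fun p hp => ⟨(hg p hp).1, by linarith [(hg p hp).2]⟩) b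
  have h2 := prod_one_sub_ge_exp B g hg hs
  have hs0 : 0 ≤ ∑ p ∈ B, g p := Finset.sum_nonneg fun p hp => (hg p hp).1
  set V := ∏ p ∈ B, (1 - g p)
  set t := Λ ^ (2 * b + 1) / ((2 * b + 1).factorial : ℝ) with ht
  have ht0 : 0 ≤ t := by
    have : 0 ≤ Λ := hs0.trans hs
    positivity
  have h3 : (∑ p ∈ B, g p) ^ (2 * b + 1) / (2 * b + 1).factorial ≤ t := by
    rw [ht]; gcongr
  have h4 : t ≤ V * (Real.exp (2 * Λ) * t) := by
    have e : Real.exp (-(2 * Λ)) * (Real.exp (2 * Λ) * t) = t := by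
      rw [← mul_assoc, ← Real.exp_add]; simp
    calc t = Real.exp (-(2 * Λ)) * (Real.exp (2 * Λ) * t) := e.symm
      _ ≤ _ := mul_le_mul_of_nonneg_right h2 (by positivity)
  have hV : 0 ≤ V := (Real.exp_pos _).le.trans h2
  have h5 := mul_le_mul_of_nonneg_left (Real.add_one_le_exp (Real.exp (2 * Λ) * t)) hV
  linarith

lemma sum_bhCap (b r : ℕ) :
    ∑ i ∈ Finset.range r, (2 * (b + i + 1) : ℝ) * (1 / 2) ^ i ≤ 4 * b + 8 := by
  have h : ∑ i ∈ Finset.range r, (2 * (b + i + 1) : ℝ) * (1 / 2) ^ i =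
      4 * b + 8 - (4 * b + 4 * r + 8) * (1 / 2) ^ r := by
    induction r with
    | zero => simp
    | succ r ih => rw [Finset.sum_range_succ, ih, pow_succ]; push_cast; ring
  rw [h]
  have : (0 : ℝ) ≤ (4 * b + 4 * r + 8) * (1 / 2) ^ r := by positivity
  linarith

/-- Block i + 1 contributes at most 2(b + i + 1) primes, each at most z^(1/2^i): the caps grow
linearly while the exponents halve, so the total exponent converges. -/
lemma prod_le_of_mem_bhFamily {D z : ℝ} (hD : 1 ≤ D) (hz : 1 ≤ z) {b r : ℕ} {e : Finset ℕ}
    (he : e ∈ bhFamily D z b r) :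
    ∏ p ∈ e, (p : ℝ) ≤ D ^ (primesIoc 0 D).card * z ^ (4 * b + 8 : ℝ) := by
  rw [bhFamily, mem_blockFamily] at he
  rw [prod_inter_biUnion (bhBlock_disjoint (by linarith) hz _) he.1, Finset.prod_range_succ',
    mul_comm]
  have hz0 : 0 < z := by linarith
  refine mul_le_mul ?_ ?_ (Finset.prod_nonneg fun _ _ => Finset.prod_nonneg fun _ _ => by
    positivity) (by positivity)
  · calc _ ≤ ∏ p ∈ e ∩ bhBlock D z 0, D := Finset.prod_le_prod (fun _ _ => by positivity)
          (fun p hp => ((mem_primesIoc le_rfl).1 (Finset.mem_inter.1 hp).2).2.2)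
      _ = D ^ (e ∩ bhBlock D z 0).card := by rw [Finset.prod_const]
      _ ≤ _ := pow_le_pow_right₀ hD (Finset.card_le_card Finset.inter_subset_right)
  · calc _ ≤ ∏ i ∈ Finset.range r, z ^ ((2 * (b + i + 1) : ℝ) * (1 / 2) ^ i) := by
          refine Finset.prod_le_prod (fun _ _ => Finset.prod_nonneg fun _ _ => by positivity)
            fun i hi => ?_
          have hc := he.2 (i + 1) (by simp at hi ⊢; omega)
          simp only [bhCap, Finset.mem_range, Nat.lt_succ_iff] at hc
          have h1 : 1 ≤ z ^ ((1 / 2 : ℝ) ^ i) := Real.one_le_rpow hz (by positivity)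
          calc _ ≤ ∏ p ∈ e ∩ bhBlock D z (i + 1), z ^ ((1 / 2 : ℝ) ^ i) :=
                Finset.prod_le_prod (fun _ _ => by positivity) (fun p hp =>
                  ((mem_bhBlock_succ (by linarith)).1 (Finset.mem_inter.1 hp).2).2.2.2)
            _ = (z ^ ((1 / 2 : ℝ) ^ i)) ^ (e ∩ bhBlock D z (i + 1)).card := by
                rw [Finset.prod_const]
            _ ≤ (z ^ ((1 / 2 : ℝ) ^ i)) ^ (2 * (b + i + 1)) := pow_le_pow_right₀ h1 hc
            _ = _ := by
              rw [← Real.rpow_natCast, ← Real.rpow_mul hz0.le]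
              congr 1; push_cast; ring
      _ = z ^ (∑ i ∈ Finset.range r, (2 * (b + i + 1) : ℝ) * (1 / 2) ^ i) :=
          (Real.rpow_sum_of_pos hz0 _ _).symm
      _ ≤ _ := Real.rpow_le_rpow_of_exponent_le hz (sum_bhCap b r)

lemma exists_tail_exp_le (Λ : ℝ) (hΛ : 0 ≤ Λ) {δ : ℝ} (hδ : 0 < δ) : ∃ b : ℕ, ∀ r : ℕ,
    ∑ i ∈ Finset.range r, Λ ^ (2 * (b + i + 1) + 1) / ((2 * (b + i + 1) + 1).factorial : ℝ) ≤ δ := by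
  have hs := Real.summable_pow_div_factorial Λ
  have ht := tendsto_sum_nat_add (fun n : ℕ => Λ ^ n / (n.factorial : ℝ))
  obtain ⟨b, hb⟩ := (ht.eventually (gt_mem_nhds hδ)).exists
  refine ⟨b, fun r => le_trans ?_ hb.le⟩
  -- The index 2(b + i + 1) + 1 is m + b with m = b + 2i + 3, so the terms are distinct members of
  -- the exponential series shifted by b.
  have hinj : Set.InjOn (fun i : ℕ => b + 2 * i + 3) (Finset.range r : Set ℕ) := by
    intro a _ c _ h; simp at h; exact h
  have h1 : ∑ i ∈ Finset.range r,
      Λ ^ (2 * (b + i + 1) + 1) / ((2 * (b + i + 1) + 1).factorial : ℝ) =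
      ∑ m ∈ (Finset.range r).image (fun i => b + 2 * i + 3),
        Λ ^ (m + b) / ((m + b).factorial : ℝ) := by
    rw [Finset.sum_image hinj]
    refine Finset.sum_congr rfl fun i _ => ?_
    rw [show b + 2 * i + 3 + b = 2 * (b + i + 1) + 1 by ring]
  rw [h1]
  exact ((summable_nat_add_iff b).2 hs).sum_le_tsum _ (fun _ _ => by positivity)

/-- The Brun–Hooley sieve: non-negative upper bound sieve weights of level a power of `z`, which
are uniformly close to optimal in dimension `k`. -/
theorem exists_brun_hooley_weights (k : ℕ) {η : ℝ} (hη : 0 < η) : ∃ s : ℝ, 0 < s ∧ ∀ᶠ z : ℝ in atTop,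
    ∃ 𝒟 : Finset (Finset ℕ),
      (∀ e ∈ 𝒟, e ⊆ primesIoc 0 z ∧ ∏ p ∈ e, (p : ℝ) ≤ z ^ s) ∧
      (∀ g : ℕ → ℝ, (∀ p ∈ primesIoc 0 z, 0 ≤ g p ∧ g p ≤ 1) →
        ∏ p ∈ primesIoc 0 z, (1 - g p) ≤ ∑ e ∈ 𝒟, ∏ p ∈ e, (-g p)) ∧
      (∀ g : ℕ → ℝ, (∀ p ∈ primesIoc 0 z, 0 ≤ g p ∧ g p ≤ 1 ∧ g p ≤ k / p) →
        ∑ e ∈ 𝒟, ∏ p ∈ e, (-g p) ≤ (1 + η) * ∏ p ∈ primesIoc 0 z, (1 - g p)) := by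
  obtain ⟨C, hC, hM⟩ := mertens_second
  have hl2 : 0 < Real.log 2 := Real.log_pos (by norm_num)
  -- Λ bounds the sum of g over one block: a block lies in some (w, w²], where Mertens gives Σ 1/p ≤
  -- log 2 + C/log 2.
  set Λ : ℝ := k * (Real.log 2 + C / Real.log 2) with hΛ
  have hΛ0 : 0 ≤ Λ := by positivity
  -- Beyond D the bound g p ≤ k/p forces g p ≤ 1/2. The primes up to D, where g may be near 1,
  -- receive exact inclusion-exclusion.
  set D : ℝ := 2 * k + 2 with hD
  have hD2 : 2 ≤ D := by rw [hD]; linarith [show (0 : ℝ) ≤ k by positivity]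
  obtain ⟨b, hb⟩ := exists_tail_exp_le Λ hΛ0
    (δ := Real.log (1 + η) / Real.exp (2 * Λ)) (div_pos (Real.log_pos (by linarith)) (Real.exp_pos _))
  -- The blocks above D use exponent 4b + 8; one more factor z absorbs the bounded contribution of
  -- the primes up to D.
  refine ⟨4 * b + 9, by positivity, ?_⟩
  filter_upwards [eventually_ge_atTop D, eventually_ge_atTop (D ^ (primesIoc 0 D).card)]
    with z hzD hzc
  have hz1 : 1 ≤ z := by linarith
  have hz0 : 0 < z := by linarith
  obtain ⟨r, hr⟩ : ∃ r : ℕ, z ^ ((1 / 2 : ℝ) ^ r) ≤ D := by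
    have h1 : Tendsto (fun r : ℕ => z ^ ((1 / 2 : ℝ) ^ r)) atTop (nhds (z ^ (0 : ℝ))) :=
      (Real.continuousAt_const_rpow hz0.ne').tendsto.comp
        (tendsto_pow_atTop_nhds_zero_of_lt_one (by norm_num) (by norm_num))
    rw [Real.rpow_zero] at h1
    exact ((h1.eventually (ge_mem_nhds (show (1 : ℝ) < D by linarith)))).exists
  have hU := biUnion_bhBlock (by linarith) hz1 hzD hr
  have hdisj := bhBlock_disjoint (D := D) (by linarith) hz1 (Finset.range (r + 1) : Set ℕ)
  have hmem : ∀ i ∈ Finset.range (r + 1), ∀ p ∈ bhBlock D z i, p ∈ primesIoc 0 z := by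
    intro i hi p hp
    rw [← hU]; exact Finset.mem_biUnion.2 ⟨i, hi, hp⟩
  have hprod : ∀ g : ℕ → ℝ, ∏ p ∈ primesIoc 0 z, (1 - g p) =
      ∏ i ∈ Finset.range (r + 1), ∏ p ∈ bhBlock D z i, (1 - g p) := by
    intro g
    rw [← hU, Finset.prod_biUnion hdisj]
  refine ⟨bhFamily D z b r, fun e he => ⟨?_, ?_⟩, fun g hg => ?_, fun g hg => ?_⟩
  · rw [bhFamily, mem_blockFamily, hU] at he
    exact he.1
  · refine (prod_le_of_mem_bhFamily (by linarith) hz1 he).trans ?_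
    calc _ ≤ z * z ^ (4 * b + 8 : ℝ) := mul_le_mul_of_nonneg_right hzc (by positivity)
      _ = _ := by
        rw [show (4 * b + 9 : ℝ) = 1 + (4 * b + 8) by ring, Real.rpow_add hz0 1, Real.rpow_one]
  -- A product of upper bounds for non-negative factors is an upper bound: this is Hooley's device,
  -- replacing a global truncation by one in each block.
  · rw [sum_bhFamily (by linarith) hz1, hprod]
    refine Finset.prod_le_prod (fun i hi => Finset.prod_nonneg fun p hp => ?_) fun i hi =>
      bhCap_bonferroni_le b g i fun p hp => hg p (hmem i hi p hp)
    linarith [(hg p (hmem i hi p hp)).2]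
  · rw [sum_bhFamily (by linarith) hz1, hprod, Finset.prod_range_succ', Finset.prod_range_succ']
    have hV0 : ∀ i ∈ Finset.range (r + 1), 0 ≤ ∏ p ∈ bhBlock D z i, (1 - g p) := fun i hi =>
      Finset.prod_nonneg fun p hp => by linarith [(hg p (hmem i hi p hp)).2.1]
    have h0 : bonferroni (bhBlock D z 0) (bhCap D b 0) g = ∏ p ∈ bhBlock D z 0, (1 - g p) :=
      bonferroni_of_card_le _ _ _ (le_of_eq rfl)
    rw [h0, ← mul_assoc]
    refine mul_le_mul_of_nonneg_right ?_ (hV0 0 (by simp))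
    have hstep : ∀ i ∈ Finset.range r, bonferroni (bhBlock D z (i + 1)) (bhCap D b (i + 1)) g ≤
        (∏ p ∈ bhBlock D z (i + 1), (1 - g p)) * Real.exp (Real.exp (2 * Λ) *
          (Λ ^ (2 * (b + i + 1) + 1) / ((2 * (b + i + 1) + 1).factorial : ℝ))) := by
      intro i hi
      have hi' : i + 1 ∈ Finset.range (r + 1) := by simp at hi ⊢; omega
      refine bonferroni_even_le_mul _ g (fun p hp => ⟨(hg p (hmem _ hi' p hp)).1, ?_⟩) ?_ _
      · have hp' := (mem_bhBlock_succ (by linarith)).1 hp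
        refine (hg p (hmem _ hi' p hp)).2.2.trans ?_
        have hp0 : (0 : ℝ) < p := by exact_mod_cast hp'.1.pos
        rw [div_le_iff₀ hp0]
        linarith [hp'.2.1]
      · have h1 : ∑ p ∈ bhBlock D z (i + 1), g p ≤ k * ∑ p ∈ bhBlock D z (i + 1), (1 : ℝ) / p := by
          rw [Finset.mul_sum]
          refine Finset.sum_le_sum fun p hp => ?_
          rw [mul_one_div]
          exact (hg p (hmem _ hi' p hp)).2.2
        refine h1.trans (mul_le_mul_of_nonneg_left ?_ (by positivity))
        set w : ℝ := max D (z ^ ((1 / 2 : ℝ) ^ (i + 1))) with hw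
        have hw2 : 2 ≤ w := hD2.trans (le_max_left _ _)
        have hsub : bhBlock D z (i + 1) ⊆ (Finset.Ioc ⌊w⌋₊ ⌊w ^ 2⌋₊).filter Nat.Prime := by
          change primesIoc w _ ⊆ primesIoc w (w ^ 2)
          intro p hp
          rw [mem_primesIoc (by linarith)] at hp ⊢
          refine ⟨hp.1, hp.2.1, hp.2.2.trans ?_⟩
          have e : z ^ ((1 / 2 : ℝ) ^ i) = (z ^ ((1 / 2 : ℝ) ^ (i + 1))) ^ 2 := by
            rw [← Real.rpow_mul_natCast hz0.le, pow_succ]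
            congr 1; push_cast; ring
          rw [e]
          exact pow_le_pow_left₀ (by positivity) (le_max_right _ _) 2
        have hlw : Real.log 2 ≤ Real.log w := Real.log_le_log (by norm_num) hw2
        have h2 := (abs_le.1 (hM w (w ^ 2) hw2 (by nlinarith))).2
        have e2 : Real.log (w ^ 2) / Real.log w = 2 := by
          rw [Real.log_pow]; push_cast
          exact mul_div_cancel_right₀ _ (by linarith)
        rw [e2] at h2
        have h3 : C / Real.log w ≤ C / Real.log 2 := div_le_div_of_nonneg_left hC hl2 hlw
        have h4 := Finset.sum_le_sum_of_subset_of_nonneg hsub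
          (f := fun p : ℕ => (1 : ℝ) / p) (fun _ _ _ => by positivity)
        linarith
    calc _ ≤ ∏ i ∈ Finset.range r, (∏ p ∈ bhBlock D z (i + 1), (1 - g p)) *
          Real.exp (Real.exp (2 * Λ) *
          (Λ ^ (2 * (b + i + 1) + 1) / ((2 * (b + i + 1) + 1).factorial : ℝ))) := by
          refine Finset.prod_le_prod (fun i hi => ?_) hstep
          have hi' : i + 1 ∈ Finset.range (r + 1) := by simp at hi ⊢; omega
          refine (hV0 _ hi').trans (bhCap_bonferroni_le b g _ fun p hp => ?_)
          have := hg p (hmem _ hi' p hp)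
          exact ⟨this.1, this.2.1⟩
      _ = (∏ i ∈ Finset.range r, ∏ p ∈ bhBlock D z (i + 1), (1 - g p)) *
          Real.exp (Real.exp (2 * Λ) * ∑ i ∈ Finset.range r,
          (Λ ^ (2 * (b + i + 1) + 1) / ((2 * (b + i + 1) + 1).factorial : ℝ))) := by
          rw [Finset.prod_mul_distrib, Finset.mul_sum, Real.exp_sum]
      _ ≤ _ := by
        rw [mul_comm]
        refine mul_le_mul_of_nonneg_right ?_ (Finset.prod_nonneg fun i hi =>
          hV0 _ (by simp at hi ⊢; omega))
        have h5 := hb r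
        rw [le_div_iff₀ (Real.exp_pos _)] at h5
        calc _ ≤ Real.exp (Real.log (1 + η)) := Real.exp_le_exp.2 (by linarith)
          _ = 1 + η := Real.exp_log (by linarith)

/-! ### Residue classes to square-free moduli -/

lemma squarefree_prod_primes {Q : Finset ℕ} (hQ : ∀ p ∈ Q, p.Prime) : Squarefree (∏ p ∈ Q, p) := by
  refine Finset.squarefree_prod_of_pairwise_isCoprime (fun p hp q hq hpq => ?_)
    fun p hp => (hQ p hp).squarefree
  simp only [Function.onFun, ← Nat.coprime_iff_isRelPrime]
  exact (Nat.coprime_primes (hQ p hp) (hQ q hq)).2 hpq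

lemma prod_primes_pos {Q : Finset ℕ} (hQ : ∀ p ∈ Q, p.Prime) : 0 < ∏ p ∈ Q, p :=
  Finset.prod_pos fun p hp => (hQ p hp).pos

lemma coprime_prod_primes {Q : Finset ℕ} {p : ℕ} (hQ : ∀ q ∈ Q, q.Prime) (hp : p.Prime)
    (hpQ : p ∉ Q) : p.Coprime (∏ q ∈ Q, q) :=
  Nat.Coprime.prod_right fun q hq => (Nat.coprime_primes hp (hQ q hq)).2
    (by rintro rfl; exact hpQ hq)

lemma totient_prod_primes {Q : Finset ℕ} (hQ : ∀ p ∈ Q, p.Prime) :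
    Nat.totient (∏ p ∈ Q, p) = ∏ p ∈ Q, (p - 1) := by
  induction Q using Finset.induction_on with
  | empty => simp
  | insert p Q hp ih =>
    have hQ' : ∀ q ∈ Q, q.Prime := fun q hq => hQ q (Finset.mem_insert_of_mem hq)
    have hpp := hQ p (Finset.mem_insert_self _ _)
    rw [Finset.prod_insert hp, Finset.prod_insert hp,
      Nat.totient_mul (coprime_prod_primes hQ' hpp hp), ih hQ', Nat.totient_prime hpp]

lemma card_filter_range_zmod {p : ℕ} (hp : 0 < p) (S : Finset (ZMod p)) :
    ((Finset.range p).filter (fun r : ℕ => (r : ZMod p) ∈ S)).card = S.card := by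
  have : NeZero p := ⟨hp.ne'⟩
  refine Finset.card_nbij' (fun r => (r : ZMod p)) (fun a => a.val) ?_ ?_ ?_ ?_
  · intro r hr; simp at hr ⊢; exact hr.2
  · intro a ha; simp at ha ⊢; exact ⟨ZMod.val_lt a, ha⟩
  · intro r hr; simp at hr ⊢; exact Nat.mod_eq_of_lt hr.1
  · intro a _; simp

/-- The Chinese remainder theorem, as a count of residue classes. -/
lemma card_residues {Q : Finset ℕ} (hQ : ∀ p ∈ Q, p.Prime) (S : (p : ℕ) → Finset (ZMod p)) :
    ((Finset.range (∏ p ∈ Q, p)).filter (fun r : ℕ => ∀ p ∈ Q, (r : ZMod p) ∈ S p)).card =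
      ∏ p ∈ Q, (S p).card := by
  induction Q using Finset.induction_on with
  | empty => simp
  | insert p Q hp ih =>
    have hQ' : ∀ q ∈ Q, q.Prime := fun q hq => hQ q (Finset.mem_insert_of_mem hq)
    have hpp := hQ p (Finset.mem_insert_self _ _)
    have hco := coprime_prod_primes hQ' hpp hp
    rw [Finset.prod_insert hp, Finset.prod_insert hp, ← ih hQ',
      ← card_filter_range_zmod hpp.pos (S p), ← Finset.card_product]
    set q := ∏ q ∈ Q, q
    have hq : 0 < q := prod_primes_pos hQ'
    have hcast : ∀ {l a b : ℕ}, a ≡ b [MOD l] → (a : ZMod l) = b := fun h =>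
      (ZMod.natCast_eq_natCast_iff _ _ _).2 h
    refine Finset.card_nbij' (fun r => (r % p, r % q))
      (fun a => (Nat.chineseRemainder hco a.1 a.2 : ℕ)) ?_ ?_ ?_ ?_
    · intro r hr
      simp only [Finset.coe_filter, Finset.mem_range, Finset.mem_insert, forall_eq_or_imp,
        Set.mem_ofPred_eq] at hr
      simp only [Finset.coe_product, Set.mem_prod, Finset.coe_filter, Finset.mem_range,
        Set.mem_ofPred_eq]
      refine ⟨⟨Nat.mod_lt _ hpp.pos, ?_⟩, Nat.mod_lt _ hq, fun l hl => ?_⟩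
      · rw [hcast (Nat.mod_modEq r p)]; exact hr.2.1
      · rw [hcast ((Nat.mod_modEq r q).of_dvd (Finset.dvd_prod_of_mem _ hl))]; exact hr.2.2 l hl
    · intro a ha
      simp only [Finset.coe_product, Set.mem_prod, Finset.coe_filter, Finset.mem_range,
        Set.mem_ofPred_eq] at ha
      simp only [Finset.coe_filter, Finset.mem_range, Finset.mem_insert, forall_eq_or_imp,
        Set.mem_ofPred_eq]
      have h := (Nat.chineseRemainder hco a.1 a.2).2
      refine ⟨Nat.chineseRemainder_lt_mul hco _ _ hpp.ne_zero hq.ne', ?_, fun l hl => ?_⟩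
      · rw [hcast h.1]; exact ha.1.2
      · rw [hcast (h.2.of_dvd (Finset.dvd_prod_of_mem _ hl))]; exact ha.2.2 l hl
    · intro r hr
      simp only [Finset.coe_filter, Finset.mem_range, Set.mem_ofPred_eq] at hr
      have h := (Nat.chineseRemainder hco (r % p) (r % q)).2
      have h2 := (Nat.modEq_and_modEq_iff_modEq_mul hco).1
        ⟨h.1.trans (Nat.mod_modEq r p), h.2.trans (Nat.mod_modEq r q)⟩
      exact Nat.ModEq.eq_of_lt_of_lt h2
        (Nat.chineseRemainder_lt_mul hco _ _ hpp.ne_zero hq.ne') hr.1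
    · intro a ha
      simp only [Finset.coe_product, Set.mem_prod, Finset.coe_filter, Finset.mem_range,
        Set.mem_ofPred_eq] at ha
      have h := (Nat.chineseRemainder hco a.1 a.2).2
      refine Prod.ext ?_ ?_
      · exact Eq.trans h.1 (Nat.mod_eq_of_lt ha.1.1)
      · exact Eq.trans h.2 (Nat.mod_eq_of_lt ha.2.1)

lemma abs_card_Ioc_modEq_sub_le {a b : ℤ} (hab : a ≤ b) {q : ℕ} (hq : 0 < q) (v : ℤ) :
    |(((Finset.Ioc a b).filter (fun x : ℤ => x ≡ v [ZMOD (q : ℤ)])).card : ℝ) -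
      ((b : ℝ) - a) / q| ≤ 1 := by
  have hq' : (0 : ℤ) < q := by exact_mod_cast hq
  have hqR : (0 : ℝ) < q := by exact_mod_cast hq
  have hqQ : (0 : ℚ) < q := by exact_mod_cast hq
  have h := Int.Ioc_filter_modEq_card a b hq' v
  have hle : ⌊((a : ℚ) - v) / ((q : ℤ) : ℚ)⌋ ≤ ⌊((b : ℚ) - v) / ((q : ℤ) : ℚ)⌋ := by
    apply Int.floor_le_floor
    have : (a : ℚ) ≤ b := by exact_mod_cast hab
    push_cast
    gcongr
  rw [max_eq_left (by linarith)] at h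
  set m := ⌊((a : ℚ) - v) / ((q : ℤ) : ℚ)⌋ with hm
  set n := ⌊((b : ℚ) - v) / ((q : ℤ) : ℚ)⌋ with hn
  have h1 := Int.floor_le (((a : ℚ) - v) / ((q : ℤ) : ℚ))
  have h2 := Int.lt_floor_add_one (((a : ℚ) - v) / ((q : ℤ) : ℚ))
  have h3 := Int.floor_le (((b : ℚ) - v) / ((q : ℤ) : ℚ))
  have h4 := Int.lt_floor_add_one (((b : ℚ) - v) / ((q : ℤ) : ℚ))
  rw [← hm] at h1 h2
  rw [← hn] at h3 h4
  have key : |(((n - m : ℤ)) : ℚ) - ((b : ℚ) - a) / q| ≤ 1 := by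
    have e : ((b : ℚ) - a) / q = ((b : ℚ) - v) / ((q : ℤ) : ℚ) - ((a : ℚ) - v) / ((q : ℤ) : ℚ) := by
      push_cast; ring
    rw [e, abs_le]; push_cast at *
    constructor <;> linarith
  have e2 : (((Finset.Ioc a b).filter (fun x : ℤ => x ≡ v [ZMOD (q : ℤ)])).card : ℝ) =
      ((n - m : ℤ) : ℝ) := by rw [← h]; simp
  rw [e2]
  exact_mod_cast key

lemma intCast_zmod_eq_of_modEq {Q : Finset ℕ} {p : ℕ} (hp : p ∈ Q) {a b : ℤ}
    (h : a ≡ b [ZMOD ((∏ p ∈ Q, p : ℕ) : ℤ)]) : (a : ZMod p) = b :=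
  (ZMod.intCast_eq_intCast_iff _ _ _).2
    (h.of_dvd (by exact_mod_cast Finset.dvd_prod_of_mem (fun p => p) hp))

/-- Every integer lies in exactly one of the residue classes `r mod q`, `0 ≤ r < q`. -/
lemma emod_toNat {q : ℕ} (hq : 0 < q) (m : ℤ) :
    (m % q).toNat < q ∧ m ≡ ((m % q).toNat : ℤ) [ZMOD (q : ℤ)] := by
  have hq' : (0 : ℤ) < q := by exact_mod_cast hq
  have h0 := Int.emod_nonneg m hq'.ne'
  have h1 := Int.emod_lt_of_pos m hq'
  refine ⟨by omega, ?_⟩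
  rw [Int.toNat_of_nonneg h0]
  exact (Int.mod_modEq m q).symm

lemma eq_of_modEq_of_lt {q r r' : ℕ} {m : ℤ} (h : m ≡ (r : ℤ) [ZMOD (q : ℤ)])
    (h' : m ≡ (r' : ℤ) [ZMOD (q : ℤ)]) (hr : r < q) (hr' : r' < q) : r = r' :=
  Nat.ModEq.eq_of_lt_of_lt ((Int.natCast_modEq_iff).1 (h.symm.trans h')) hr hr'

/-- Conditions modulo each p in Q depend only on the class modulo ∏ p, and each m x lies in exactly
one such class. -/
lemma sum_filter_residues {Q : Finset ℕ} (hQ : ∀ p ∈ Q, p.Prime) (S : (p : ℕ) → Finset (ZMod p))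
    {β : Type*} (I : Finset β) (m : β → ℤ) (f : β → ℝ) :
    ∑ x ∈ I.filter (fun x => ∀ p ∈ Q, (m x : ZMod p) ∈ S p), f x =
      ∑ r ∈ (Finset.range (∏ p ∈ Q, p)).filter (fun r : ℕ => ∀ p ∈ Q, (r : ZMod p) ∈ S p),
        ∑ x ∈ I.filter (fun x => m x ≡ (r : ℤ) [ZMOD ((∏ p ∈ Q, p : ℕ) : ℤ)]), f x := by
  have hq := prod_primes_pos hQ
  set q := ∏ p ∈ Q, p with hqdef
  rw [Finset.sum_filter]
  rw [Finset.sum_congr rfl (fun r _ => Finset.sum_filter _ _), Finset.sum_comm]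
  refine Finset.sum_congr rfl fun x _ => ?_
  obtain ⟨h1, h2⟩ := emod_toNat hq (m x)
  set r := (m x % (q : ℤ)).toNat
  split_ifs with h
  · rw [Finset.sum_eq_single_of_mem r]
    · rw [if_pos h2]
    · refine Finset.mem_filter.2 ⟨Finset.mem_range.2 h1, fun p hp => ?_⟩
      have := intCast_zmod_eq_of_modEq hp h2
      rw [Int.cast_natCast] at this
      rw [← this]; exact h p hp
    · intro r' hr' hne
      rw [if_neg]
      intro h3
      exact hne (eq_of_modEq_of_lt h3 h2 (Finset.mem_range.1 (Finset.mem_filter.1 hr').1) h1)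
  · refine (Finset.sum_eq_zero fun r' hr' => if_neg fun h3 => h fun p hp => ?_).symm
    have := intCast_zmod_eq_of_modEq hp h3
    rw [Int.cast_natCast] at this
    rw [this]; exact (Finset.mem_filter.1 hr').2 p hp

/-- Each of the ∏ |S p| admitted classes has its expected share of the interval with error at most
1. -/
lemma abs_card_sieve_sub_le {Q : Finset ℕ} (hQ : ∀ p ∈ Q, p.Prime)
    (S : (p : ℕ) → Finset (ZMod p)) {a b : ℤ} (hab : a ≤ b) :
    |(((Finset.Ioc a b).filter (fun m : ℤ => ∀ p ∈ Q, (m : ZMod p) ∈ S p)).card : ℝ) -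
      ((b : ℝ) - a) * ∏ p ∈ Q, ((S p).card / p : ℝ)| ≤ ∏ p ∈ Q, ((S p).card : ℝ) := by
  have hq := prod_primes_pos hQ
  have h1 := sum_filter_residues hQ S (Finset.Ioc a b) (fun m => m) (fun _ => (1 : ℝ))
  simp only [Finset.sum_const, nsmul_eq_mul, mul_one] at h1
  rw [h1, Finset.prod_div_distrib]
  have h2 : ((b : ℝ) - a) * ((∏ p ∈ Q, ((S p).card : ℝ)) / ∏ p ∈ Q, (p : ℝ)) =
      ∑ r ∈ (Finset.range (∏ p ∈ Q, p)).filter (fun r : ℕ => ∀ p ∈ Q, (r : ZMod p) ∈ S p),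
        ((b : ℝ) - a) / ((∏ p ∈ Q, p : ℕ) : ℝ) := by
    rw [Finset.sum_const, card_residues hQ, nsmul_eq_mul]; push_cast; ring
  rw [h2, ← Finset.sum_sub_distrib]
  refine (Finset.abs_sum_le_sum_abs _ _).trans ?_
  have h3 : ∀ r : ℕ, |(((Finset.Ioc a b).filter
      (fun x : ℤ => x ≡ (r : ℤ) [ZMOD ((∏ p ∈ Q, p : ℕ) : ℤ)])).card : ℝ) -
      ((b : ℝ) - a) / ((∏ p ∈ Q, p : ℕ) : ℝ)| ≤ 1 :=
    fun r => abs_card_Ioc_modEq_sub_le hab hq (r : ℤ)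
  refine (Finset.sum_le_sum fun r _ => h3 r).trans ?_
  rw [Finset.sum_const, card_residues hQ]; simp

/-! ### The classes Ω and Ω* over integers and primes -/

/-- The integer `m` lies in one of the classes of `Ω(p)`. -/
def Hits (H : Finset ℤ) (p : ℕ) (m : ℤ) : Prop := (m : ZMod p) ∈ Omega H p

instance (H : Finset ℤ) (p : ℕ) (m : ℤ) : Decidable (Hits H p m) := by
  unfold Hits; infer_instance

lemma OmegaStar_prod_primes {Q : Finset ℕ} (hQ : ∀ p ∈ Q, p.Prime) (H : Finset ℤ) (h : ℤ) :
    OmegaStar H h (∏ p ∈ Q, p) = (Finset.range (∏ p ∈ Q, p)).filter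
      (fun r : ℕ => ∀ p ∈ Q, (r : ZMod p) ∈ Omega H p \ {-(h : ZMod p)}) := by
  unfold OmegaStar
  refine Finset.filter_congr fun r _ => ?_
  rw [Nat.primeFactors_prod hQ]
  exact and_iff_right (squarefree_prod_primes hQ)

lemma OmegaStar_of_not_squarefree {q : ℕ} (hq : ¬ Squarefree q) (H : Finset ℤ) (h : ℤ) :
    OmegaStar H h q = ∅ := by
  unfold OmegaStar
  exact Finset.filter_false_of_mem fun r _ hr => hq hr.1

lemma card_Omega_sdiff {H : Finset ℤ} {h : ℤ} (hh : h ∈ H) (p : ℕ) :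
    ((Omega H p \ {-(h : ZMod p)}).card : ℝ) = ((Omega H p).card : ℝ) - 1 := by
  have hm : -(h : ZMod p) ∈ Omega H p := Finset.mem_image.2 ⟨h, hh, rfl⟩
  rw [Finset.card_sdiff_of_subset (by simpa using hm), Finset.card_singleton,
    Nat.cast_sub (Finset.card_pos.2 ⟨_, hm⟩)]
  simp

lemma card_OmegaStar {Q : Finset ℕ} (hQ : ∀ p ∈ Q, p.Prime) {H : Finset ℤ} {h : ℤ} (hh : h ∈ H) :
    ((OmegaStar H h (∏ p ∈ Q, p)).card : ℝ) = ∏ p ∈ Q, (((Omega H p).card : ℝ) - 1) := by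
  rw [OmegaStar_prod_primes hQ, card_residues hQ (fun p => Omega H p \ {-(h : ZMod p)})]
  push_cast
  exact Finset.prod_congr rfl fun p _ => card_Omega_sdiff hh p

/-- A prime n > N is divisible by no p ≤ N, so n − h never falls in the class −h mod p. Hence Ω may
be replaced by Ω*, the set in the hypothesis on the bilinear form. -/
lemma sum_log_primes_hits {Q : Finset ℕ} (hQ : ∀ p ∈ Q, p.Prime) (H : Finset ℤ) (h : ℤ) (N : ℕ)
    (hN : ∀ p ∈ Q, p ≤ N) :
    ∑ n ∈ ((Finset.Ioc N (2 * N)).filter Nat.Prime).filter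
        (fun n : ℕ => ∀ p ∈ Q, Hits H p ((n : ℤ) - h)), Real.log n =
      ∑ r ∈ OmegaStar H h (∏ p ∈ Q, p), thetaStar N ((r : ℤ) + h) (∏ p ∈ Q, p) := by
  have h1 : ((Finset.Ioc N (2 * N)).filter Nat.Prime).filter
        (fun n : ℕ => ∀ p ∈ Q, Hits H p ((n : ℤ) - h)) =
      ((Finset.Ioc N (2 * N)).filter Nat.Prime).filter
        (fun n : ℕ => ∀ p ∈ Q, (((n : ℤ) - h : ℤ) : ZMod p) ∈ Omega H p \ {-(h : ZMod p)}) := by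
    refine Finset.filter_congr fun n hn => forall₂_congr fun p hp => ?_
    rw [Finset.mem_filter, Finset.mem_Ioc] at hn
    unfold Hits
    rw [Finset.mem_sdiff, Finset.mem_singleton]
    refine ⟨fun h2 => ⟨h2, fun h3 => ?_⟩, fun h2 => h2.1⟩
    push_cast at h3
    have h4 : ((n : ℕ) : ZMod p) = 0 := by linear_combination h3
    rw [ZMod.natCast_eq_zero_iff] at h4
    have := (Nat.prime_dvd_prime_iff_eq (hQ p hp) hn.2).1 h4
    have := hN p hp
    omega
  rw [h1, sum_filter_residues hQ (fun p => Omega H p \ {-(h : ZMod p)}), OmegaStar_prod_primes hQ]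
  refine Finset.sum_congr rfl fun r _ => ?_
  unfold thetaStar
  rw [Finset.filter_filter]
  refine Finset.sum_congr (Finset.filter_congr fun n _ => and_congr_right fun _ => ?_) fun _ _ => rfl
  constructor
  · intro h2; simpa using h2.add_right h
  · intro h2; simpa using h2.sub_right h

lemma sum_thetaStar_eq {Q : Finset ℕ} (hQ : ∀ p ∈ Q, p.Prime) {H : Finset ℤ} {h : ℤ} (hh : h ∈ H)
    (N : ℕ) :
    ∑ r ∈ OmegaStar H h (∏ p ∈ Q, p), thetaStar N ((r : ℤ) + h) (∏ p ∈ Q, p) =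
      N * ∏ p ∈ Q, ((((Omega H p).card : ℝ) - 1) / ((p : ℝ) - 1)) +
      ∑ r ∈ OmegaStar H h (∏ p ∈ Q, p), EStar N ((r : ℤ) + h) (∏ p ∈ Q, p) := by
  unfold EStar
  rw [Finset.sum_sub_distrib, Finset.sum_const, nsmul_eq_mul, card_OmegaStar hQ hh,
    totient_prod_primes hQ, Finset.prod_div_distrib]
  have : ((∏ p ∈ Q, (p - 1) : ℕ) : ℝ) = ∏ p ∈ Q, ((p : ℝ) - 1) := by
    push_cast
    exact Finset.prod_congr rfl fun p hp => by rw [Nat.cast_sub (hQ p hp).one_le]; simp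
  rw [this]; ring

/-! ### Quadratic forms on products of binomial coefficients -/

section MultiIndex

/-- The structure constants of the basis of binomial coefficients. -/
noncomputable def chooseCoef (i j γ : ℕ) : ℝ :=
  ((i + j - γ).factorial : ℝ) / (γ.factorial * (i - γ).factorial * (j - γ).factorial)

lemma choose_mul_choose_aux {i j γ : ℕ} (hi : γ ≤ i) (hj : γ ≤ j) :
    ((i.choose γ : ℝ)) * ((i + j - γ).choose i : ℝ) = chooseCoef i j γ := by
  rw [Nat.cast_choose ℝ hi, Nat.cast_choose ℝ (show i ≤ i + j - γ by omega),
    show i + j - γ - i = j - γ by omega, chooseCoef]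
  have h1 : (i.factorial : ℝ) ≠ 0 := by exact_mod_cast i.factorial_ne_zero
  have h2 : (γ.factorial : ℝ) ≠ 0 := by exact_mod_cast γ.factorial_ne_zero
  have h3 : ((i - γ).factorial : ℝ) ≠ 0 := by exact_mod_cast (i - γ).factorial_ne_zero
  have h4 : ((j - γ).factorial : ℝ) ≠ 0 := by exact_mod_cast (j - γ).factorial_ne_zero
  field_simp

/-- Pairs of subsets of sizes i and j are sorted by the size γ of their intersection; the union has
size i + j − γ, and `chooseCoef` counts the ways to cover it. -/
lemma choose_mul_choose_eq_sum (x i j : ℕ) :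
    (x.choose i : ℝ) * (x.choose j : ℝ) =
      ∑ γ ∈ Finset.Iic (min i j), chooseCoef i j γ * (x.choose (i + j - γ) : ℝ) := by
  by_cases hx : i ≤ x
  · have hv := Nat.add_choose_eq i (x - i) j
    rw [Nat.add_sub_cancel' hx, Finset.Nat.sum_antidiagonal_eq_sum_range_succ
      (fun a b => i.choose a * (x - i).choose b)] at hv
    have hv' : (x.choose j : ℝ) = ∑ γ ∈ Finset.range (j + 1),
        (i.choose γ : ℝ) * ((x - i).choose (j - γ) : ℝ) := by
      rw [hv]; push_cast; rfl
    rw [hv', Finset.mul_sum]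
    symm
    apply Finset.sum_subset_zero_on_sdiff
    · intro γ hγ
      rw [Finset.mem_Iic, le_min_iff] at hγ
      exact Finset.mem_range.2 (by omega)
    · intro γ hγ
      rw [Finset.mem_sdiff, Finset.mem_Iic, le_min_iff, Finset.mem_range] at hγ
      rw [Nat.choose_eq_zero_of_lt (show i < γ by omega)]; simp
    · intro γ hγ
      rw [Finset.mem_Iic, le_min_iff] at hγ
      rw [← choose_mul_choose_aux hγ.1 hγ.2]
      have h : x.choose (i + j - γ) * (i + j - γ).choose i =
          x.choose i * (x - i).choose (j - γ) := by
        by_cases hx2 : i + j - γ ≤ x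
        · have := Nat.choose_mul (n := x) (k := i + j - γ) (s := i) (by omega)
          rw [this, show i + j - γ - i = j - γ by omega]
        · rw [Nat.choose_eq_zero_of_lt (show x < i + j - γ by omega),
            Nat.choose_eq_zero_of_lt (show x - i < j - γ by omega)]
          simp
      have h' : (x.choose (i + j - γ) : ℝ) * ((i + j - γ).choose i : ℝ) =
          (x.choose i : ℝ) * ((x - i).choose (j - γ) : ℝ) := by exact_mod_cast h
      linear_combination (i.choose γ : ℝ) * h'
  · rw [Nat.choose_eq_zero_of_lt (show x < i by omega)]
    simp only [Nat.cast_zero, zero_mul]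
    refine (Finset.sum_eq_zero fun γ hγ => ?_).symm
    rw [Finset.mem_Iic, le_min_iff] at hγ
    rw [Nat.choose_eq_zero_of_lt (show x < i + j - γ by omega)]; simp

variable {ι : Type*} [Fintype ι]

instance : DecidableLE (ι → ℕ) := fun a b => decidable_of_iff (∀ l, a l ≤ b l) Iff.rfl

/-- The product of binomial coefficients. -/
def multiChoose (X n : ι → ℕ) : ℝ := ∏ l, ((X l).choose (n l) : ℝ)

/-- The product of the `x_l ^ n_l / n_l!`. -/
noncomputable def expMono (x : ι → ℝ) (n : ι → ℕ) : ℝ := ∏ l, x l ^ n l / ((n l).factorial : ℝ)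

/-- The factorial of i + j − γ cancels, leaving a product of a factor in i and a factor in j for
fixed γ. This is what diagonalises the form. -/
lemma chooseCoef_mul_expMono (x : ι → ℝ) {i j γ : ι → ℕ} (hi : γ ≤ i) (hj : γ ≤ j) :
    (∏ l, chooseCoef (i l) (j l) (γ l)) * expMono x (i + j - γ) =
      expMono x γ * expMono x (i - γ) * expMono x (j - γ) := by
  unfold expMono
  simp_rw [← Finset.prod_mul_distrib]
  refine Finset.prod_congr rfl fun l _ => ?_
  have hil : γ l ≤ i l := hi l
  have hjl : γ l ≤ j l := hj l
  simp only [Pi.add_apply, Pi.sub_apply, chooseCoef]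
  have h1 : ((i l + j l - γ l).factorial : ℝ) ≠ 0 := by exact_mod_cast Nat.factorial_ne_zero _
  have h2 : ((γ l).factorial : ℝ) ≠ 0 := by exact_mod_cast Nat.factorial_ne_zero _
  have h3 : ((i l - γ l).factorial : ℝ) ≠ 0 := by exact_mod_cast Nat.factorial_ne_zero _
  have h4 : ((j l - γ l).factorial : ℝ) ≠ 0 := by exact_mod_cast Nat.factorial_ne_zero _
  have e : x l ^ (i l + j l - γ l) = x l ^ γ l * x l ^ (i l - γ l) * x l ^ (j l - γ l) := by
    rw [← pow_add, ← pow_add]; congr 1; omega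
  rw [e]
  field_simp

lemma expMono_mul_pow (x g : ι → ℝ) (n : ι → ℕ) :
    expMono x n * ∏ l, g l ^ n l = expMono (fun l => x l * g l) n := by
  unfold expMono
  rw [← Finset.prod_mul_distrib]
  exact Finset.prod_congr rfl fun l _ => by rw [mul_pow]; ring

lemma expMono_zero_right (x : ι → ℝ) : expMono x 0 = 1 := by simp [expMono]

lemma expMono_zero_left {n : ι → ℕ} (hn : n ≠ 0) : expMono (0 : ι → ℝ) n = 0 := by
  obtain ⟨l, hl⟩ := Function.ne_iff.1 hn
  refine Finset.prod_eq_zero (Finset.mem_univ l) ?_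
  simp at hl; simp [hl]

variable [DecidableEq ι]

lemma sum_Iic_prod (m : ι → ℕ) (f : ι → ℕ → ℝ) :
    ∑ γ ∈ Finset.Iic m, ∏ l, f l (γ l) = ∏ l, ∑ c ∈ Finset.Iic (m l), f l c := by
  rw [Finset.prod_univ_sum]
  refine Finset.sum_congr ?_ fun _ _ => rfl
  ext γ; simp [Pi.le_def]

lemma sum_Icc_prod (a m : ι → ℕ) (f : ι → ℕ → ℝ) :
    ∑ γ ∈ Finset.Icc a m, ∏ l, f l (γ l) = ∏ l, ∑ c ∈ Finset.Icc (a l) (m l), f l c := by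
  rw [Finset.prod_univ_sum]
  refine Finset.sum_congr ?_ fun _ _ => rfl
  ext γ; simp [Pi.le_def, forall_and]

lemma multiChoose_mul (X i j : ι → ℕ) :
    multiChoose X i * multiChoose X j = ∑ γ ∈ Finset.Iic (i ⊓ j),
      (∏ l, chooseCoef (i l) (j l) (γ l)) * multiChoose X (i + j - γ) := by
  unfold multiChoose
  simp_rw [← Finset.prod_mul_distrib]
  rw [Finset.prod_congr rfl fun l _ => choose_mul_choose_eq_sum (X l) (i l) (j l)]
  exact (sum_Iic_prod (i ⊓ j) (fun l c => chooseCoef (i l) (j l) c *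
    ((X l).choose (i l + j l - c) : ℝ))).symm

/-- The quadratic form in `lam` by which a linear functional `M` on binomial coefficients acts
on the square of `∑ n ∈ K, lam n * multiChoose X n`. -/
noncomputable def sqForm (K : Finset (ι → ℕ)) (lam : (ι → ℕ) → ℝ) (M : (ι → ℕ) → ℝ) : ℝ :=
  ∑ i ∈ K, ∑ j ∈ K, lam i * lam j * ∑ γ ∈ Finset.Iic (i ⊓ j),
    (∏ l, chooseCoef (i l) (j l) (γ l)) * M (i + j - γ)

lemma sq_sum_multiChoose (K : Finset (ι → ℕ)) (lam : (ι → ℕ) → ℝ) (X : ι → ℕ) :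
    (∑ n ∈ K, lam n * multiChoose X n) ^ 2 = sqForm K lam (multiChoose X) := by
  unfold sqForm
  rw [sq, Finset.sum_mul_sum]
  refine Finset.sum_congr rfl fun i _ => Finset.sum_congr rfl fun j _ => ?_
  rw [← multiChoose_mul]; ring

lemma sum_mul_sq_multiChoose {β : Type*} (I : Finset β) (w : β → ℝ) (X : β → ι → ℕ)
    (K : Finset (ι → ℕ)) (lam : (ι → ℕ) → ℝ) :
    ∑ x ∈ I, w x * (∑ n ∈ K, lam n * multiChoose (X x) n) ^ 2 =
      sqForm K lam (fun n => ∑ x ∈ I, w x * multiChoose (X x) n) := by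
  simp_rw [sq_sum_multiChoose]
  unfold sqForm
  simp_rw [Finset.mul_sum]
  rw [Finset.sum_comm]
  refine Finset.sum_congr rfl fun i _ => ?_
  rw [Finset.sum_comm]
  refine Finset.sum_congr rfl fun j _ => ?_
  rw [Finset.sum_comm]
  refine Finset.sum_congr rfl fun γ _ => Finset.sum_congr rfl fun x _ => by ring

lemma tendsto_sqForm (K : Finset (ι → ℕ)) (lam : (ι → ℕ) → ℝ) (M : ℕ → (ι → ℕ) → ℝ)
    (M₀ : (ι → ℕ) → ℝ)
    (h : ∀ i ∈ K, ∀ j ∈ K, ∀ γ ≤ i ⊓ j,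
      Tendsto (fun N => M N (i + j - γ)) atTop (nhds (M₀ (i + j - γ)))) :
    Tendsto (fun N => sqForm K lam (M N)) atTop (nhds (sqForm K lam M₀)) := by
  unfold sqForm
  refine tendsto_finsetSum _ fun i hi => tendsto_finsetSum _ fun j hj => ?_
  refine Tendsto.const_mul _ (tendsto_finsetSum _ fun γ hγ => ?_)
  exact (h i hi j hj γ (Finset.mem_Iic.1 hγ)).const_mul _

lemma sqForm_div (K : Finset (ι → ℕ)) (lam : (ι → ℕ) → ℝ) (M : (ι → ℕ) → ℝ) (c : ℝ) :
    sqForm K lam (fun n => M n / c) = sqForm K lam M / c := by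
  unfold sqForm
  simp_rw [Finset.sum_div, Finset.mul_sum, Finset.sum_div]
  refine Finset.sum_congr rfl fun i _ => Finset.sum_congr rfl fun j _ =>
    Finset.sum_congr rfl fun γ _ => by ring

/-- `expMono x` records the factorial moments of independent Poisson variables of means x, so this
is the second moment of the polynomial in its Charlier expansion. Downward closure of K lets γ range
over K itself. -/
lemma sqForm_expMono {K : Finset (ι → ℕ)} (hK : ∀ i ∈ K, ∀ γ ≤ i, γ ∈ K) (lam : (ι → ℕ) → ℝ)
    (x : ι → ℝ) :
    sqForm K lam (expMono x) =
      ∑ γ ∈ K, expMono x γ * (∑ i ∈ K.filter (fun i => γ ≤ i), lam i * expMono x (i - γ)) ^ 2 := by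
  have h1 : sqForm K lam (expMono x) = ∑ i ∈ K, ∑ j ∈ K, ∑ γ ∈ K,
      if γ ≤ i ∧ γ ≤ j then
        expMono x γ * (lam i * expMono x (i - γ)) * (lam j * expMono x (j - γ)) else 0 := by
    unfold sqForm
    refine Finset.sum_congr rfl fun i hi => Finset.sum_congr rfl fun j hj => ?_
    rw [Finset.mul_sum, ← Finset.sum_filter]
    refine Finset.sum_congr ?_ fun γ hγ => ?_
    · ext γ
      simp only [Finset.mem_Iic, le_inf_iff, Finset.mem_filter]
      exact ⟨fun h => ⟨hK i hi γ h.1, h⟩, fun h => h.2⟩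
    · rw [Finset.mem_filter] at hγ
      rw [chooseCoef_mul_expMono x hγ.2.1 hγ.2.2]; ring
  rw [h1]
  rw [Finset.sum_congr rfl fun i _ => Finset.sum_comm, Finset.sum_comm]
  refine Finset.sum_congr rfl fun γ _ => ?_
  rw [sq, Finset.sum_mul_sum, Finset.mul_sum, Finset.sum_filter]
  refine Finset.sum_congr rfl fun i _ => ?_
  split_ifs with h
  · rw [Finset.mul_sum, Finset.sum_filter]
    refine Finset.sum_congr rfl fun j _ => ?_
    by_cases hj : γ ≤ j
    · rw [if_pos ⟨h, hj⟩, if_pos hj]; ring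
    · rw [if_neg (fun hh => hj hh.2), if_neg hj]
  · exact Finset.sum_eq_zero fun j _ => if_neg fun hh => h hh.1

lemma sum_Icc_pow_div_factorial (b c : ℝ) {γ n : ℕ} (h : γ ≤ n) :
    ∑ i ∈ Finset.Icc γ n, b ^ (i - γ) / ((i - γ).factorial : ℝ) *
      (c ^ (n - i) / ((n - i).factorial : ℝ)) = (b + c) ^ (n - γ) / ((n - γ).factorial : ℝ) := by
  rw [← Finset.Ico_add_one_right_eq_Icc, Finset.sum_Ico_eq_sum_range,
    show n + 1 - γ = n - γ + 1 by omega, add_pow, Finset.sum_div]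
  refine Finset.sum_congr rfl fun m hm => ?_
  have hm' : m ≤ n - γ := by simp at hm; omega
  rw [Nat.cast_choose ℝ hm', show γ + m - γ = m by omega, show n - (γ + m) = n - γ - m by omega]
  have h1 : ((n - γ).factorial : ℝ) ≠ 0 := by exact_mod_cast Nat.factorial_ne_zero _
  field_simp

lemma sum_Icc_expMono (x y : ι → ℝ) {γ n : ι → ℕ} (h : γ ≤ n) :
    ∑ i ∈ Finset.Icc γ n, expMono x (i - γ) * expMono y (n - i) = expMono (x + y) (n - γ) := by
  unfold expMono
  simp_rw [← Finset.prod_mul_distrib]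
  have := sum_Icc_prod γ n (fun l c => x l ^ (c - γ l) / ((c - γ l).factorial : ℝ) *
      (y l ^ (n l - c) / ((n l - c).factorial : ℝ)))
  simp only [Pi.sub_apply] at this ⊢
  rw [this]
  exact Finset.prod_congr rfl fun l _ => sum_Icc_pow_div_factorial _ _ (h l)

/-- The coefficients whose transform at intensity `a` is `y`. -/
noncomputable def invCoef (K : Finset (ι → ℕ)) (y : (ι → ℕ) → ℝ) (a : ι → ℝ) (i : ι → ℕ) : ℝ :=
  ∑ n ∈ K.filter (fun n => i ≤ n), y n * expMono (-a) (n - i)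

/-- Convolution with `expMono (-a)` inverts convolution with `expMono a`, by the binomial theorem in
each coordinate. At another intensity x the net effect is convolution with `expMono (x - a)`. -/
lemma sum_invCoef {K : Finset (ι → ℕ)} (hK : ∀ i ∈ K, ∀ γ ≤ i, γ ∈ K) (y : (ι → ℕ) → ℝ)
    (a x : ι → ℝ) (γ : ι → ℕ) :
    ∑ i ∈ K.filter (fun i => γ ≤ i), invCoef K y a i * expMono x (i - γ) =
      ∑ n ∈ K.filter (fun n => γ ≤ n), y n * expMono (x - a) (n - γ) := by
  unfold invCoef
  simp_rw [Finset.sum_mul]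
  have h1 : ∀ n ∈ K.filter (fun n => γ ≤ n), y n * expMono (x - a) (n - γ) =
      ∑ i ∈ K.filter (fun i => γ ≤ i),
        if i ≤ n then y n * expMono (-a) (n - i) * expMono x (i - γ) else 0 := by
    intro n hn
    rw [Finset.mem_filter] at hn
    rw [sub_eq_add_neg, ← sum_Icc_expMono x (-a) hn.2, Finset.mul_sum, ← Finset.sum_filter]
    refine Finset.sum_congr ?_ fun i _ => by ring
    ext i
    simp only [Finset.mem_Icc, Finset.mem_filter]
    exact ⟨fun h => ⟨⟨hK n hn.1 i h.2, h.1⟩, h.2⟩, fun h => ⟨h.1.2, h.2⟩⟩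
  rw [Finset.sum_congr rfl h1, Finset.sum_comm]
  refine Finset.sum_congr rfl fun i hi => ?_
  rw [← Finset.sum_filter, Finset.filter_filter]
  refine Finset.sum_congr (Finset.filter_congr fun n _ => ?_) fun _ _ => rfl
  exact ⟨fun h => ⟨(Finset.mem_filter.1 hi).2.trans h, h⟩, fun h => h.2⟩

/-- The value of the form at the intensity used to define the coefficients. -/
lemma sqForm_invCoef_self {K : Finset (ι → ℕ)} (hK : ∀ i ∈ K, ∀ γ ≤ i, γ ∈ K) (g a : ι → ℝ) :
    sqForm K (invCoef K (fun n => ∏ l, (-g l) ^ n l) a) (expMono a) =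
      ∑ γ ∈ K, expMono (fun l => a l * g l ^ 2) γ := by
  rw [sqForm_expMono hK]
  refine Finset.sum_congr rfl fun γ hγ => ?_
  -- At intensity a itself the shift is 0 and the inner sum collapses to n = γ.
  rw [sum_invCoef hK, Finset.sum_eq_single_of_mem γ (by simp [hγ])]
  · have : γ - γ = 0 := by ext; simp
    rw [this, expMono_zero_right, mul_one, ← expMono_mul_pow, ← Finset.prod_pow]
    congr 1
    exact Finset.prod_congr rfl fun l _ => by rw [← pow_mul, ← pow_mul, mul_comm, pow_mul, neg_sq,
      ← pow_mul]
  · intro n hn hne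
    rw [sub_self, expMono_zero_left, mul_zero]
    intro h0
    refine hne (le_antisymm ?_ (Finset.mem_filter.1 hn).2)
    intro l
    exact Nat.sub_eq_zero_iff_le.1 (congrFun h0 l)

/-- The value of the form at a smaller intensity. -/
lemma sqForm_invCoef_sub {K : Finset (ι → ℕ)} (hK : ∀ i ∈ K, ∀ γ ≤ i, γ ∈ K) (g a L : ι → ℝ) :
    sqForm K (invCoef K (fun n => ∏ l, (-g l) ^ n l) a) (expMono (a - L)) =
      ∑ γ ∈ K, expMono (fun l => (a l - L l) * g l ^ 2) γ *
        (∑ n ∈ K.filter (fun n => γ ≤ n), expMono (fun l => g l * L l) (n - γ)) ^ 2 := by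
  rw [sqForm_expMono hK]
  refine Finset.sum_congr rfl fun γ hγ => ?_
  rw [sum_invCoef hK]
  -- The alternating signs in the coordinates cancel those of the shift −L: outside a common sign,
  -- which the square removes, the inner sum becomes one in the products g L, with no cancellation
  -- when these are non-negative.
  have h1 : ∀ n ∈ K.filter (fun n => γ ≤ n), (∏ l, (-g l) ^ n l) * expMono (a - L - a) (n - γ) =
      (∏ l, (-g l) ^ γ l) * expMono (fun l => g l * L l) (n - γ) := by
    intro n hn
    have hle := (Finset.mem_filter.1 hn).2
    unfold expMono
    rw [← Finset.prod_mul_distrib, ← Finset.prod_mul_distrib]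
    refine Finset.prod_congr rfl fun l _ => ?_
    have hll : γ l ≤ n l := hle l
    simp only [Pi.sub_apply]
    have e : (-g l) ^ n l = (-g l) ^ γ l * (-g l) ^ (n l - γ l) := by
      rw [← pow_add]; congr 1; omega
    rw [e, show a l - L l - a l = -L l by ring, show g l * L l = (-g l) * (-L l) by ring, mul_pow]
    ring
  rw [Finset.sum_congr rfl h1, ← Finset.mul_sum, mul_pow, ← mul_assoc]
  congr 1
  rw [← Finset.prod_pow]
  have e2 : ∏ l, ((-g l) ^ γ l) ^ 2 = ∏ l, (g l ^ 2) ^ γ l :=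
    Finset.prod_congr rfl fun l _ => by
      rw [← pow_mul, ← pow_mul, mul_comm, pow_mul, neg_sq, ← pow_mul]
  rw [e2, expMono_mul_pow]
  rfl

end MultiIndex

/-! ### Truncation by weight and Poisson concentration -/

section Types

variable {ι : Type*} [Fintype ι]

/-- The weight `∑ n_l t_l` of a multi-index. -/
def typeWeight (t : ι → ℝ) (n : ι → ℕ) : ℝ := ∑ l, (n l : ℝ) * t l

lemma typeWeight_add (t : ι → ℝ) (m n : ι → ℕ) :
    typeWeight t (m + n) = typeWeight t m + typeWeight t n := by
  unfold typeWeight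
  rw [← Finset.sum_add_distrib]
  exact Finset.sum_congr rfl fun l _ => by simp; ring

lemma typeWeight_mono {t : ι → ℝ} (ht : ∀ l, 0 ≤ t l) {m n : ι → ℕ} (h : m ≤ n) :
    typeWeight t m ≤ typeWeight t n :=
  Finset.sum_le_sum fun l _ => mul_le_mul_of_nonneg_right (by exact_mod_cast h l) (ht l)

lemma expMono_nonneg {x : ι → ℝ} (hx : ∀ l, 0 ≤ x l) (n : ι → ℕ) : 0 ≤ expMono x n :=
  Finset.prod_nonneg fun l _ => div_nonneg (pow_nonneg (hx l) _) (by positivity)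

variable [DecidableEq ι]

/-- The multi-indices of weight at most `W`. -/
noncomputable def typesLE (t : ι → ℝ) (W : ℝ) : Finset (ι → ℕ) :=
  (Finset.Iic (fun l => ⌊W / t l⌋₊)).filter (fun n => typeWeight t n ≤ W)

/-- The box in the definition only secures finiteness: the weight condition already forces n_l ≤ W /
t_l. -/
lemma mem_typesLE {t : ι → ℝ} (ht : ∀ l, 0 < t l) {W : ℝ} {n : ι → ℕ} :
    n ∈ typesLE t W ↔ typeWeight t n ≤ W := by
  unfold typesLE
  rw [Finset.mem_filter, Finset.mem_Iic]
  refine and_iff_right_of_imp fun h l => Nat.le_floor ?_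
  rw [le_div_iff₀ (ht l)]
  exact (Finset.single_le_sum (f := fun l => (n l : ℝ) * t l)
    (fun l _ => mul_nonneg (by positivity) (ht l).le) (Finset.mem_univ l)).trans h

lemma typesLE_lower {t : ι → ℝ} (ht : ∀ l, 0 < t l) {W : ℝ} :
    ∀ i ∈ typesLE t W, ∀ γ ≤ i, γ ∈ typesLE t W := by
  intro i hi γ hγ
  rw [mem_typesLE ht] at hi ⊢
  exact (typeWeight_mono (fun l => (ht l).le) hγ).trans hi

lemma sum_box_expMono (x : ι → ℝ) (M : ℕ) :
    ∑ n ∈ Finset.Iic (fun _ : ι => M), expMono x n =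
      ∏ l, ∑ c ∈ Finset.range (M + 1), x l ^ c / (c.factorial : ℝ) := by
  unfold expMono
  rw [sum_Iic_prod (fun _ : ι => M) (fun l c => x l ^ c / (c.factorial : ℝ))]
  refine Finset.prod_congr rfl fun l _ => Finset.sum_congr ?_ fun _ _ => rfl
  ext c; simp

lemma tendsto_sum_box_expMono (x : ι → ℝ) :
    Tendsto (fun M : ℕ => ∑ n ∈ Finset.Iic (fun _ : ι => M), expMono x n) atTop
      (nhds (Real.exp (∑ l, x l))) := by
  simp_rw [sum_box_expMono]
  rw [Real.exp_sum]
  refine tendsto_finsetProd _ fun l _ => ?_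
  have h : HasSum (fun c : ℕ => x l ^ c / (c.factorial : ℝ)) (Real.exp (x l)) := by
    rw [Real.exp_eq_exp_ℝ]
    exact NormedSpace.expSeries_div_hasSum_exp (x l)
  exact h.tendsto_sum_nat.comp (tendsto_add_atTop_nat 1)

lemma sum_box_expMono_le {x : ι → ℝ} (hx : ∀ l, 0 ≤ x l) (M : ℕ) :
    ∑ n ∈ Finset.Iic (fun _ : ι => M), expMono x n ≤ Real.exp (∑ l, x l) := by
  rw [sum_box_expMono, Real.exp_sum]
  exact Finset.prod_le_prod (fun l _ => Finset.sum_nonneg fun c _ =>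
    div_nonneg (pow_nonneg (hx l) _) (by positivity)) fun l _ => Real.sum_le_exp_of_nonneg (hx l) _

/-- After division by the right-hand side these are Poisson probabilities, whose total is 1. -/
lemma sum_expMono_le {x : ι → ℝ} (hx : ∀ l, 0 ≤ x l) (K : Finset (ι → ℕ)) :
    ∑ n ∈ K, expMono x n ≤ Real.exp (∑ l, x l) := by
  have hsub : K ⊆ Finset.Iic (fun _ : ι => K.sup (fun n => ∑ l, n l)) := by
    intro n hn
    rw [Finset.mem_Iic]
    intro l
    exact (Finset.single_le_sum (f := n) (fun _ _ => Nat.zero_le _) (Finset.mem_univ l)).trans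
      (Finset.le_sup (f := fun n : ι → ℕ => ∑ l, n l) hn)
  exact (Finset.sum_le_sum_of_subset_of_nonneg hsub fun n _ _ => expMono_nonneg hx n).trans
    (sum_box_expMono_le hx _)

/-- A Chernoff bound for the weight of a vector of independent Poisson variables. -/
lemma sum_typesLE_ge {t x : ι → ℝ} (ht : ∀ l, 0 < t l) (hx : ∀ l, 0 ≤ x l) {δ lam W : ℝ}
    (htδ : ∀ l, t l ≤ δ) (hlam : 0 ≤ lam) (hld : lam * δ ≤ 1) :
    Real.exp (∑ l, x l) * (1 - Real.exp (-(lam * (W - ∑ l, x l * t l)) +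
      lam ^ 2 * δ * ∑ l, x l * t l)) ≤ ∑ n ∈ typesLE t W, expMono x n := by
  set μ := ∑ l, x l * t l with hμ
  -- exp v ≤ 1 + v + v² on [0, 1], applied with v = lam · t_l.
  have hexp : ∑ l, x l * Real.exp (lam * t l) ≤ ∑ l, x l + lam * μ + lam ^ 2 * δ * μ := by
    rw [hμ, Finset.mul_sum, Finset.mul_sum, ← Finset.sum_add_distrib, ← Finset.sum_add_distrib]
    refine Finset.sum_le_sum fun l _ => ?_
    have h0 : 0 ≤ lam * t l := mul_nonneg hlam (ht l).le
    have h1 : lam * t l ≤ 1 := (mul_le_mul_of_nonneg_left (htδ l) hlam).trans hld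
    have h2 := (abs_le.1 (Real.abs_exp_sub_one_sub_id_le (abs_le.2 ⟨by linarith, h1⟩))).2
    have h3 : (lam * t l) ^ 2 ≤ lam ^ 2 * δ * t l := by
      rw [mul_pow, mul_assoc, sq (t l)]
      exact mul_le_mul_of_nonneg_left (mul_le_mul_of_nonneg_right (htδ l) (ht l).le) (by positivity)
    have := mul_le_mul_of_nonneg_left
      (show Real.exp (lam * t l) ≤ 1 + lam * t l + lam ^ 2 * δ * t l by linarith) (hx l)
    linarith
  -- Off the truncation, exp(lam(weight − W)) ≥ 1 is inserted, and it tilts each x_l to x_l exp(lam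
  -- t_l). The boxes exhaust all types as M grows.
  have hbox : ∀ M : ℕ, ∑ n ∈ Finset.Iic (fun _ : ι => M), expMono x n -
      Real.exp (-(lam * W) + ∑ l, x l * Real.exp (lam * t l)) ≤ ∑ n ∈ typesLE t W, expMono x n := by
    intro M
    rw [← Finset.sum_filter_add_sum_filter_not _ (fun n => typeWeight t n ≤ W)]
    have h1 : ∑ n ∈ (Finset.Iic (fun _ : ι => M)).filter (fun n => typeWeight t n ≤ W),
        expMono x n ≤ ∑ n ∈ typesLE t W, expMono x n := by
      refine Finset.sum_le_sum_of_subset_of_nonneg (fun n hn => ?_) fun n _ _ => expMono_nonneg hx n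
      rw [mem_typesLE ht]; exact (Finset.mem_filter.1 hn).2
    have h2 : ∑ n ∈ (Finset.Iic (fun _ : ι => M)).filter (fun n => ¬ typeWeight t n ≤ W),
        expMono x n ≤ Real.exp (-(lam * W) + ∑ l, x l * Real.exp (lam * t l)) := by
      calc _ ≤ ∑ n ∈ (Finset.Iic (fun _ : ι => M)).filter (fun n => ¬ typeWeight t n ≤ W),
            Real.exp (-(lam * W)) * expMono (fun l => x l * Real.exp (lam * t l)) n := by
            refine Finset.sum_le_sum fun n hn => ?_
            have hn' := not_le.1 (Finset.mem_filter.1 hn).2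
            have e : expMono (fun l => x l * Real.exp (lam * t l)) n =
                expMono x n * Real.exp (lam * typeWeight t n) := by
              rw [← expMono_mul_pow, typeWeight, Finset.mul_sum, Real.exp_sum]
              congr 1
              refine Finset.prod_congr rfl fun l _ => ?_
              rw [← Real.exp_nat_mul]; congr 1; ring
            rw [e, mul_left_comm, ← Real.exp_add]
            refine le_mul_of_one_le_right (expMono_nonneg hx n) (Real.one_le_exp ?_)
            nlinarith [mul_le_mul_of_nonneg_left hn'.le hlam]
        _ ≤ ∑ n ∈ Finset.Iic (fun _ : ι => M),
            Real.exp (-(lam * W)) * expMono (fun l => x l * Real.exp (lam * t l)) n :=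
            Finset.sum_le_sum_of_subset_of_nonneg (Finset.filter_subset _ _) fun n _ _ =>
              mul_nonneg (Real.exp_pos _).le (expMono_nonneg (fun l =>
                mul_nonneg (hx l) (Real.exp_pos _).le) n)
        _ ≤ _ := by
          rw [← Finset.mul_sum, Real.exp_add]
          exact mul_le_mul_of_nonneg_left (sum_box_expMono_le (fun l =>
                mul_nonneg (hx l) (Real.exp_pos _).le) M) (Real.exp_pos _).le
    linarith
  have hlim := le_of_tendsto ((tendsto_sum_box_expMono x).sub_const
    (Real.exp (-(lam * W) + ∑ l, x l * Real.exp (lam * t l)))) (Eventually.of_forall hbox)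
  refine le_trans ?_ hlim
  rw [mul_sub, mul_one, ← Real.exp_add]
  refine sub_le_sub_left (Real.exp_le_exp.2 ?_) _
  linarith

/-- A lower bound for the second quadratic form by a product. -/
lemma sum_sq_ge_mul {t x y : ι → ℝ} (ht : ∀ l, 0 < t l) (hx : ∀ l, 0 ≤ x l) (hy : ∀ l, 0 ≤ y l)
    {W W₁ W₂ : ℝ} (hW₂ : 0 ≤ W₂) (hW : W₁ + W₂ ≤ W) :
    (∑ γ ∈ typesLE t W₁, expMono x γ) * (∑ m ∈ typesLE t W₂, expMono y m) ^ 2 ≤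
      ∑ γ ∈ typesLE t W, expMono x γ *
        (∑ n ∈ (typesLE t W).filter (fun n => γ ≤ n), expMono y (n - γ)) ^ 2 := by
  rw [Finset.sum_mul]
  -- Keep only γ of weight at most W₁ and n = γ + m with m of weight at most W₂. All discarded terms
  -- are non-negative, and the two sums separate.
  have hsub : typesLE t W₁ ⊆ typesLE t W := by
    intro γ hγ
    rw [mem_typesLE ht] at hγ ⊢; linarith
  refine le_trans (Finset.sum_le_sum fun γ hγ => ?_)
    (Finset.sum_le_sum_of_subset_of_nonneg hsub fun γ _ _ =>
      mul_nonneg (expMono_nonneg hx γ) (sq_nonneg _))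
  refine mul_le_mul_of_nonneg_left (pow_le_pow_left₀ (Finset.sum_nonneg fun m _ =>
    expMono_nonneg hy m) ?_ 2) (expMono_nonneg hx γ)
  have hinj : Set.InjOn (fun m : ι → ℕ => γ + m) (typesLE t W₂ : Set (ι → ℕ)) := by
    intro a _ b _ h; exact add_left_cancel h
  have e : ∑ m ∈ typesLE t W₂, expMono y m =
      ∑ n ∈ (typesLE t W₂).image (fun m => γ + m), expMono y (n - γ) := by
    rw [Finset.sum_image hinj]
    exact Finset.sum_congr rfl fun m _ => by rw [add_tsub_cancel_left]
  rw [e]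
  refine Finset.sum_le_sum_of_subset_of_nonneg (fun n hn => ?_) fun n _ _ => expMono_nonneg hy _
  obtain ⟨m, hm, rfl⟩ := Finset.mem_image.1 hn
  rw [mem_typesLE ht] at hm hγ
  rw [Finset.mem_filter, mem_typesLE ht, typeWeight_add]
  exact ⟨by linarith, le_self_add⟩

end Types

/-! ### Riemann sums for the sieve function 1/(1 + u) -/

section Telescoping

variable {ρ : ℝ} {u : ℕ → ℝ}

/-- A geometric Riemann sum for ∫ du/(1 + u)² ≤ 1, compared term by term with differences of −1/(1 +
u); passing from u_(j+1) to u_j costs the factor ρ. It bounds the mean weight. -/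
lemma sum_log_mul_le_telescope (hρ : 1 < ρ) (hu : ∀ j, 0 < u j) (hs : ∀ j, u (j + 1) = ρ * u j)
    (J : ℕ) :
    ∑ j ∈ Finset.range J, Real.log ρ * (u (j + 1) / (1 + u (j + 1)) ^ 2) ≤ ρ := by
  have hlog : Real.log ρ ≤ ρ - 1 := Real.log_le_sub_one_of_pos (by linarith)
  calc _ ≤ ∑ j ∈ Finset.range J, (ρ * (1 / (1 + u j)) - ρ * (1 / (1 + u (j + 1)))) := by
        refine Finset.sum_le_sum fun j _ => ?_
        have h0 := hu j
        have h1 := hu (j + 1)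
        have hle : u j ≤ u (j + 1) := by rw [hs]; nlinarith
        have e : ρ * (1 / (1 + u j)) - ρ * (1 / (1 + u (j + 1))) =
            (ρ - 1) * (u (j + 1) / ((1 + u j) * (1 + u (j + 1)))) := by
          rw [hs] at *
          field_simp; ring
        rw [e]
        refine mul_le_mul hlog ?_ (by positivity) (by linarith)
        rw [sq]
        gcongr
    _ = ρ * (1 / (1 + u 0)) - ρ * (1 / (1 + u J)) := Finset.sum_range_sub' (fun j => ρ * (1 / (1 + u j))) J
    _ ≤ ρ := by
      have h1 : 1 / (1 + u 0) ≤ 1 := by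
        rw [div_le_one (by linarith [hu 0])]; linarith [hu 0]
      have h2 : 0 < 1 / (1 + u J) := by have := hu J; positivity
      nlinarith

/-- The same comparison for ∫ u/(1 + u)² du, with primitive log(1 + u) + 1/(1 + u), which is at
least 1 at the lower end. It bounds the loss Σ L(1 − g)². -/
lemma sum_log_mul_sq_le_telescope (hρ : 1 < ρ) (hu : ∀ j, 0 < u j)
    (hs : ∀ j, u (j + 1) = ρ * u j) (J : ℕ) :
    ∑ j ∈ Finset.range J, Real.log ρ * (u (j + 1) / (1 + u (j + 1))) ^ 2 ≤
      ρ ^ 2 * (Real.log (1 + u J) + 1 / (1 + u J) - 1) := by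
  have hlog : Real.log ρ ≤ ρ - 1 := Real.log_le_sub_one_of_pos (by linarith)
  have hlog0 : 0 ≤ Real.log ρ := (Real.log_pos hρ).le
  set Ψ : ℕ → ℝ := fun j => ρ ^ 2 * (Real.log (1 + u j) + 1 / (1 + u j)) with hΨ
  have hterm : ∀ j, Real.log ρ * (u (j + 1) / (1 + u (j + 1))) ^ 2 ≤ Ψ (j + 1) - Ψ j := by
    intro j
    have h0 := hu j
    have h1 := hu (j + 1)
    have hle : u j ≤ u (j + 1) := by rw [hs]; nlinarith
    have hl : 1 - (1 + u j) / (1 + u (j + 1)) ≤ Real.log (1 + u (j + 1)) - Real.log (1 + u j) := by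
      have := Real.log_le_sub_one_of_pos (x := (1 + u j) / (1 + u (j + 1))) (by positivity)
      rw [Real.log_div (by positivity) (by positivity)] at this
      linarith
    have e : 1 - (1 + u j) / (1 + u (j + 1)) + 1 / (1 + u (j + 1)) - 1 / (1 + u j) =
        (ρ - 1) * (u j ^ 2 / ((1 + u j) * (1 + u (j + 1)))) := by
      rw [hs] at *
      field_simp; ring
    have h3 : (u (j + 1) / (1 + u (j + 1))) ^ 2 ≤
        ρ ^ 2 * (u j ^ 2 / ((1 + u j) * (1 + u (j + 1)))) := by
      have e2 : ρ ^ 2 * (u j ^ 2 / ((1 + u j) * (1 + u (j + 1)))) =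
          u (j + 1) ^ 2 / ((1 + u j) * (1 + u (j + 1))) := by rw [hs]; ring
      rw [e2, div_pow, sq (1 + u (j + 1))]
      gcongr
    calc _ ≤ (ρ - 1) * (ρ ^ 2 * (u j ^ 2 / ((1 + u j) * (1 + u (j + 1))))) :=
          mul_le_mul hlog h3 (by positivity) (by linarith)
      _ = ρ ^ 2 * (1 - (1 + u j) / (1 + u (j + 1)) + 1 / (1 + u (j + 1)) - 1 / (1 + u j)) := by
          rw [e]; ring
      _ ≤ ρ ^ 2 * ((Real.log (1 + u (j + 1)) - Real.log (1 + u j)) +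
          1 / (1 + u (j + 1)) - 1 / (1 + u j)) := by
          apply mul_le_mul_of_nonneg_left _ (by positivity); linarith
      _ = _ := by simp only [hΨ]; ring
  refine (Finset.sum_le_sum fun j _ => hterm j).trans ?_
  rw [Finset.sum_range_sub]
  have h0 := hu 0
  have hl : 1 - 1 / (1 + u 0) ≤ Real.log (1 + u 0) := by
    have := Real.log_le_sub_one_of_pos (x := 1 / (1 + u 0)) (by positivity)
    rw [one_div, Real.log_inv] at this
    rw [one_div]; linarith
  have : ρ ^ 2 * 1 ≤ Ψ 0 := by
    simp only [hΨ]
    exact mul_le_mul_of_nonneg_left (by linarith) (by positivity)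
  have hJ : Ψ J = ρ ^ 2 * (Real.log (1 + u J) + 1 / (1 + u J)) := rfl
  rw [hJ]; linarith

end Telescoping

/-! ### Choice of the sieve parameters -/

lemma one_sub_exp_neg_ge {x : ℝ} (hx : 1000 ≤ x) : 0.999 ≤ 1 - Real.exp (-x) := by
  have h := Real.add_one_le_exp x
  rw [Real.exp_neg]
  have : (Real.exp x)⁻¹ ≤ 1000⁻¹ := inv_anti₀ (by norm_num) (by linarith)
  norm_num at this ⊢; linarith

/-- The term −log 1001 in the exponent offsets the length 1000 of the range of u, and the constant 1
yields e. The value is close to 1.61 · 0.99 · e/4; the remaining room pays for truncation,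
discretisation and the sieve. -/
lemma extremal_constant_bound {ρ : ℝ} (hρ : ρ = 1 + 1 / 10000) :
    1.03 ≤ 1.61 * 0.997 * (0.99 * 1000 / 4) *
      Real.exp (-(ρ ^ 2 * (Real.log (1 + 1000) + 1 / (1 + 1000) - 1))) := by
  set X := Real.log (1 + 1000 : ℝ) + 1 / (1 + 1000) - 1 with hX
  have hlog : Real.log (1 + 1000 : ℝ) ≤ 10 := by
    have h2 : (1 + 1000 : ℝ) ≤ 2 ^ 10 := by norm_num
    have := Real.log_le_log (by norm_num) h2
    rw [Real.log_pow] at this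
    have := Real.log_two_lt_d9
    push_cast at *; linarith
  have hX10 : X ≤ 10 := by rw [hX]; norm_num at *; linarith
  have e1 : -(ρ ^ 2 * X) = 1 + (-Real.log (1 + 1000)) + (-(1 / (1 + 1000)) - (ρ ^ 2 - 1) * X) := by
    rw [hX]; ring
  have hlow : -(0.004 : ℝ) ≤ -(1 / (1 + 1000)) - (ρ ^ 2 - 1) * X := by
    have : (ρ ^ 2 - 1) * X ≤ (ρ ^ 2 - 1) * 10 :=
      mul_le_mul_of_nonneg_left hX10 (by rw [hρ]; norm_num)
    have h3 : (ρ ^ 2 - 1) * 10 ≤ 0.0021 := by rw [hρ]; norm_num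
    norm_num at *; linarith
  have hex : 0.996 ≤ Real.exp (-(1 / (1 + 1000)) - (ρ ^ 2 - 1) * X) := by
    have := Real.add_one_le_exp (-(1 / (1 + 1000)) - (ρ ^ 2 - 1) * X)
    norm_num at *; linarith
  rw [e1, Real.exp_add, Real.exp_add, Real.exp_neg, Real.exp_log (by norm_num)]
  have he := Real.exp_one_gt_d9
  have h5 : 2.718 * (1 + 1000 : ℝ)⁻¹ * 0.996 ≤ Real.exp 1 * (1 + 1000 : ℝ)⁻¹ *
      Real.exp (-(1 / (1 + 1000)) - (ρ ^ 2 - 1) * X) := by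
    refine mul_le_mul (mul_le_mul_of_nonneg_right (by linarith) (by norm_num)) hex (by norm_num)
      (by positivity)
  refine le_trans ?_ (mul_le_mul_of_nonneg_left h5 (by norm_num))
  norm_num

set_option maxHeartbeats 2000000 in
/-- The choice of the sieve function: a discretised form of `1 / (1 + u)`, `u = 4 k t`. -/
theorem exists_sieve_parameters {κ : ℝ} (hκ : 0 < κ) : ∃ k₀ : ℕ, ∀ k : ℕ, k₀ ≤ k →
    ∀ ε₀ : ℝ, 0 < ε₀ → ∃ (J : ℕ) (ε ρ : ℝ) (g : Fin J → ℝ),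
      0 < ε ∧ ε ≤ ε₀ ∧ 1 < ρ ∧ ε * ρ ^ J ≤ κ ∧
      1.02 * ∑ γ ∈ typesLE (fun l : Fin J => ε * ρ ^ ((l : ℕ) + 1)) (1 / 4),
          expMono (fun l => k * Real.log ρ * g l ^ 2) γ ≤
        k * (1.61 * ε) * ∑ γ ∈ typesLE (fun l : Fin J => ε * ρ ^ ((l : ℕ) + 1)) (1 / 4),
          expMono (fun l => (k * Real.log ρ - Real.log ρ) * g l ^ 2) γ *
          (∑ n ∈ (typesLE (fun l : Fin J => ε * ρ ^ ((l : ℕ) + 1)) (1 / 4)).filter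
            (fun n => γ ≤ n), expMono (fun l => g l * Real.log ρ) (n - γ)) ^ 2 := by
  -- The top cell exponent will be at most 250/k, hence at most κ. The other requirement, k ≥ 10^20,
  -- makes √k large enough for the Chernoff bounds.
  obtain ⟨k₁, hk₁⟩ := exists_nat_ge (250 / κ)
  refine ⟨max k₁ (10 ^ 20), fun k hk ε₀ hε₀ => ?_⟩
  have hk20' : 10 ^ 20 ≤ k := (le_max_right _ _).trans hk
  have hk20 : (10 : ℝ) ^ 20 ≤ k := by exact_mod_cast hk20'
  have hk0 : (0 : ℝ) < k := by linarith [show (0 : ℝ) < 10 ^ 20 by norm_num]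
  have hkκ : 250 / κ ≤ k := hk₁.trans (by exact_mod_cast (le_max_left _ _).trans hk)
  obtain ⟨ρ, hρ⟩ : ∃ ρ : ℝ, ρ = 1 + 1 / 10000 := ⟨_, rfl⟩
  have hρ1 : 1 < ρ := by rw [hρ]; norm_num
  have hρ0 : 0 < ρ := by linarith
  -- Only the bottom of the range of u depends on ε₀; its top is 1000 for every J.
  obtain ⟨J, hJ⟩ := pow_unbounded_of_one_lt (1 / ε₀) hρ1
  have hρJ : 0 < ρ ^ J := by positivity
  set u : ℕ → ℝ := fun j => 1000 * ρ ^ j / ρ ^ J with hu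
  have hu0 : ∀ j, 0 < u j := fun j => by simp only [hu]; positivity
  have hus : ∀ j, u (j + 1) = ρ * u j := fun j => by simp only [hu, pow_succ]; ring
  have huJ : u J = 1000 := by simp only [hu]; field_simp
  have hule : ∀ j, j ≤ J → u j ≤ 1000 := fun j hj => by
    rw [← huJ]; simp only [hu]; gcongr; exact hρ1.le
  -- The scale t = cs · u brings the mean weight to about 0.99/4, leaving below the cap 1/4 the
  -- margin that concentration needs.
  set cs : ℝ := 0.99 / (4 * k) with hcs
  have hcs0 : 0 < cs := by positivity
  set ε : ℝ := cs * u 0 with hε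
  have hτ : ∀ j : ℕ, ε * ρ ^ j = cs * u j := fun j => by simp only [hε, hu]; ring
  set g : ℕ → ℝ := fun j => 1 / (1 + u (j + 1)) with hg
  have hg0 : ∀ j, 0 < g j := fun j => by have := hu0 (j + 1); simp only [hg]; positivity
  set L := Real.log ρ with hL
  have hL0 : 0 < L := Real.log_pos hρ1
  set t : Fin J → ℝ := fun l => ε * ρ ^ ((l : ℕ) + 1) with ht
  have htu : ∀ l : Fin J, t l = cs * u (l + 1) := fun l => hτ _
  have ht0 : ∀ l, 0 < t l := fun l => by rw [htu]; exact mul_pos hcs0 (hu0 _)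
  have hcsk : cs * k = 0.99 / 4 := by rw [hcs]; field_simp
  have hδ : cs * 1000 ≤ 250 / k := by
    rw [le_div_iff₀ hk0]; nlinarith
  have htδ : ∀ l, t l ≤ 250 / k := fun l => by
    rw [htu]
    exact (mul_le_mul_of_nonneg_left (hule _ l.2) hcs0.le).trans hδ
  -- the telescoping bounds
  have hT1 : ∑ l : Fin J, L * g l ^ 2 * u (l + 1) ≤ ρ := by
    rw [Fin.sum_univ_eq_sum_range (fun l => L * g l ^ 2 * u (l + 1)) J]
    refine le_trans (le_of_eq (Finset.sum_congr rfl fun j _ => ?_))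
      (sum_log_mul_le_telescope hρ1 hu0 hus J)
    simp only [hg]; rw [one_div, inv_pow]; ring
  have hT2 : ∑ l : Fin J, L * (1 - g l) ^ 2 ≤
      ρ ^ 2 * (Real.log (1 + 1000) + 1 / (1 + 1000) - 1) := by
    rw [Fin.sum_univ_eq_sum_range (fun l => L * (1 - g l) ^ 2) J, ← huJ]
    refine le_trans (le_of_eq (Finset.sum_congr rfl fun j _ => ?_))
      (sum_log_mul_sq_le_telescope hρ1 hu0 hus J)
    have := hu0 (j + 1)
    simp only [hg]; congr 2; field_simp; ring
  have hρle : ρ ≤ 1.0001 := by rw [hρ]; norm_num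
  -- the means
  set x : Fin J → ℝ := fun l => (k * L - L) * g l ^ 2 with hx
  set y : Fin J → ℝ := fun l => g l * L with hy
  have hkL : 0 ≤ k * L - L := by nlinarith [show (1 : ℝ) ≤ 10 ^ 20 by norm_num]
  have hx0 : ∀ l, 0 ≤ x l := fun l => mul_nonneg hkL (sq_nonneg _)
  have hy0 : ∀ l, 0 ≤ y l := fun l => (mul_pos (hg0 _) hL0).le
  have hS0 : 0 ≤ ∑ l : Fin J, L * g l ^ 2 * u (l + 1) :=
    Finset.sum_nonneg fun l _ => mul_nonneg (by positivity) (hu0 _).le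
  have hmx : ∑ l, x l * t l ≤ 0.2476 := by
    have e : ∑ l, x l * t l = (k - 1) * cs * ∑ l : Fin J, L * g l ^ 2 * u (l + 1) := by
      rw [Finset.mul_sum]
      refine Finset.sum_congr rfl fun l _ => ?_
      rw [htu]; simp only [hx]; ring
    rw [e]
    have h1 : (k - 1) * cs ≤ 0.99 / 4 := by nlinarith
    calc _ ≤ 0.99 / 4 * ∑ l : Fin J, L * g l ^ 2 * u (l + 1) :=
          mul_le_mul_of_nonneg_right h1 hS0
      _ ≤ 0.99 / 4 * 1.0001 := by
          apply mul_le_mul_of_nonneg_left _ (by norm_num); linarith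
      _ ≤ _ := by norm_num
  have hmx0 : 0 ≤ ∑ l, x l * t l := Finset.sum_nonneg fun l _ => mul_nonneg (hx0 l) (ht0 l).le
  have hmy : ∑ l, y l * t l ≤ 300 / k := by
    have h1 : ∑ l, y l * t l ≤ 1001 * cs * ∑ l : Fin J, L * g l ^ 2 * u (l + 1) := by
      rw [Finset.mul_sum]
      refine Finset.sum_le_sum fun l _ => ?_
      rw [htu]
      -- As g is at least 1/1001, the sum linear in g is controlled by the quadratic one already
      -- bounded.
      have hg1 : 1 ≤ 1001 * g l := by
        have h2 := hule (l + 1) l.2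
        have h3 := hu0 (l + 1)
        simp only [hg]
        rw [mul_one_div, le_div_iff₀ (by linarith)]; linarith
      simp only [hy]
      have h4 : 0 ≤ g l * L * (cs * u (l + 1)) := by
        have := hg0 l; have := hu0 (l + 1); positivity
      nlinarith
    have h2 : cs = 0.99 / 4 / k := by rw [← hcsk]; field_simp
    calc _ ≤ 1001 * cs * 1.0001 := h1.trans (mul_le_mul_of_nonneg_left (by linarith) (by positivity))
      _ = (1001 * 0.99 / 4 * 1.0001) / k := by rw [h2]; ring
      _ ≤ _ := by
        apply div_le_div_of_nonneg_right _ hk0.le; norm_num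
  have hmy0 : 0 ≤ ∑ l, y l * t l := Finset.sum_nonneg fun l _ => mul_nonneg (hy0 l) (ht0 l).le
  -- the Chernoff parameter
  set s := Real.sqrt k with hs
  have hs2 : s ^ 2 = k := Real.sq_sqrt hk0.le
  have hs10 : (10 : ℝ) ^ 10 ≤ s := by
    rw [hs]; apply Real.le_sqrt_of_sq_le; norm_num at hk20 ⊢; exact hk20
  have hs0 : 0 < s := lt_of_lt_of_le (by norm_num) hs10
  -- With lam = √k/20 and δ = 250/k the quadratic term lam²δ stays constant, while the gain lam ·
  -- (gap) grows like √k.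
  have hld : s / 20 * (250 / k) ≤ 1 := by
    rw [← hs2, div_mul_div_comm, div_le_one (by positivity)]; nlinarith
  have hl2 : (s / 20) ^ 2 * (250 / k) = 0.625 := by
    rw [div_pow, hs2]; field_simp; norm_num
  have h300 : 300 / (k : ℝ) ≤ 0.0005 := by
    rw [div_le_iff₀ hk0]; linarith
  -- The cap 1/4 is shared as 0.249 + 0.001: x has mean weight at most 0.2476, and y only 300/k.
  have hPx := sum_typesLE_ge (W := 0.249) ht0 hx0 htδ (by positivity) hld
  have hPy := sum_typesLE_ge (W := 0.001) ht0 hy0 htδ (by positivity) hld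
  rw [hl2] at hPx hPy
  have hfx : 0.999 ≤ 1 - Real.exp (-(s / 20 * (0.249 - ∑ l, x l * t l)) +
      0.625 * ∑ l, x l * t l) := by
    have e : -(s / 20 * (0.249 - ∑ l, x l * t l)) + 0.625 * ∑ l, x l * t l =
      -(s / 20 * (0.249 - ∑ l, x l * t l) - 0.625 * ∑ l, x l * t l) := by ring
    rw [e]
    apply one_sub_exp_neg_ge
    have : s / 20 * 0.001 ≤ s / 20 * (0.249 - ∑ l, x l * t l) :=
      mul_le_mul_of_nonneg_left (by linarith) (by positivity)
    norm_num at *; linarith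
  have hfy : 0.999 ≤ 1 - Real.exp (-(s / 20 * (0.001 - ∑ l, y l * t l)) +
      0.625 * ∑ l, y l * t l) := by
    have e : -(s / 20 * (0.001 - ∑ l, y l * t l)) + 0.625 * ∑ l, y l * t l =
      -(s / 20 * (0.001 - ∑ l, y l * t l) - 0.625 * ∑ l, y l * t l) := by ring
    rw [e]
    apply one_sub_exp_neg_ge
    have : s / 20 * 0.0005 ≤ s / 20 * (0.001 - ∑ l, y l * t l) :=
      mul_le_mul_of_nonneg_left (by linarith) (by positivity)
    norm_num at *; linarith
  have hPx' : 0.999 * Real.exp (∑ l, x l) ≤ ∑ n ∈ typesLE t 0.249, expMono x n := by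
    refine le_trans ?_ hPx
    rw [mul_comm]
    exact mul_le_mul_of_nonneg_left hfx (Real.exp_pos _).le
  have hPy' : 0.999 * Real.exp (∑ l, y l) ≤ ∑ n ∈ typesLE t 0.001, expMono y n := by
    refine le_trans ?_ hPy
    rw [mul_comm]
    exact mul_le_mul_of_nonneg_left hfy (Real.exp_pos _).le
  have hQ2 := sum_sq_ge_mul (W := 1 / 4) (W₁ := 0.249) (W₂ := 0.001) ht0 hx0 hy0 (by norm_num)
    (by norm_num)
  have hQ1 := sum_expMono_le (x := fun l : Fin J => k * L * g l ^ 2)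
    (fun l => by positivity) (typesLE t (1 / 4))
  have hlow : 0.997 * Real.exp (∑ l, x l + 2 * ∑ l, y l) ≤
      (∑ γ ∈ typesLE t 0.249, expMono x γ) * (∑ m ∈ typesLE t 0.001, expMono y m) ^ 2 := by
    calc _ ≤ (0.999 * Real.exp (∑ l, x l)) * (0.999 * Real.exp (∑ l, y l)) ^ 2 := by
          have e2 : Real.exp (∑ l, x l + 2 * ∑ l, y l) =
              Real.exp (∑ l, x l) * Real.exp (∑ l, y l) ^ 2 := by
            rw [Real.exp_add, ← Real.exp_nat_mul]; push_cast; rfl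
          rw [e2]
          have hp : 0 ≤ Real.exp (∑ l, x l) * Real.exp (∑ l, y l) ^ 2 := by positivity
          nlinarith
      _ ≤ _ := mul_le_mul hPx' (pow_le_pow_left₀ (by positivity) hPy' 2) (by positivity)
          (le_trans (by positivity) hPx')
  -- Completing the square: (k − 1)g² + 2g = kg² + 1 − (1 − g)². The J ones produce the factor ρ^J,
  -- which turns ε into the top exponent.
  have hsum : ∑ l, x l + 2 * ∑ l, y l = ∑ l : Fin J, k * L * g l ^ 2 +
      (J * L - ∑ l : Fin J, L * (1 - g l) ^ 2) := by
    have e3 : (J : ℝ) * L = ∑ l : Fin J, L := by simp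
    rw [e3, Finset.mul_sum, ← Finset.sum_add_distrib, ← Finset.sum_sub_distrib,
      ← Finset.sum_add_distrib]
    refine Finset.sum_congr rfl fun l _ => ?_
    simp only [hx, hy]; ring
  have hkε : k * (1.61 * ε) * ρ ^ J = 1.61 * (0.99 * 1000 / 4) := by
    have : ε * ρ ^ J = cs * 1000 := by rw [hτ, huJ]
    calc _ = 1.61 * k * (ε * ρ ^ J) := by ring
      _ = 1.61 * (cs * k) * 1000 := by rw [this]; ring
      _ = _ := by rw [hcsk]; ring
  refine ⟨J, ε, ρ, fun l => g l, mul_pos hcs0 (hu0 0), ?_, hρ1, ?_, ?_⟩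
  · have h1 : ε = cs * 1000 / ρ ^ J := by simp only [hε, hu]; ring
    rw [h1, div_le_iff₀ hρJ]
    have h2 : cs * 1000 ≤ 1 := hδ.trans (by rw [div_le_one hk0]; linarith)
    rw [div_lt_iff₀ hε₀] at hJ
    linarith
  · rw [hτ, huJ]
    refine hδ.trans ?_
    rw [div_le_iff₀ hκ] at hkκ
    rw [div_le_iff₀ hk0]; linarith
  · have hexpJ : Real.exp (J * L) = ρ ^ J := by
      rw [Real.exp_nat_mul, hL, Real.exp_log hρ0]
    set E1 := Real.exp (∑ l : Fin J, k * L * g l ^ 2) with hE1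
    have hε0 : 0 < ε := mul_pos hcs0 (hu0 0)
    calc _ ≤ 1.02 * E1 := mul_le_mul_of_nonneg_left hQ1 (by norm_num)
      _ ≤ (1.61 * 0.997 * (0.99 * 1000 / 4) *
          Real.exp (-(ρ ^ 2 * (Real.log (1 + 1000) + 1 / (1 + 1000) - 1)))) * E1 :=
          mul_le_mul_of_nonneg_right (by linarith [extremal_constant_bound hρ]) (Real.exp_pos _).le
      _ ≤ (1.61 * 0.997 * (0.99 * 1000 / 4) *
          Real.exp (-∑ l : Fin J, L * (1 - g l) ^ 2)) * E1 := by
          refine mul_le_mul_of_nonneg_right (mul_le_mul_of_nonneg_left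
            (Real.exp_le_exp.2 (by linarith)) (by norm_num)) (Real.exp_pos _).le
      _ = k * (1.61 * ε) * (0.997 * Real.exp (∑ l, x l + 2 * ∑ l, y l)) := by
          rw [hsum, Real.exp_add, sub_eq_add_neg, Real.exp_add, hexpJ]
          calc _ = 0.997 * (1.61 * (0.99 * 1000 / 4)) *
                Real.exp (-∑ l : Fin J, L * (1 - g l) ^ 2) * E1 := by ring
            _ = _ := by rw [← hkε]; ring
      _ ≤ _ := mul_le_mul_of_nonneg_left (hlow.trans hQ2) (by positivity)

/-! ### Moments of the hit counts as sums over moduli -/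

section Families

variable {ι : Type*} [Fintype ι] [DecidableEq ι]

/-- The sets of primes with exactly `n l` elements in each cell `P l`. -/
def typeFamily (P : ι → Finset ℕ) (n : ι → ℕ) : Finset (Finset ℕ) :=
  blockFamily Finset.univ P (fun l => {n l})

lemma mem_typeFamily {P : ι → Finset ℕ} {n : ι → ℕ} {s : Finset ℕ} :
    s ∈ typeFamily P n ↔ s ⊆ Finset.univ.biUnion P ∧ ∀ l, (s ∩ P l).card = n l := by
  simp [typeFamily, mem_blockFamily]

lemma sum_typeFamily {R : Type*} [CommRing R] {P : ι → Finset ℕ} (hP : Pairwise (fun i j => Disjoint (P i) (P j)))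
    (n : ι → ℕ) (x : ℕ → R) :
    ∑ s ∈ typeFamily P n, ∏ p ∈ s, x p = ∏ l, ∑ S ∈ (P l).powersetCard (n l), ∏ p ∈ S, x p := by
  unfold typeFamily
  rw [sum_blockFamily _ _ (fun i _ j _ hij => hP hij)]
  refine Finset.prod_congr rfl fun l _ => Finset.sum_congr ?_ fun _ _ => rfl
  ext S; simp [Finset.mem_powersetCard]

lemma card_typeFamily_filter_subset {P : ι → Finset ℕ}
    (hP : Pairwise (fun i j => Disjoint (P i) (P j))) {n n' : ι → ℕ}
    {s : Finset ℕ} (hs : s ∈ typeFamily P n) :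
    (((typeFamily P n').filter (fun s' => s' ⊆ s)).card : ℝ) = ∏ l, ((n l).choose (n' l) : ℝ) := by
  rw [mem_typeFamily] at hs
  have h := sum_typeFamily (P := fun l => s ∩ P l) (fun i j hij =>
    (hP hij).mono Finset.inter_subset_right Finset.inter_subset_right) n' (fun _ => (1 : ℝ))
  simp only [Finset.prod_const_one, Finset.sum_const, Finset.card_powersetCard, nsmul_eq_mul,
    mul_one] at h
  simp only [hs.2] at h
  rw [← h]
  congr 2
  ext s'
  rw [Finset.mem_filter, mem_typeFamily, mem_typeFamily, ← Finset.inter_biUnion,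
    Finset.inter_eq_left.2 hs.1]
  constructor
  · rintro ⟨⟨_, h2⟩, h3⟩
    refine ⟨h3, fun l => ?_⟩
    rw [← Finset.inter_assoc, Finset.inter_eq_left.2 h3, h2]
  · rintro ⟨h1, h2⟩
    refine ⟨⟨h1.trans hs.1, fun l => ?_⟩, h1⟩
    rw [← h2 l, ← Finset.inter_assoc, Finset.inter_eq_left.2 h1]

/-- Splitting the sets of type `n' + n''` into a set of type `n'` and a set of type `n''`. -/
lemma sum_typeFamily_split {P : ι → Finset ℕ} (hP : Pairwise (fun i j => Disjoint (P i) (P j)))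
    (n' n'' : ι → ℕ) (F : Finset ℕ → ℝ) :
    (∏ l, ((n' l + n'' l).choose (n' l) : ℝ)) * ∑ s ∈ typeFamily P (n' + n''), F s =
      ∑ s' ∈ typeFamily P n', ∑ s'' ∈ typeFamily P n'',
        if Disjoint s' s'' then F (s' ∪ s'') else 0 := by
  have h1 : (∏ l, ((n' l + n'' l).choose (n' l) : ℝ)) * ∑ s ∈ typeFamily P (n' + n''), F s =
      ∑ s' ∈ typeFamily P n', ∑ s ∈ (typeFamily P (n' + n'')).filter (fun s => s' ⊆ s), F s := by
    rw [Finset.mul_sum]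
    simp_rw [Finset.sum_filter]
    rw [Finset.sum_comm]
    refine Finset.sum_congr rfl fun s hs => ?_
    have := card_typeFamily_filter_subset hP (n' := n') hs
    simp only [Pi.add_apply] at this
    rw [← Finset.sum_filter, Finset.sum_const, nsmul_eq_mul, this]
  rw [h1]
  refine Finset.sum_congr rfl fun s' hs' => ?_
  rw [← Finset.sum_filter]
  rw [mem_typeFamily] at hs'
  refine Finset.sum_bij' (fun s _ => s \ s') (fun s'' _ => s' ∪ s'') ?_ ?_ ?_ ?_ ?_
  · intro s hs
    rw [Finset.mem_filter, mem_typeFamily] at hs ⊢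
    obtain ⟨⟨h2, h3⟩, h4⟩ := hs
    refine ⟨⟨Finset.sdiff_subset.trans h2, fun l => ?_⟩, Finset.disjoint_sdiff⟩
    have e : (s \ s') ∩ P l = (s ∩ P l) \ (s' ∩ P l) := by
      ext p; simp only [Finset.mem_inter, Finset.mem_sdiff]; tauto
    rw [e, Finset.card_sdiff_of_subset (Finset.inter_subset_inter_right h4), h3, hs'.2]
    simp
  · intro s'' hs
    rw [Finset.mem_filter, mem_typeFamily] at hs ⊢
    obtain ⟨⟨h2, h3⟩, h4⟩ := hs
    refine ⟨⟨Finset.union_subset hs'.1 h2, fun l => ?_⟩, Finset.subset_union_left⟩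
    rw [Finset.union_inter_distrib_right, Finset.card_union_of_disjoint
      (h4.mono Finset.inter_subset_left Finset.inter_subset_left), h3, hs'.2]
    rfl
  · intro s hs
    exact Finset.union_sdiff_of_subset (Finset.mem_filter.1 hs).2
  · intro s'' hs
    exact Finset.union_sdiff_cancel_left (Finset.mem_filter.1 hs).2
  · intro s hs
    rw [Finset.union_sdiff_of_subset (Finset.mem_filter.1 hs).2]

/-- The indicator of `Hits`. -/
def hitInd (H : Finset ℤ) (m : ℤ) (p : ℕ) : ℝ := if Hits H p m then 1 else 0

lemma prod_hitInd (H : Finset ℤ) (m : ℤ) (S : Finset ℕ) :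
    ∏ p ∈ S, hitInd H m p = if ∀ p ∈ S, Hits H p m then 1 else 0 := by
  unfold hitInd
  rw [Finset.prod_ite_zero]; simp

/-- The number of primes in each cell that hit `m`. -/
def hitCount (H : Finset ℤ) (P : ι → Finset ℕ) (m : ℤ) (l : ι) : ℕ :=
  ((P l).filter (fun p => Hits H p m)).card

/-- Both sides count the ways to choose n_l hitting primes in each cell. -/
lemma multiChoose_hitCount (H : Finset ℤ) {P : ι → Finset ℕ}
    (hP : Pairwise (fun i j => Disjoint (P i) (P j))) (m : ℤ) (n : ι → ℕ) :
    multiChoose (hitCount H P m) n = ∑ s ∈ typeFamily P n, ∏ p ∈ s, hitInd H m p := by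
  rw [sum_typeFamily hP]
  unfold multiChoose hitCount
  refine Finset.prod_congr rfl fun l _ => ?_
  simp_rw [prod_hitInd]
  rw [← Finset.sum_filter, ← Finset.card_powersetCard, Finset.sum_const, nsmul_eq_mul, mul_one]
  congr 2
  ext S
  simp only [Finset.mem_powersetCard, Finset.mem_filter]
  constructor
  · rintro ⟨h1, h2⟩
    exact ⟨⟨fun p hp => (Finset.mem_filter.1 (h1 hp)).1, h2⟩,
      fun p hp => (Finset.mem_filter.1 (h1 hp)).2⟩
  · rintro ⟨⟨h1, h2⟩, h3⟩
    exact ⟨fun p hp => Finset.mem_filter.2 ⟨h1 hp, h3 p hp⟩, h2⟩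

/-- The sieve weight attached to a family of sets of primes. -/
def sieveWeight (H : Finset ℤ) (D : Finset (Finset ℕ)) (m : ℤ) : ℝ :=
  ∑ e ∈ D, ∏ p ∈ e, (-hitInd H m p)

/-- Expansion of a sieve-weighted moment into sums over residue classes. -/
lemma sum_sieveWeight_mul_multiChoose (H : Finset ℤ) (D : Finset (Finset ℕ)) {P : ι → Finset ℕ}
    (hP : Pairwise (fun i j => Disjoint (P i) (P j))) {β : Type*} (I : Finset β) (w : β → ℝ)
    (m : β → ℤ) (n : ι → ℕ) :
    ∑ x ∈ I, w x * sieveWeight H D (m x) * multiChoose (hitCount H P (m x)) n =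
      ∑ e ∈ D, ∑ s ∈ typeFamily P n,
        (-1) ^ e.card * ∑ x ∈ I.filter (fun x => ∀ p ∈ e ∪ s, Hits H p (m x)), w x := by
  simp_rw [multiChoose_hitCount H hP, sieveWeight]
  have h1 : ∀ x ∈ I, w x * (∑ e ∈ D, ∏ p ∈ e, (-hitInd H (m x) p)) *
      ∑ s ∈ typeFamily P n, ∏ p ∈ s, hitInd H (m x) p =
      ∑ e ∈ D, ∑ s ∈ typeFamily P n, (-1) ^ e.card *
        (if ∀ p ∈ e ∪ s, Hits H p (m x) then w x else 0) := by
    intro x _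
    rw [mul_assoc, Finset.sum_mul_sum, Finset.mul_sum]
    refine Finset.sum_congr rfl fun e _ => ?_
    rw [Finset.mul_sum]
    refine Finset.sum_congr rfl fun s _ => ?_
    rw [Finset.prod_neg, prod_hitInd, prod_hitInd]
    by_cases h1 : ∀ p ∈ e, Hits H p (m x)
    · by_cases h2 : ∀ p ∈ s, Hits H p (m x)
      · rw [if_pos h1, if_pos h2, if_pos]
        · ring
        · intro p hp
          rcases Finset.mem_union.1 hp with h | h
          · exact h1 p h
          · exact h2 p h
      · have h3 : ¬ ∀ p ∈ e ∪ s, Hits H p (m x) :=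
          fun h => h2 fun p hp => h p (Finset.mem_union_right _ hp)
        simp only [if_neg h2, if_neg h3, mul_zero]
    · have h3 : ¬ ∀ p ∈ e ∪ s, Hits H p (m x) :=
        fun h => h1 fun p hp => h p (Finset.mem_union_left _ hp)
      simp only [if_neg h1, if_neg h3, mul_zero, zero_mul]
  rw [Finset.sum_congr rfl h1, Finset.sum_comm]
  refine Finset.sum_congr rfl fun e _ => ?_
  rw [Finset.sum_comm]
  refine Finset.sum_congr rfl fun s _ => ?_
  rw [← Finset.mul_sum, Finset.sum_filter]

lemma disjoint_of_mem_typeFamily {P : ι → Finset ℕ} {Z : Finset ℕ} (hZ : ∀ l, Disjoint Z (P l))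
    {n : ι → ℕ} {s e : Finset ℕ} (he : e ⊆ Z) (hs : s ∈ typeFamily P n) : Disjoint e s := by
  have h1 : Disjoint Z (Finset.univ.biUnion P) := by
    rw [Finset.disjoint_biUnion_right]; exact fun l _ => hZ l
  exact h1.mono he (mem_typeFamily.1 hs).1

/-- Sieve primes and cell primes are disjoint, so a multiplicative density factors and the main term
splits into a sieve sum times a cell sum. -/
lemma sum_sum_signed_prod {P : ι → Finset ℕ} {Z : Finset ℕ} (hZ : ∀ l, Disjoint Z (P l))
    {D : Finset (Finset ℕ)} (hD : ∀ e ∈ D, e ⊆ Z) (n : ι → ℕ) (g : ℕ → ℝ) :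
    ∑ e ∈ D, ∑ s ∈ typeFamily P n, (-1) ^ e.card * ∏ p ∈ e ∪ s, g p =
      (∑ e ∈ D, ∏ p ∈ e, (-g p)) * ∑ s ∈ typeFamily P n, ∏ p ∈ s, g p := by
  rw [Finset.sum_mul_sum]
  refine Finset.sum_congr rfl fun e he => Finset.sum_congr rfl fun s hs => ?_
  rw [Finset.prod_union (disjoint_of_mem_typeFamily hZ (hD e he) hs), Finset.prod_neg, mul_assoc]

lemma prod_primes_injOn {F : Set (Finset ℕ)} (hF : ∀ s ∈ F, ∀ p ∈ s, p.Prime) :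
    Set.InjOn (fun s : Finset ℕ => ∏ p ∈ s, p) F := by
  intro s hs s' hs' h
  have := congrArg Nat.primeFactors h
  simpa [Nat.primeFactors_prod (hF s hs), Nat.primeFactors_prod (hF s' hs')] using this

/-- Distinct sets of primes have distinct products, which are integers in [1, Y]. -/
lemma card_family_le {F : Finset (Finset ℕ)} (hF : ∀ s ∈ F, ∀ p ∈ s, p.Prime) {Y : ℝ} (hY : 0 ≤ Y)
    (h : ∀ s ∈ F, ∏ p ∈ s, (p : ℝ) ≤ Y) : (F.card : ℝ) ≤ Y := by
  have h1 : F.card ≤ (Finset.Icc 1 ⌊Y⌋₊).card := by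
    refine Finset.card_le_card_of_injOn (fun s => ∏ p ∈ s, p) (fun s hs => ?_)
      (prod_primes_injOn hF)
    simp only [Finset.coe_Icc, Set.mem_Icc]
    refine ⟨prod_primes_pos (hF s hs), Nat.le_floor ?_⟩
    push_cast; exact h s hs
  rw [Nat.card_Icc] at h1
  calc (F.card : ℝ) ≤ (⌊Y⌋₊ : ℝ) := by exact_mod_cast (by simpa using h1)
    _ ≤ Y := Nat.floor_le hY

lemma prod_le_of_mem_typeFamily {P : ι → Finset ℕ}
    (hP : Pairwise (fun i j => Disjoint (P i) (P j))) {X : ℝ} (hX : 1 ≤ X) {t : ι → ℝ}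
    (ht : ∀ l, ∀ p ∈ P l, (p : ℝ) ≤ X ^ t l) {n : ι → ℕ} {s : Finset ℕ}
    (hs : s ∈ typeFamily P n) : ∏ p ∈ s, (p : ℝ) ≤ X ^ typeWeight t n := by
  rw [mem_typeFamily] at hs
  have hX0 : 0 < X := by linarith
  rw [prod_inter_biUnion (fun i _ j _ hij => hP hij) hs.1, typeWeight,
    Real.rpow_sum_of_pos hX0]
  refine Finset.prod_le_prod (fun _ _ => Finset.prod_nonneg fun _ _ => by positivity) fun l _ => ?_
  calc _ ≤ ∏ p ∈ s ∩ P l, X ^ t l := Finset.prod_le_prod (fun _ _ => by positivity)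
        (fun p hp => ht l p (Finset.mem_inter.1 hp).2)
    _ = _ := by
      rw [Finset.prod_const, hs.2, ← Real.rpow_mul_natCast hX0.le, mul_comm]

/-- Coefficients supported on the image of an injective map. -/
lemma exists_coefficients {σ : Type*} (S : Finset σ) (φ : σ → ℕ) (hφ : Set.InjOn φ S) (c : σ → ℝ)
    (hc : ∀ x, |c x| ≤ 1) (A : ℝ) (hA : ∀ x ∈ S, φ x ∈ Finset.Icc 1 ⌊A⌋₊) :
    ∃ α : ℕ → ℝ, (∀ a, |α a| ≤ 1) ∧ ∀ G : ℕ → ℝ,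
      ∑ a ∈ Finset.Icc 1 ⌊A⌋₊, α a * G a = ∑ x ∈ S, c x * G (φ x) := by
  refine ⟨fun a => ∑ x ∈ S, if φ x = a then c x else 0, fun a => ?_, fun G => ?_⟩
  · change |∑ x ∈ S, if φ x = a then c x else 0| ≤ 1
    by_cases h : ∃ x ∈ S, φ x = a
    · obtain ⟨x, hx, rfl⟩ := h
      rw [Finset.sum_eq_single_of_mem x hx, if_pos rfl]
      · exact hc x
      · intro y hy hne
        exact if_neg fun h => hne (hφ hy hx h)
    · push Not at h
      rw [Finset.sum_eq_zero fun x hx => if_neg (h x hx)]; simp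
  · simp_rw [Finset.sum_mul]
    rw [Finset.sum_comm]
    refine Finset.sum_congr rfl fun x hx => ?_
    rw [Finset.sum_eq_single_of_mem (φ x) (hA x hx)]
    · rw [if_pos rfl]
    · intro a _ hne
      rw [if_neg (Ne.symm hne), zero_mul]

lemma abs_bilinearSum_le (H : Finset ℤ) (h : ℤ) (N : ℕ) (A B : ℝ) {α β : ℕ → ℝ}
    (hα : ∀ a, |α a| ≤ 1) (hβ : ∀ b, |β b| ≤ 1) :
    |bilinearSum H h N A B α β| ≤ bilinearError H h N A B :=
  le_csSup (bddAbove_bilinearValues H h N A B) ⟨α, β, hα, hβ, rfl⟩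

lemma bilinearSum_comm (H : Finset ℤ) (h : ℤ) (N : ℕ) (A B : ℝ) (α β : ℕ → ℝ) :
    bilinearSum H h N A B α β = bilinearSum H h N B A β α := by
  unfold bilinearSum
  rw [Finset.sum_comm]
  refine Finset.sum_congr rfl fun b _ => Finset.sum_congr rfl fun a _ => ?_
  rw [mul_comm (α a), mul_comm a b]

lemma bilinearError_comm (H : Finset ℤ) (h : ℤ) (N : ℕ) (A B : ℝ) :
    bilinearError H h N A B = bilinearError H h N B A := by
  unfold bilinearError
  congr 1
  ext x
  constructor <;> rintro ⟨α, β, hα, hβ, rfl⟩ <;>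
    exact ⟨β, α, hβ, hα, by rw [bilinearSum_comm]⟩

/-- The error terms of a moment are controlled by the bilinear form. -/
lemma abs_error_le_bilinearError (H : Finset ℤ) (h : ℤ) (N : ℕ) {P : ι → Finset ℕ}
    (hP : Pairwise (fun i j => Disjoint (P i) (P j))) (hPp : ∀ l, ∀ p ∈ P l, p.Prime)
    {Z : Finset ℕ} (hZ : ∀ l, Disjoint Z (P l)) (hZp : ∀ p ∈ Z, p.Prime)
    {D : Finset (Finset ℕ)} (hD : ∀ e ∈ D, e ⊆ Z) (n' n'' : ι → ℕ) {A B Y : ℝ}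
    (hY : 0 ≤ Y) (hDY : ∀ e ∈ D, ∏ p ∈ e, (p : ℝ) ≤ Y) {Y' : ℝ}
    (hA : ∀ s ∈ typeFamily P n', ∏ p ∈ s, (p : ℝ) ≤ Y') (hAY : Y * Y' ≤ A)
    (hB : ∀ s ∈ typeFamily P n'', ∏ p ∈ s, (p : ℝ) ≤ B) :
    |∑ e ∈ D, ∑ s ∈ typeFamily P (n' + n''), (-1) ^ e.card *
      ∑ r ∈ OmegaStar H h (∏ p ∈ e ∪ s, p), EStar N ((r : ℤ) + h) (∏ p ∈ e ∪ s, p)| ≤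
      bilinearError H h N A B := by
  set G : ℕ → ℝ := fun q => ∑ r ∈ OmegaStar H h q, EStar N ((r : ℤ) + h) q with hG
  have hG0 : ∀ q, ¬ Squarefree q → G q = 0 := fun q hq => by
    simp only [hG]; rw [OmegaStar_of_not_squarefree hq]; simp
  have hTp : ∀ n : ι → ℕ, ∀ s ∈ typeFamily P n, ∀ p ∈ s, p.Prime := fun n s hs p hp => by
    obtain ⟨l, _, hl⟩ := Finset.mem_biUnion.1 ((mem_typeFamily.1 hs).1 hp)
    exact hPp l p hl
  have hDp : ∀ e ∈ D, ∀ p ∈ e, p.Prime := fun e he p hp => hZp p (hD e he hp)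
  have hpos : ∀ s : Finset ℕ, 0 ≤ ∏ p ∈ s, (p : ℝ) := fun s => Finset.prod_nonneg fun _ _ => by
    positivity
  obtain ⟨α, hα1, hα2⟩ := exists_coefficients (D ×ˢ typeFamily P n')
    (fun x => (∏ p ∈ x.1, p) * ∏ p ∈ x.2, p) (by
      intro x hx y hy hxy
      simp only [Finset.coe_product, Set.mem_prod, Finset.mem_coe] at hx hy
      have hdx := disjoint_of_mem_typeFamily hZ (hD _ hx.1) hx.2
      have hdy := disjoint_of_mem_typeFamily hZ (hD _ hy.1) hy.2
      simp only [← Finset.prod_union hdx, ← Finset.prod_union hdy] at hxy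
      have hpr : ∀ x : Finset ℕ × Finset ℕ, x.1 ∈ D → x.2 ∈ typeFamily P n' →
          ∀ p ∈ x.1 ∪ x.2, p.Prime := by
        intro x h1 h2 p hp
        rcases Finset.mem_union.1 hp with h | h
        · exact hDp _ h1 p h
        · exact hTp _ _ h2 p h
      have hun : x.1 ∪ x.2 = y.1 ∪ y.2 := prod_primes_injOn
        (F := {s | ∀ p ∈ s, p.Prime}) (fun s hs => hs) (hpr x hx.1 hx.2) (hpr y hy.1 hy.2) hxy
      -- Unique factorisation returns the union of the two sets, and intersecting with Z separates
      -- the sieve part from the cell part.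
      have hZu : ∀ x : Finset ℕ × Finset ℕ, x.1 ∈ D → x.2 ∈ typeFamily P n' →
          (x.1 ∪ x.2) ∩ Z = x.1 ∧ (x.1 ∪ x.2) \ Z = x.2 := by
        intro x h1 h2
        have hd : Disjoint Z x.2 := disjoint_of_mem_typeFamily hZ subset_rfl h2
        have hs := hD _ h1
        constructor
        · rw [Finset.union_inter_distrib_right, Finset.inter_eq_left.2 hs,
            Finset.disjoint_iff_inter_eq_empty.1 hd.symm, Finset.union_empty]
        · rw [Finset.union_sdiff_distrib, Finset.sdiff_eq_empty_iff_subset.2 hs,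
            Finset.empty_union, Finset.sdiff_eq_self_of_disjoint hd.symm]
      have hx' := hZu x hx.1 hx.2
      have hy' := hZu y hy.1 hy.2
      exact Prod.ext (by rw [← hx'.1, ← hy'.1, hun]) (by rw [← hx'.2, ← hy'.2, hun]))
    (fun x => (-1) ^ x.1.card) (fun x => by simp) A (by
      intro x hx
      rw [Finset.mem_product] at hx
      rw [Finset.mem_Icc]
      refine ⟨Nat.mul_pos (prod_primes_pos (hDp _ hx.1)) (prod_primes_pos (hTp _ _ hx.2)),
        Nat.le_floor ?_⟩
      push_cast
      exact (mul_le_mul (hDY _ hx.1) (hA _ hx.2) (hpos _) hY).trans hAY)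
  obtain ⟨β, hβ1, hβ2⟩ := exists_coefficients (typeFamily P n'') (fun s => ∏ p ∈ s, p)
    (prod_primes_injOn (hTp n'')) (fun _ => 1) (fun _ => by simp) B (by
      intro s hs
      rw [Finset.mem_Icc]
      refine ⟨prod_primes_pos (hTp _ _ hs), Nat.le_floor ?_⟩
      push_cast; exact hB s hs)
  have hbil : bilinearSum H h N A B α β = ∑ e ∈ D, ∑ s' ∈ typeFamily P n',
      ∑ s'' ∈ typeFamily P n'', (-1) ^ e.card *
        G ((∏ p ∈ e, p) * (∏ p ∈ s', p) * ∏ p ∈ s'', p) := by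
    have h1 : bilinearSum H h N A B α β = ∑ a ∈ Finset.Icc 1 ⌊A⌋₊, α a *
        ∑ b ∈ Finset.Icc 1 ⌊B⌋₊, β b * G (a * b) := by
      unfold bilinearSum
      refine Finset.sum_congr rfl fun a _ => ?_
      rw [Finset.mul_sum]
      exact Finset.sum_congr rfl fun b _ => by simp only [hG]; ring
    rw [h1, hα2, Finset.sum_product]
    refine Finset.sum_congr rfl fun e _ => Finset.sum_congr rfl fun s' _ => ?_
    rw [hβ2 (fun b => G ((∏ p ∈ e, p) * (∏ p ∈ s', p) * b)), Finset.mul_sum]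
    simp only [one_mul]
  set ch : ℝ := ∏ l, ((n' l + n'' l).choose (n' l) : ℝ) with hch
  have hch1 : 1 ≤ ch := by
    rw [hch]
    exact_mod_cast Finset.prod_pos fun l _ =>
      Nat.choose_pos (Nat.le_add_right (n' l) (n'' l))
  -- Each set of type n' + n'' arises from exactly `ch` ordered splittings. Overlapping pairs give a
  -- modulus that is not square-free, where Ω* is empty; so the full bilinear form is `ch` ≥ 1 times
  -- the error.
  have hkey : ch * ∑ e ∈ D, ∑ s ∈ typeFamily P (n' + n''), (-1) ^ e.card * G (∏ p ∈ e ∪ s, p) =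
      bilinearSum H h N A B α β := by
    rw [hbil, Finset.mul_sum]
    refine Finset.sum_congr rfl fun e he => ?_
    rw [hch, sum_typeFamily_split hP n' n'' (fun s => (-1) ^ e.card * G (∏ p ∈ e ∪ s, p))]
    refine Finset.sum_congr rfl fun s' hs' => Finset.sum_congr rfl fun s'' hs'' => ?_
    split_ifs with hd
    · rw [Finset.prod_union, Finset.prod_union hd, mul_assoc]
      rw [Finset.disjoint_union_right]
      exact ⟨disjoint_of_mem_typeFamily hZ (hD e he) hs',
        disjoint_of_mem_typeFamily hZ (hD e he) hs''⟩
    · rw [hG0, mul_zero]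
      intro hsq
      obtain ⟨p, hp, hp'⟩ := Finset.not_disjoint_iff.1 hd
      have hdvd : p * p ∣ (∏ p ∈ e, p) * (∏ p ∈ s', p) * ∏ p ∈ s'', p :=
        mul_dvd_mul ((Finset.dvd_prod_of_mem _ hp).mul_left _) (Finset.dvd_prod_of_mem _ hp')
      exact (hTp _ _ hs' p hp).not_isUnit (hsq p hdvd)
  have hfin := abs_bilinearSum_le H h N A B hα1 hβ1
  rw [← hkey, abs_mul, abs_of_pos (by linarith)] at hfin
  exact (le_mul_of_one_le_left (abs_nonneg _) hch1).trans hfin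

/-- The greedy splitting of a type of weight at most `1 / 2` between two factors. -/
lemma exists_type_split {t : ι → ℝ} {c α β : ℝ} (htc : ∀ l, t l ≤ c)
    (hβ : 0 ≤ β) (hαβ : β ≤ α) (hsum : 1 / 2 + 4 * c ≤ α + β) (hc : 0 ≤ c) {n : ι → ℕ}
    (hn : typeWeight t n ≤ 1 / 2) :
    ∃ n' n'' : ι → ℕ, n = n' + n'' ∧ c + typeWeight t n' ≤ α ∧ typeWeight t n'' ≤ β := by
  have h0 : typeWeight t (0 : ι → ℕ) = 0 := by simp [typeWeight]
  have hne : ((Finset.Iic n).filter (fun n' => c + typeWeight t n' ≤ α)).Nonempty :=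
    ⟨0, Finset.mem_filter.2 ⟨by simp, by rw [h0]; linarith⟩⟩
  -- Take n' as large as the first factor allows. If anything remains, adding one more prime would
  -- overflow, so c + (weight of n') > α − c, and what is left fits into β.
  obtain ⟨n', hn', hmax⟩ := Finset.exists_max_image _ (fun n' : ι → ℕ => ∑ l, n' l) hne
  rw [Finset.mem_filter, Finset.mem_Iic] at hn'
  have hadd : n = n' + (n - n') := (add_tsub_cancel_of_le hn'.1).symm
  refine ⟨n', n - n', hadd, hn'.2, ?_⟩
  have hw : typeWeight t n = typeWeight t n' + typeWeight t (n - n') := by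
    rw [← typeWeight_add, ← hadd]
  by_cases heq : n' = n
  · rw [heq, tsub_self, h0]; exact hβ
  · have : ∃ l, n' l < n l := by
      by_contra hcon
      push Not at hcon
      exact heq (le_antisymm hn'.1 hcon)
    obtain ⟨l, hl⟩ := this
    have hlt : ¬ (c + typeWeight t (n' + Pi.single l 1) ≤ α) := by
      intro hle
      have hmem : n' + Pi.single l 1 ∈ (Finset.Iic n).filter (fun n' => c + typeWeight t n' ≤ α) := by
        refine Finset.mem_filter.2 ⟨Finset.mem_Iic.2 fun j => ?_, hle⟩
        by_cases hj : j = l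
        · subst hj; simpa using hl
        · simpa [hj] using hn'.1 j
      have := hmax _ hmem
      simp [Finset.sum_add_distrib] at this
    have hsingle : typeWeight t (Pi.single l 1 : ι → ℕ) = t l := by
      unfold typeWeight
      rw [Finset.sum_eq_single l] <;> simp +contextual
    rw [typeWeight_add, hsingle] at hlt
    have := htc l
    linarith

end Families

/-! ### Local densities and the sieve product -/

section Densities

/-- The density of the classes of `Ω(p)` among the integers. -/
noncomputable def intDensity (H : Finset ℤ) (p : ℕ) : ℝ := (Omega H p).card / p

/-- The density of the classes of `Ω*(p)` among the reduced residues. -/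
noncomputable def primeDensity (H : Finset ℤ) (p : ℕ) : ℝ := ((Omega H p).card - 1) / ((p : ℝ) - 1)

lemma card_Omega_le (H : Finset ℤ) (p : ℕ) : (Omega H p).card ≤ H.card := Finset.card_image_le

lemma one_le_card_Omega {H : Finset ℤ} (hH : H.Nonempty) (p : ℕ) : 1 ≤ (Omega H p).card :=
  Finset.card_pos.2 (hH.image _)

/-- A prime or any other modulus exceeding every |h − h'| keeps the elements of H distinct. -/
lemma eventually_card_Omega (H : Finset ℤ) : ∀ᶠ p : ℕ in atTop, (Omega H p).card = H.card := by
  filter_upwards [eventually_gt_atTop (2 * ∑ h ∈ H, h.natAbs)] with p hp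
  refine Finset.card_image_of_injOn fun h hh h' hh' heq => ?_
  have h1 : ((h : ℤ) : ZMod p) = ((h' : ℤ) : ZMod p) := neg_injective heq
  rw [ZMod.intCast_eq_intCast_iff_dvd_sub] at h1
  have a1 := Finset.single_le_sum (f := fun h : ℤ => h.natAbs) (fun _ _ => Nat.zero_le _) hh
  have a2 := Finset.single_le_sum (f := fun h : ℤ => h.natAbs) (fun _ _ => Nat.zero_le _) hh'
  have h2 := Int.eq_zero_of_abs_lt_dvd h1 (abs_lt.2 ⟨by omega, by omega⟩)
  omega

lemma intDensity_nonneg (H : Finset ℤ) (p : ℕ) : 0 ≤ intDensity H p := by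
  unfold intDensity; positivity

lemma intDensity_le (H : Finset ℤ) (p : ℕ) : intDensity H p ≤ H.card / p := by
  unfold intDensity
  have := card_Omega_le H p
  gcongr

lemma inv_le_one_sub_intDensity {H : Finset ℤ} (hadm : Admissible H) {p : ℕ} (hp : p.Prime) :
    1 / (p : ℝ) ≤ 1 - intDensity H p := by
  have h1 : (0 : ℝ) < p := by exact_mod_cast hp.pos
  have h2 : ((Omega H p).card : ℝ) + 1 ≤ p := by exact_mod_cast hadm p hp
  unfold intDensity
  rw [le_sub_iff_add_le, ← add_div, div_le_one h1]
  linarith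

lemma primeDensity_nonneg {H : Finset ℤ} (hH : H.Nonempty) {p : ℕ} (hp : 1 ≤ p) :
    0 ≤ primeDensity H p := by
  have h1 : (1 : ℝ) ≤ (Omega H p).card := by exact_mod_cast one_le_card_Omega hH p
  have h2 : (1 : ℝ) ≤ p := by exact_mod_cast hp
  exact div_nonneg (by linarith) (by linarith)

/-- 1 − (ν − 1)/(p − 1) = (p − ν)/(p − 1). The extra factor (1 − 1/p)⁻¹, multiplied over p ≤ z, is
the gain of order log z on the prime side. -/
lemma one_sub_primeDensity {H : Finset ℤ} {p : ℕ} (hp : p.Prime) :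
    1 - primeDensity H p = (1 - intDensity H p) * (1 - 1 / (p : ℝ))⁻¹ := by
  have h1 : (1 : ℝ) < p := by exact_mod_cast hp.one_lt
  have h2 : (p : ℝ) - 1 ≠ 0 := by linarith
  have h3 : (p : ℝ) ≠ 0 := by linarith
  unfold primeDensity intDensity
  field_simp
  ring

lemma primeDensity_le_one {H : Finset ℤ} (hadm : Admissible H) {p : ℕ} (hp : p.Prime) :
    primeDensity H p ≤ 1 := by
  have h1 : (1 : ℝ) < p := by exact_mod_cast hp.one_lt
  have h2 : ((Omega H p).card : ℝ) + 1 ≤ p := by exact_mod_cast hadm p hp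
  unfold primeDensity
  rw [div_le_one (by linarith)]
  linarith

lemma tendsto_mul_intDensity (H : Finset ℤ) :
    Tendsto (fun p : ℕ => (p : ℝ) * intDensity H p) atTop (nhds H.card) := by
  refine tendsto_const_nhds.congr' ?_
  filter_upwards [eventually_card_Omega H, eventually_gt_atTop 0] with p hp hp0
  have : (p : ℝ) ≠ 0 := by positivity
  unfold intDensity
  rw [hp]; field_simp

lemma tendsto_mul_primeDensity (H : Finset ℤ) :
    Tendsto (fun p : ℕ => (p : ℝ) * primeDensity H p) atTop (nhds (H.card - 1)) := by
  have h1 : Tendsto (fun p : ℕ => ((H.card : ℝ) - 1) * (1 + 1 / ((p : ℝ) - 1))) atTop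
      (nhds (((H.card : ℝ) - 1) * (1 + 0))) := by
    refine tendsto_const_nhds.mul (tendsto_const_nhds.add ?_)
    refine tendsto_const_nhds.div_atTop ?_
    exact tendsto_atTop_add_const_right _ _ tendsto_natCast_atTop_atTop
  rw [add_zero, mul_one] at h1
  refine h1.congr' ?_
  filter_upwards [eventually_card_Omega H, eventually_gt_atTop 1] with p hp hp0
  have h2 : (1 : ℝ) < p := by exact_mod_cast hp0
  have : (p : ℝ) - 1 ≠ 0 := by linarith
  unfold primeDensity
  rw [hp]; field_simp
  ring

/-- A lower bound for the sieve product of an admissible set. -/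
lemma exists_prod_one_sub_intDensity_ge {H : Finset ℤ} (hadm : Admissible H) :
    ∃ c₀ : ℝ, 0 < c₀ ∧ ∀ᶠ z : ℝ in atTop,
      c₀ * (Real.log z ^ (2 * H.card))⁻¹ ≤ ∏ p ∈ primesIoc 0 z, (1 - intDensity H p) := by
  obtain ⟨C, hC, hsum⟩ := sum_primes_le
  set k := H.card with hk
  -- Up to 2k only 1 − ν/p ≥ 1/p is available, from admissibility. Beyond, the density is at most
  -- 1/2 and 1 − x ≥ exp(−2x) applies, whence the crude exponent 2k of the logarithm.
  set F := primesIoc 0 (2 * (k : ℝ)) with hF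
  have hFpos : 0 < ∏ p ∈ F, (1 / (p : ℝ)) := Finset.prod_pos fun p hp => by
    have := (prime_of_mem_primesIoc hp).pos
    positivity
  refine ⟨(∏ p ∈ F, (1 / (p : ℝ))) * Real.exp (-(2 * (k * C))), by positivity, ?_⟩
  filter_upwards [eventually_ge_atTop (2 * (k : ℝ)), eventually_ge_atTop 3] with z hz hz3
  have hlog : 0 < Real.log z := Real.log_pos (by linarith)
  have hsub : F ⊆ primesIoc 0 z := by
    intro p hp
    rw [hF, mem_primesIoc le_rfl] at hp
    rw [mem_primesIoc le_rfl]
    exact ⟨hp.1, hp.2.1, hp.2.2.trans hz⟩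
  rw [← Finset.prod_sdiff hsub, mul_assoc, mul_comm]
  refine mul_le_mul ?_ ?_ hFpos.le ?_
  · have hΛ : ∑ p ∈ primesIoc 0 z \ F, intDensity H p ≤ k * (Real.log (Real.log z) + C) := by
      calc _ ≤ ∑ p ∈ primesIoc 0 z \ F, (k : ℝ) * (1 / p) := Finset.sum_le_sum fun p _ => by
            rw [mul_one_div]; exact intDensity_le H p
        _ ≤ ∑ p ∈ primesIoc 0 z, (k : ℝ) * (1 / p) :=
            Finset.sum_le_sum_of_subset_of_nonneg Finset.sdiff_subset fun _ _ _ => by positivity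
        _ ≤ _ := by
            rw [← Finset.mul_sum]
            exact mul_le_mul_of_nonneg_left (hsum z (by linarith)) (by positivity)
    have := prod_one_sub_ge_exp (primesIoc 0 z \ F) (intDensity H) (fun p hp => by
      rw [Finset.mem_sdiff] at hp
      refine ⟨intDensity_nonneg H p, (intDensity_le H p).trans ?_⟩
      have hp' := (mem_primesIoc le_rfl).1 hp.1
      have h2 : 2 * (k : ℝ) < p := by
        by_contra hcon
        exact hp.2 ((mem_primesIoc le_rfl).2 ⟨hp'.1, hp'.2.1, not_lt.1 hcon⟩)
      rw [div_le_iff₀ hp'.2.1]; linarith) hΛ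
    refine le_trans (le_of_eq ?_) this
    rw [show -(2 * ((k : ℝ) * (Real.log (Real.log z) + C))) =
      -(2 * (k * C)) + -(((2 * k : ℕ) : ℝ) * Real.log (Real.log z)) by push_cast; ring,
      Real.exp_add, Real.exp_neg (((2 * k : ℕ) : ℝ) * _), Real.exp_nat_mul, Real.exp_log hlog]
  · exact Finset.prod_le_prod (fun _ _ => by positivity) fun p hp =>
      inv_le_one_sub_intDensity hadm (prime_of_mem_primesIoc hp)
  · refine Finset.prod_nonneg fun p hp => ?_
    have hp' := prime_of_mem_primesIoc (Finset.mem_sdiff.1 hp).1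
    have := inv_le_one_sub_intDensity hadm hp'
    exact le_trans (by positivity) this

end Densities

/-! ### Cells of primes and their Poisson limits -/

section Cells

/-- The cells of primes between consecutive powers `N ^ (ε ρ ^ l)`. -/
noncomputable def cell (ε ρ : ℝ) (J N : ℕ) (l : Fin J) : Finset ℕ :=
  primesIoc ((N : ℝ) ^ (ε * ρ ^ (l : ℕ))) ((N : ℝ) ^ (ε * ρ ^ ((l : ℕ) + 1)))

lemma mem_cell {ε ρ : ℝ} {J N : ℕ} {l : Fin J} {p : ℕ} :
    p ∈ cell ε ρ J N l ↔ p.Prime ∧ (N : ℝ) ^ (ε * ρ ^ (l : ℕ)) < p ∧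
      (p : ℝ) ≤ (N : ℝ) ^ (ε * ρ ^ ((l : ℕ) + 1)) :=
  mem_primesIoc (by positivity)

lemma pairwise_disjoint_cell {ε ρ : ℝ} (hε : 0 ≤ ε) (hρ : 1 ≤ ρ) {J N : ℕ} (hN : 1 ≤ N) :
    Pairwise (fun i j => Disjoint (cell ε ρ J N i) (cell ε ρ J N j)) := by
  have hN1 : (1 : ℝ) ≤ N := by exact_mod_cast hN
  have key : ∀ i j : Fin J, i < j → Disjoint (cell ε ρ J N i) (cell ε ρ J N j) := by
    intro i j hij
    rw [Finset.disjoint_left]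
    intro p hi hj
    rw [mem_cell] at hi hj
    have : (N : ℝ) ^ (ε * ρ ^ ((i : ℕ) + 1)) ≤ (N : ℝ) ^ (ε * ρ ^ (j : ℕ)) :=
      Real.rpow_le_rpow_of_exponent_le hN1
        (mul_le_mul_of_nonneg_left (pow_le_pow_right₀ hρ hij) hε)
    linarith [hi.2.2, hj.2.1]
  intro i j hij
  rcases lt_or_gt_of_ne hij with h | h
  · exact key i j h
  · exact (key j i h).symm

lemma disjoint_primesIoc_cell {ε ρ : ℝ} (hε : 0 ≤ ε) (hρ : 1 ≤ ρ) {J N : ℕ} (hN : 1 ≤ N)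
    (l : Fin J) : Disjoint (primesIoc 0 ((N : ℝ) ^ ε)) (cell ε ρ J N l) := by
  have hN1 : (1 : ℝ) ≤ N := by exact_mod_cast hN
  rw [Finset.disjoint_left]
  intro p hi hj
  rw [mem_cell] at hj
  rw [mem_primesIoc le_rfl] at hi
  have : (N : ℝ) ^ ε ≤ (N : ℝ) ^ (ε * ρ ^ (l : ℕ)) :=
    Real.rpow_le_rpow_of_exponent_le hN1 (le_mul_of_one_le_right hε (one_le_pow₀ hρ))
  linarith [hi.2.2, hj.2.1]

lemma tendsto_natCast_rpow_atTop {a : ℝ} (ha : 0 < a) :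
    Tendsto (fun N : ℕ => (N : ℝ) ^ a) atTop atTop :=
  (tendsto_rpow_atTop ha).comp tendsto_natCast_atTop_atTop

lemma tendsto_sum_primesIoc_inv {a b : ℝ} (ha : 0 < a) (hab : a ≤ b) :
    Tendsto (fun N : ℕ => ∑ p ∈ primesIoc ((N : ℝ) ^ a) ((N : ℝ) ^ b), (1 : ℝ) / p) atTop
      (nhds (Real.log (b / a))) := by
  obtain ⟨C, hC, hM⟩ := mertens_second
  have hlim : Tendsto (fun N : ℕ => C / Real.log ((N : ℝ) ^ a)) atTop (nhds 0) :=
    tendsto_const_nhds.div_atTop (Real.tendsto_log_atTop.comp (tendsto_natCast_rpow_atTop ha))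
  rw [tendsto_iff_norm_sub_tendsto_zero]
  refine squeeze_zero' (Eventually.of_forall fun _ => norm_nonneg _) ?_ hlim
  filter_upwards [(tendsto_natCast_rpow_atTop ha).eventually_ge_atTop 2,
    eventually_ge_atTop 2] with N hN hN2
  have hN1 : (1 : ℝ) < N := by exact_mod_cast hN2
  have hl : Real.log N ≠ 0 := (Real.log_pos hN1).ne'
  have h := hM _ _ hN (Real.rpow_le_rpow_of_exponent_le hN1.le hab)
  have e : Real.log ((N : ℝ) ^ b) / Real.log ((N : ℝ) ^ a) = b / a := by
    rw [Real.log_rpow (by linarith), Real.log_rpow (by linarith)]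
    field_simp
  rw [e] at h
  exact h

/-- Every prime in the range tends to infinity with N, so g p may be replaced by κ/p with error
o(1/p), and the sum of 1/p is bounded by Mertens. -/
lemma tendsto_sum_primesIoc {a b : ℝ} (ha : 0 < a) (hab : a ≤ b) {g : ℕ → ℝ} {κ : ℝ}
    (hg : Tendsto (fun p : ℕ => (p : ℝ) * g p) atTop (nhds κ)) :
    Tendsto (fun N : ℕ => ∑ p ∈ primesIoc ((N : ℝ) ^ a) ((N : ℝ) ^ b), g p) atTop
      (nhds (κ * Real.log (b / a))) := by
  have h1 := tendsto_sum_primesIoc_inv ha hab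
  have h2 : Tendsto (fun N : ℕ => ∑ p ∈ primesIoc ((N : ℝ) ^ a) ((N : ℝ) ^ b), (g p - κ * (1 / p)))
      atTop (nhds 0) := by
    have hL : 0 ≤ Real.log (b / a) := Real.log_nonneg (by rwa [le_div_iff₀ ha, one_mul])
    rw [Metric.tendsto_atTop]
    intro δ hδ
    set δ' := δ / (Real.log (b / a) + 2) with hδ'
    have hδ'0 : 0 < δ' := by positivity
    obtain ⟨p₀, hp₀⟩ := (Metric.tendsto_atTop.1 hg) δ' hδ'0
    have hev : ∀ᶠ N : ℕ in atTop, dist (∑ p ∈ primesIoc ((N : ℝ) ^ a) ((N : ℝ) ^ b),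
        (g p - κ * (1 / p))) 0 < δ := by
      filter_upwards [h1.eventually (gt_mem_nhds (lt_add_one _)),
        (tendsto_natCast_rpow_atTop ha).eventually_ge_atTop (p₀ : ℝ)] with N hN1 hN2
      rw [dist_zero_right, Real.norm_eq_abs]
      calc _ ≤ ∑ p ∈ primesIoc ((N : ℝ) ^ a) ((N : ℝ) ^ b), |g p - κ * (1 / p)| :=
            Finset.abs_sum_le_sum_abs _ _
        _ ≤ ∑ p ∈ primesIoc ((N : ℝ) ^ a) ((N : ℝ) ^ b), δ' * (1 / p) := by
            refine Finset.sum_le_sum fun p hp => ?_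
            rw [mem_primesIoc (by positivity)] at hp
            have hpp : (0 : ℝ) < p := by exact_mod_cast hp.1.pos
            have := hp₀ p (by exact_mod_cast (hN2.trans hp.2.1.le))
            rw [Real.dist_eq] at this
            have e : g p - κ * (1 / p) = (p * g p - κ) * (1 / p) := by field_simp
            rw [e, abs_mul, abs_of_pos (by positivity : (0 : ℝ) < 1 / p)]
            exact mul_le_mul_of_nonneg_right this.le (by positivity)
        _ ≤ δ' * (Real.log (b / a) + 1) := by
            rw [← Finset.mul_sum]; gcongr
        _ < δ := by
            rw [hδ', div_mul_eq_mul_div, div_lt_iff₀ (by positivity)]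
            nlinarith
    exact eventually_atTop.1 hev
  have h3 := h2.add (h1.const_mul κ)
  rw [zero_add] at h3
  refine h3.congr fun N => ?_
  rw [Finset.sum_sub_distrib, ← Finset.mul_sum]
  ring

/-- In each cell the densities are uniformly small with sum tending to κ log ρ, so their elementary
symmetric functions converge to Poisson factorial moments. -/
lemma tendsto_sum_typeFamily {ε ρ : ℝ} (hε : 0 < ε) (hρ : 1 < ρ) {J : ℕ} {g : ℕ → ℝ} {κ : ℝ}
    (hg0 : ∀ p : ℕ, p.Prime → 0 ≤ g p)
    (hg : Tendsto (fun p : ℕ => (p : ℝ) * g p) atTop (nhds κ)) (n : Fin J → ℕ) :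
    Tendsto (fun N : ℕ => ∑ s ∈ typeFamily (cell ε ρ J N) n, ∏ p ∈ s, g p) atTop
      (nhds (expMono (fun _ => κ * Real.log ρ) n)) := by
  have h1 : Tendsto (fun N : ℕ => ∏ l : Fin J,
      ∑ S ∈ (cell ε ρ J N l).powersetCard (n l), ∏ p ∈ S, g p) atTop
      (nhds (expMono (fun _ => κ * Real.log ρ) n)) := by
    unfold expMono
    refine tendsto_finsetProd _ fun l _ => ?_
    have hpos : 0 < ε * ρ ^ (l : ℕ) := by positivity
    refine tendsto_esymm (fun N => cell ε ρ J N l) (fun _ => g)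
      (fun N : ℕ => (κ + 1) / (N : ℝ) ^ (ε * ρ ^ (l : ℕ))) _ ?_
      (tendsto_const_nhds.div_atTop (tendsto_natCast_rpow_atTop hpos)) ?_ (n l)
    · obtain ⟨p₀, hp₀⟩ := eventually_atTop.1 (hg.eventually (gt_mem_nhds (lt_add_one _)))
      filter_upwards [(tendsto_natCast_rpow_atTop hpos).eventually_ge_atTop (p₀ : ℝ),
        (tendsto_natCast_rpow_atTop hpos).eventually_gt_atTop 0] with N hN hN0 p hp
      rw [mem_cell] at hp
      refine ⟨hg0 p hp.1, ?_⟩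
      have := hp₀ p (by exact_mod_cast (hN.trans hp.2.1.le))
      rw [le_div_iff₀ hN0]
      calc g p * (N : ℝ) ^ (ε * ρ ^ (l : ℕ)) ≤ g p * p :=
            mul_le_mul_of_nonneg_left hp.2.1.le (hg0 p hp.1)
        _ ≤ κ + 1 := by linarith
    · have := tendsto_sum_primesIoc (b := ε * ρ ^ ((l : ℕ) + 1)) hpos
        (mul_le_mul_of_nonneg_left (pow_le_pow_right₀ hρ.le (Nat.le_succ _)) hε.le) hg
      have e : ε * ρ ^ ((l : ℕ) + 1) / (ε * ρ ^ (l : ℕ)) = ρ := by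
        have : ρ ≠ 0 := by linarith
        field_simp
        exact pow_succ _ _
      rw [e] at this
      exact this
  refine h1.congr' ?_
  filter_upwards [eventually_ge_atTop 1] with N hN
  rw [sum_typeFamily (pairwise_disjoint_cell hε.le hρ.le hN)]

end Cells

/-! ### Moments over integers and over primes -/

section Moments

variable {ι : Type*} [Fintype ι] [DecidableEq ι]

/-- The moments over an interval of integers, with an explicit error term. -/
lemma abs_intMoment_sub_le {H : Finset ℤ} (hH : H.Nonempty) (hadm : Admissible H) {P : ι → Finset ℕ}
    (hP : Pairwise (fun i j => Disjoint (P i) (P j))) (hPp : ∀ l, ∀ p ∈ P l, p.Prime)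
    {Z : Finset ℕ} (hZ : ∀ l, Disjoint Z (P l)) (hZp : ∀ p ∈ Z, p.Prime)
    {D : Finset (Finset ℕ)} (hD : ∀ e ∈ D, e ⊆ Z) (n : ι → ℕ) {Y Y' : ℝ}
    (hY : 0 ≤ Y) (hDY : ∀ e ∈ D, ∏ p ∈ e, (p : ℝ) ≤ Y) (hY' : 0 ≤ Y')
    (hTY : ∀ s ∈ typeFamily P n, ∏ p ∈ s, (p : ℝ) ≤ Y') {a b : ℤ} (hab : a ≤ b) :
    |∑ m ∈ Finset.Ioc a b, sieveWeight H D m * multiChoose (hitCount H P m) n -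
      ((b : ℝ) - a) * ((∑ e ∈ D, ∏ p ∈ e, (-intDensity H p)) *
        ∑ s ∈ typeFamily P n, ∏ p ∈ s, intDensity H p)| ≤
      Y * Y' * (Y * (H.card : ℝ) ^ (∑ l, n l)) := by
  have hTp : ∀ s ∈ typeFamily P n, ∀ p ∈ s, p.Prime := fun s hs p hp => by
    obtain ⟨l, _, hl⟩ := Finset.mem_biUnion.1 ((mem_typeFamily.1 hs).1 hp)
    exact hPp l p hl
  have hDp : ∀ e ∈ D, ∀ p ∈ e, p.Prime := fun e he p hp => hZp p (hD e he hp)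
  have h1 := sum_sieveWeight_mul_multiChoose H D hP (Finset.Ioc a b) (fun _ => (1 : ℝ)) (fun m => m) n
  simp only [one_mul, Finset.sum_const, nsmul_eq_mul, mul_one] at h1
  rw [h1, ← sum_sum_signed_prod hZ hD, Finset.mul_sum, ← Finset.sum_sub_distrib]
  have h2 : ∀ e ∈ D, ∀ s ∈ typeFamily P n,
      |(-1 : ℝ) ^ e.card * (((Finset.Ioc a b).filter
        (fun m : ℤ => ∀ p ∈ e ∪ s, Hits H p m)).card : ℝ) -
        ((b : ℝ) - a) * ((-1) ^ e.card * ∏ p ∈ e ∪ s, intDensity H p)| ≤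
      Y * (H.card : ℝ) ^ (∑ l, n l) := by
    intro e he s hs
    have hQ : ∀ p ∈ e ∪ s, p.Prime := fun p hp => by
      rcases Finset.mem_union.1 hp with h | h
      · exact hDp e he p h
      · exact hTp s hs p h
    have h3 := abs_card_sieve_sub_le hQ (Omega H) hab
    have e1 : (-1 : ℝ) ^ e.card * (((Finset.Ioc a b).filter
        (fun m : ℤ => ∀ p ∈ e ∪ s, Hits H p m)).card : ℝ) -
        ((b : ℝ) - a) * ((-1) ^ e.card * ∏ p ∈ e ∪ s, intDensity H p) =
        (-1) ^ e.card * ((((Finset.Ioc a b).filter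
        (fun m : ℤ => ∀ p ∈ e ∪ s, Hits H p m)).card : ℝ) -
        ((b : ℝ) - a) * ∏ p ∈ e ∪ s, intDensity H p) := by ring
    rw [e1, abs_mul, abs_pow, abs_neg, abs_one, one_pow, one_mul]
    refine h3.trans ?_
    rw [Finset.prod_union (disjoint_of_mem_typeFamily hZ (hD e he) hs)]
    -- For p in e, admissibility gives |Ω(p)| < p, so the product is at most Y. For p in s the bound
    -- k is used; the number of these primes is fixed by the type.
    refine mul_le_mul ?_ ?_ (Finset.prod_nonneg fun _ _ => by positivity) hY
    · refine le_trans (Finset.prod_le_prod (fun _ _ => by positivity) fun p hp => ?_) (hDY e he)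
      exact_mod_cast (hadm p (hDp e he p hp)).le
    · have hs' := mem_typeFamily.1 hs
      rw [prod_inter_biUnion (fun i _ j _ hij => hP hij) hs'.1, ← Finset.prod_pow_eq_pow_sum]
      refine Finset.prod_le_prod (fun _ _ => Finset.prod_nonneg fun _ _ => by positivity)
        fun l _ => ?_
      rw [← hs'.2 l, ← Finset.prod_const]
      exact Finset.prod_le_prod (fun _ _ => by positivity) fun p _ => by
        exact_mod_cast card_Omega_le H p
  calc _ ≤ ∑ e ∈ D, ∑ s ∈ typeFamily P n, Y * (H.card : ℝ) ^ (∑ l, n l) := by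
        refine (Finset.abs_sum_le_sum_abs _ _).trans (Finset.sum_le_sum fun e he => ?_)
        rw [Finset.mul_sum, ← Finset.sum_sub_distrib]
        exact (Finset.abs_sum_le_sum_abs _ _).trans (Finset.sum_le_sum fun s hs => h2 e he s hs)
    _ = (D.card : ℝ) * ((typeFamily P n).card : ℝ) * (Y * (H.card : ℝ) ^ (∑ l, n l)) := by
        simp only [Finset.sum_const, nsmul_eq_mul]; ring
    _ ≤ _ := by
        have c1 := card_family_le hDp hY hDY
        have c2 := card_family_le hTp hY' hTY
        gcongr

/-- The moments over the primes of a dyadic interval; the error is the bilinear form. -/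
lemma primeMoment_eq {H : Finset ℤ} {h : ℤ} (hh : h ∈ H) {P : ι → Finset ℕ} {N : ℕ}
    (hP : Pairwise (fun i j => Disjoint (P i) (P j))) (hPp : ∀ l, ∀ p ∈ P l, p.Prime ∧ p ≤ N)
    {Z : Finset ℕ} (hZ : ∀ l, Disjoint Z (P l)) (hZp : ∀ p ∈ Z, p.Prime ∧ p ≤ N)
    {D : Finset (Finset ℕ)} (hD : ∀ e ∈ D, e ⊆ Z) (n : ι → ℕ) :
    ∑ q ∈ (Finset.Ioc N (2 * N)).filter Nat.Prime, Real.log q * sieveWeight H D ((q : ℤ) - h) *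
        multiChoose (hitCount H P ((q : ℤ) - h)) n =
      N * ((∑ e ∈ D, ∏ p ∈ e, (-primeDensity H p)) *
        ∑ s ∈ typeFamily P n, ∏ p ∈ s, primeDensity H p) +
      ∑ e ∈ D, ∑ s ∈ typeFamily P n, (-1) ^ e.card *
        ∑ r ∈ OmegaStar H h (∏ p ∈ e ∪ s, p), EStar N ((r : ℤ) + h) (∏ p ∈ e ∪ s, p) := by
  rw [sum_sieveWeight_mul_multiChoose H D hP _ _ (fun q : ℕ => (q : ℤ) - h) n,
    ← sum_sum_signed_prod hZ hD, Finset.mul_sum, ← Finset.sum_add_distrib]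
  refine Finset.sum_congr rfl fun e he => ?_
  rw [Finset.mul_sum, ← Finset.sum_add_distrib]
  refine Finset.sum_congr rfl fun s hs => ?_
  have hQ : ∀ p ∈ e ∪ s, p.Prime ∧ p ≤ N := fun p hp => by
    rcases Finset.mem_union.1 hp with h | h
    · exact hZp p (hD e he h)
    · obtain ⟨l, _, hl⟩ := Finset.mem_biUnion.1 ((mem_typeFamily.1 hs).1 h)
      exact hPp l p hl
  rw [sum_log_primes_hits (fun p hp => (hQ p hp).1) H h N (fun p hp => (hQ p hp).2),
    sum_thetaStar_eq (fun p hp => (hQ p hp).1) hh]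
  unfold primeDensity
  ring

/-- The error term of a prime moment, when the level exceeds `X ^ (1 / 2 + 4 * c)`. -/
lemma abs_primeMoment_error_le (H : Finset ℤ) (h : ℤ) (N : ℕ) {P : ι → Finset ℕ}
    (hP : Pairwise (fun i j => Disjoint (P i) (P j))) (hPp : ∀ l, ∀ p ∈ P l, p.Prime)
    {Z : Finset ℕ} (hZ : ∀ l, Disjoint Z (P l)) (hZp : ∀ p ∈ Z, p.Prime)
    {D : Finset (Finset ℕ)} (hD : ∀ e ∈ D, e ⊆ Z) {X c A B : ℝ} (hX : 1 < X) (hc : 0 ≤ c)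
    (hDX : ∀ e ∈ D, ∏ p ∈ e, (p : ℝ) ≤ X ^ c) {t : ι → ℝ} (htc : ∀ l, t l ≤ c)
    (ht : ∀ l, ∀ p ∈ P l, (p : ℝ) ≤ X ^ t l) (hA : 1 ≤ A) (hB : 1 ≤ B)
    (hAB : X ^ (1 / 2 + 4 * c) ≤ A * B) {n : ι → ℕ} (hn : typeWeight t n ≤ 1 / 2) :
    |∑ e ∈ D, ∑ s ∈ typeFamily P n, (-1) ^ e.card *
      ∑ r ∈ OmegaStar H h (∏ p ∈ e ∪ s, p), EStar N ((r : ℤ) + h) (∏ p ∈ e ∪ s, p)| ≤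
      bilinearError H h N A B := by
  -- The sieve part e is placed in the larger factor, which certainly has room for it.
  wlog hle : B ≤ A generalizing A B
  · rw [bilinearError_comm]
    exact this hB hA (by rwa [mul_comm B A]) (not_le.1 hle).le
  have hX0 : 0 < X := by linarith
  have hlX : 0 < Real.log X := Real.log_pos hX
  have hA0 : 0 < A := by linarith
  have hB0 : 0 < B := by linarith
  have eA : X ^ (Real.log A / Real.log X) = A := by
    rw [Real.rpow_def_of_pos hX0, mul_div_cancel₀ _ hlX.ne', Real.exp_log hA0]
  have eB : X ^ (Real.log B / Real.log X) = B := by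
    rw [Real.rpow_def_of_pos hX0, mul_div_cancel₀ _ hlX.ne', Real.exp_log hB0]
  obtain ⟨n', n'', rfl, h1, h2⟩ := exists_type_split (α := Real.log A / Real.log X)
    (β := Real.log B / Real.log X) htc (div_nonneg (Real.log_nonneg hB) hlX.le)
    (by gcongr) (by
      rw [← add_div, ← Real.log_mul hA0.ne' hB0.ne', le_div_iff₀ hlX, ← Real.log_rpow hX0]
      exact Real.log_le_log (by positivity) hAB) hc hn
  refine abs_error_le_bilinearError H h N hP hPp hZ hZp hD n' n'' (Y := X ^ c)
    (Y' := X ^ typeWeight t n') (by positivity) hDX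
    (fun s hs => prod_le_of_mem_typeFamily hP hX.le ht hs) ?_
    (fun s hs => (prod_le_of_mem_typeFamily hP hX.le ht hs).trans ?_)
  · rw [← Real.rpow_add hX0]
    exact (Real.rpow_le_rpow_of_exponent_le hX.le h1).trans_eq eA
  · exact (Real.rpow_le_rpow_of_exponent_le hX.le h2).trans_eq eB

end Moments

/-! ### Limits of the normalised moments -/

section Asymptotics

lemma tendsto_natCast_log_atTop : Tendsto (fun N : ℕ => Real.log N) atTop atTop :=
  Real.tendsto_log_atTop.comp tendsto_natCast_atTop_atTop

/-- R² = N^θ, and the remaining factors R₀^(2τ) and R^ω are at least 1 for large N. -/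
lemma eventually_rpow_le_level {θ ω : ℝ} (hθ : 0 < θ) (hω : 0 ≤ ω) :
    ∀ᶠ N : ℕ in atTop, (N : ℝ) ^ θ ≤ level ((N : ℝ) ^ (θ / 2)) ω := by
  have hR := tendsto_natCast_rpow_atTop (half_pos hθ)
  filter_upwards [hR.eventually_ge_atTop 1,
    (Real.tendsto_log_atTop.comp hR).eventually_ge_atTop 1] with N h1 h2
  set R : ℝ := (N : ℝ) ^ (θ / 2) with hRdef
  replace h2 : 1 ≤ Real.log R := h2
  have h3 : 0 ≤ Real.log (Real.log R) := Real.log_nonneg h2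
  have h4 : 1 ≤ R0 R := Real.one_le_exp (div_nonneg (by linarith) (Real.rpow_nonneg h3 _))
  have h5 : 0 ≤ 2 * tau R := mul_nonneg (by norm_num) (Real.rpow_nonneg h3 _)
  have h6 : (N : ℝ) ^ θ = R ^ (2 : ℝ) := by
    rw [hRdef, ← Real.rpow_mul (by positivity)]; congr 1; ring
  rw [h6, level]
  calc R ^ (2 : ℝ) ≤ R ^ (2 + ω) := Real.rpow_le_rpow_of_exponent_le h1 (by linarith)
    _ ≤ _ := le_mul_of_one_le_left (by positivity) (Real.one_le_rpow h4 h5)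

lemma exists_sieveProduct_ge {H : Finset ℤ} (hadm : Admissible H) {ε : ℝ} (hε : 0 < ε) :
    ∃ c₀ : ℝ, 0 < c₀ ∧ ∀ᶠ N : ℕ in atTop, c₀ * (Real.log N ^ (2 * H.card))⁻¹ ≤
      ∏ p ∈ primesIoc 0 ((N : ℝ) ^ ε), (1 - intDensity H p) := by
  obtain ⟨c₀, hc₀, h⟩ := exists_prod_one_sub_intDensity_ge hadm
  refine ⟨c₀ * (ε ^ (2 * H.card))⁻¹, by positivity, ?_⟩
  filter_upwards [(tendsto_natCast_rpow_atTop hε).eventually h, eventually_gt_atTop 0] with N hN hN0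
  rw [Real.log_rpow (by positivity), mul_pow, mul_inv, ← mul_assoc] at hN
  exact hN

/-- Passing to the limit in a moment with a known main term and a small error term. -/
lemma tendsto_div_of_abs_sub_le {M F V T Err : ℕ → ℝ} {m : ℕ} {c₀ τ : ℝ} (hc₀ : 0 < c₀)
    (hV : ∀ᶠ N : ℕ in atTop, c₀ * (Real.log N ^ m)⁻¹ ≤ V N)
    (hM : ∀ᶠ N in atTop, |M N - F N * (V N * T N)| ≤ Err N)
    (hF : Tendsto (fun N : ℕ => F N / N) atTop (nhds 1)) (hT : Tendsto T atTop (nhds τ))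
    (hErr : Tendsto (fun N : ℕ => Err N * Real.log N ^ m / N) atTop (nhds 0)) :
    Tendsto (fun N : ℕ => M N / (N * V N)) atTop (nhds τ) := by
  have h1 : Tendsto (fun N : ℕ => (M N - F N * (V N * T N)) / (N * V N)) atTop (nhds 0) := by
    have h2 := hErr.const_mul c₀⁻¹
    rw [mul_zero] at h2
    refine squeeze_zero_norm' ?_ h2
    filter_upwards [hV, hM, tendsto_natCast_log_atTop.eventually_gt_atTop 0,
      eventually_gt_atTop 0] with N hV hM hl hN
    have hN0 : (0 : ℝ) < N := by exact_mod_cast hN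
    have hlow : 0 < c₀ * (Real.log N ^ m)⁻¹ := by positivity
    have hV0 : 0 < V N := hlow.trans_le hV
    rw [Real.norm_eq_abs, abs_div, abs_of_pos (by positivity : 0 < (N : ℝ) * V N)]
    have hE0 : 0 ≤ Err N := (abs_nonneg _).trans hM
    calc _ ≤ Err N / (N * (c₀ * (Real.log N ^ m)⁻¹)) := by gcongr
      _ = _ := by field_simp
  have h2 := (hF.mul hT).add h1
  rw [one_mul, add_zero] at h2
  refine h2.congr' ?_
  filter_upwards [hV, tendsto_natCast_log_atTop.eventually_gt_atTop 0,
    eventually_gt_atTop 0] with N hV hl hN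
  have hN0 : (N : ℝ) ≠ 0 := by positivity
  have hlow : 0 < c₀ * (Real.log N ^ m)⁻¹ := by positivity
  have hV0 : V N ≠ 0 := (hlow.trans_le hV).ne'
  field_simp
  ring

lemma eventually_cell_le {ε ρ c : ℝ} {J : ℕ} (hε : 0 ≤ ε) (hρ : 1 ≤ ρ) (hc : c ≤ 1)
    (hJ : ε * ρ ^ J ≤ c) (hεc : ε ≤ c) :
    ∀ᶠ N : ℕ in atTop, (∀ l, ∀ p ∈ cell ε ρ J N l, p.Prime ∧ p ≤ N) ∧
      ∀ p ∈ primesIoc 0 ((N : ℝ) ^ ε), p.Prime ∧ p ≤ N := by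
  filter_upwards [eventually_ge_atTop 1] with N hN
  have hN1 : (1 : ℝ) ≤ N := by exact_mod_cast hN
  have key : ∀ a ≤ (1 : ℝ), (N : ℝ) ^ a ≤ N := fun a ha => by
    simpa using Real.rpow_le_rpow_of_exponent_le hN1 ha
  refine ⟨fun l p hp => ?_, fun p hp => ?_⟩
  · rw [mem_cell] at hp
    refine ⟨hp.1, ?_⟩
    have h1 : ε * ρ ^ ((l : ℕ) + 1) ≤ ε * ρ ^ J :=
      mul_le_mul_of_nonneg_left (pow_le_pow_right₀ hρ l.2) hε
    exact_mod_cast hp.2.2.trans (key _ (by linarith))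
  · rw [mem_primesIoc le_rfl] at hp
    exact ⟨hp.1, by exact_mod_cast hp.2.2.trans (key _ (by linarith))⟩

/-- Sieve part and type contribute an error N^(c + 1/2 + c) ≤ N^(3/4) up to a constant, negligible
against N V ≫ N (log N)^(−2k). Widening the interval by b on each side changes its length only from
N to N + 2b. -/
lemma tendsto_intMoment {H : Finset ℤ} (hH : H.Nonempty) (hadm : Admissible H) {J : ℕ}
    {ε ρ c : ℝ} (hε : 0 < ε) (hρ : 1 < ρ) (hc : c ≤ 1 / 8) {D : ℕ → Finset (Finset ℕ)}
    (hD : ∀ᶠ N : ℕ in atTop, ∀ e ∈ D N, e ⊆ primesIoc 0 ((N : ℝ) ^ ε) ∧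
      ∏ p ∈ e, (p : ℝ) ≤ (N : ℝ) ^ c)
    (hV : ∀ᶠ N : ℕ in atTop, ∏ p ∈ primesIoc 0 ((N : ℝ) ^ ε), (1 - intDensity H p) ≤
      ∑ e ∈ D N, ∏ p ∈ e, (-intDensity H p)) (b : ℕ) {n : Fin J → ℕ}
    (hn : typeWeight (fun l : Fin J => ε * ρ ^ ((l : ℕ) + 1)) n ≤ 1 / 2) :
    Tendsto (fun N : ℕ => (∑ m ∈ Finset.Ioc ((N : ℤ) - b) (2 * N + b), sieveWeight H (D N) m *
        multiChoose (hitCount H (cell ε ρ J N) m) n) /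
        (N * ∑ e ∈ D N, ∏ p ∈ e, (-intDensity H p))) atTop
      (nhds (expMono (fun _ => H.card * Real.log ρ) n)) := by
  obtain ⟨c₀, hc₀, hlow⟩ := exists_sieveProduct_ge hadm hε
  refine tendsto_div_of_abs_sub_le (F := fun N : ℕ => (N : ℝ) + 2 * b)
    (Err := fun N : ℕ => (H.card : ℝ) ^ (∑ l, n l) * (N : ℝ) ^ (3 / 4 : ℝ)) (m := 2 * H.card) hc₀
    (by filter_upwards [hV, hlow] with N h1 h2 using h2.trans h1) ?_ ?_
    (tendsto_sum_typeFamily hε hρ (fun p _ => intDensity_nonneg H p) (tendsto_mul_intDensity H) n) ?_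
  · filter_upwards [hD, eventually_ge_atTop 1] with N hD hN
    have hN1 : (1 : ℝ) ≤ N := by exact_mod_cast hN
    have hN0 : (0 : ℝ) < N := by linarith
    have h1 := abs_intMoment_sub_le hH hadm (pairwise_disjoint_cell hε.le hρ.le (J := J) hN)
      (fun l p hp => (mem_cell.1 hp).1) (disjoint_primesIoc_cell hε.le hρ.le hN)
      (fun p hp => prime_of_mem_primesIoc hp) (fun e he => (hD e he).1) n
      (Y := (N : ℝ) ^ c) (Y' := (N : ℝ) ^ (1 / 2 : ℝ)) (by positivity)
      (fun e he => (hD e he).2) (by positivity)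
      (fun s hs => (prod_le_of_mem_typeFamily (pairwise_disjoint_cell hε.le hρ.le hN) hN1
        (t := fun l : Fin J => ε * ρ ^ ((l : ℕ) + 1))
        (fun l p hp => (mem_cell.1 hp).2.2) hs).trans
        (Real.rpow_le_rpow_of_exponent_le hN1 hn))
      (a := (N : ℤ) - b) (b := 2 * N + b) (by omega)
    push_cast at h1
    rw [show 2 * (N : ℝ) + b - (N - b) = N + 2 * b by ring] at h1
    refine h1.trans ?_
    rw [show (N : ℝ) ^ c * (N : ℝ) ^ (1 / 2 : ℝ) * ((N : ℝ) ^ c * (H.card : ℝ) ^ (∑ l, n l)) =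
      (H.card : ℝ) ^ (∑ l, n l) * ((N : ℝ) ^ c * (N : ℝ) ^ (1 / 2 : ℝ) * (N : ℝ) ^ c) by ring,
      ← Real.rpow_add hN0, ← Real.rpow_add hN0]
    exact mul_le_mul_of_nonneg_left
      (Real.rpow_le_rpow_of_exponent_le hN1 (by linarith)) (by positivity)
  · have h1 : Tendsto (fun N : ℕ => 1 + 2 * (b : ℝ) / N) atTop (nhds (1 + 0)) :=
      tendsto_const_nhds.add (tendsto_const_nhds.div_atTop tendsto_natCast_atTop_atTop)
    rw [add_zero] at h1
    refine h1.congr' ?_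
    filter_upwards [eventually_gt_atTop 0] with N hN
    have hN0 : (N : ℝ) ≠ 0 := by positivity
    field_simp
  · have h1 := ((isLittleO_log_rpow_rpow_atTop ((2 * H.card : ℕ) : ℝ)
      (by norm_num : (0 : ℝ) < 1 / 4)).tendsto_div_nhds_zero.comp
      tendsto_natCast_atTop_atTop).const_mul ((H.card : ℝ) ^ (∑ l, n l))
    rw [mul_zero] at h1
    refine h1.congr' ?_
    filter_upwards [eventually_gt_atTop 0] with N hN
    have hN0 : (0 : ℝ) < N := by exact_mod_cast hN
    simp only [Function.comp_apply, Real.rpow_natCast]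
    have e : (N : ℝ) = (N : ℝ) ^ (3 / 4 : ℝ) * (N : ℝ) ^ (1 / 4 : ℝ) := by
      rw [← Real.rpow_add hN0]; norm_num
    have e1 : ((N : ℝ) ^ (3 / 4 : ℝ)) ≠ 0 := by positivity
    have e2 : ((N : ℝ) ^ (1 / 4 : ℝ)) ≠ 0 := by positivity
    generalize Real.log N ^ (2 * H.card) = L
    generalize (N : ℝ) ^ (3 / 4 : ℝ) = x at *
    generalize (N : ℝ) ^ (1 / 4 : ℝ) = y at *
    rw [e]
    field_simp

/-- The error is bounded by the bilinear form, O(N (log N)^(−C₁)). Since the sieve sum is ≫ (log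
N)^(−2k), the condition C₁ > 2k makes it negligible. -/
lemma tendsto_primeMoment {H : Finset ℤ} (hadm : Admissible H) {θ ω C₁ : ℝ} (hω : 0 ≤ ω)
    (hbil : BilinearErrorBound H θ ω C₁) (hC₁ : 2 * (H.card : ℝ) < C₁) {h : ℤ} (hh : h ∈ H) {J : ℕ}
    {ε ρ c : ℝ} (hε : 0 < ε) (hρ : 1 < ρ) (hc : c ≤ 1 / 8) (hθ : 1 / 2 + 4 * c ≤ θ)
    (hJ : ε * ρ ^ J ≤ c) (hεc : ε ≤ c) {D : ℕ → Finset (Finset ℕ)}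
    (hD : ∀ᶠ N : ℕ in atTop, ∀ e ∈ D N, e ⊆ primesIoc 0 ((N : ℝ) ^ ε) ∧
      ∏ p ∈ e, (p : ℝ) ≤ (N : ℝ) ^ c)
    (hV : ∀ᶠ N : ℕ in atTop, ∏ p ∈ primesIoc 0 ((N : ℝ) ^ ε), (1 - intDensity H p) ≤
      ∑ e ∈ D N, ∏ p ∈ e, (-primeDensity H p)) {n : Fin J → ℕ}
    (hn : typeWeight (fun l : Fin J => ε * ρ ^ ((l : ℕ) + 1)) n ≤ 1 / 2) :
    Tendsto (fun N : ℕ => (∑ q ∈ (Finset.Ioc N (2 * N)).filter Nat.Prime,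
        Real.log q * sieveWeight H (D N) ((q : ℤ) - h) *
        multiChoose (hitCount H (cell ε ρ J N) ((q : ℤ) - h)) n) /
        (N * ∑ e ∈ D N, ∏ p ∈ e, (-primeDensity H p))) atTop
      (nhds (expMono (fun _ => (H.card - 1) * Real.log ρ) n)) := by
  obtain ⟨c₀, hc₀, hlow⟩ := exists_sieveProduct_ge hadm hε
  obtain ⟨A, B, hAB, hO⟩ := hbil h hh
  obtain ⟨K, hK⟩ := hO.bound
  have hc0 : 0 ≤ c := hε.le.trans hεc
  refine tendsto_div_of_abs_sub_le (F := fun N : ℕ => (N : ℝ))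
    (Err := fun N : ℕ => K * (N / Real.log N ^ C₁)) (m := 2 * H.card) hc₀
    (by filter_upwards [hV, hlow] with N h1 h2 using h2.trans h1) ?_ ?_
    (tendsto_sum_typeFamily hε hρ (fun p hp => primeDensity_nonneg ⟨h, hh⟩ hp.one_le)
      (tendsto_mul_primeDensity H) n) ?_
  · filter_upwards [hD, hAB, hK, eventually_ge_atTop 2, eventually_cell_le hε.le hρ.le
      (by linarith : c ≤ 1) hJ hεc, eventually_rpow_le_level (by linarith : 0 < θ) hω,
      tendsto_natCast_log_atTop.eventually_gt_atTop 0] with N hD hAB hK hN hcell hlev hl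
    have hN1 : (1 : ℝ) < N := by exact_mod_cast hN
    have hd := pairwise_disjoint_cell hε.le hρ.le (J := J) (show 1 ≤ N by omega)
    have hZ := disjoint_primesIoc_cell hε.le hρ.le (J := J) (show 1 ≤ N by omega)
    have h1 := primeMoment_eq hh hd hcell.1 hZ hcell.2 (fun e he => (hD e he).1) n
    rw [h1, add_sub_cancel_left]
    refine (abs_primeMoment_error_le H h N hd (fun l p hp => (hcell.1 l p hp).1) hZ
      (fun p hp => (hcell.2 p hp).1) (fun e he => (hD e he).1) hN1 hc0
      (fun e he => (hD e he).2) (t := fun l : Fin J => ε * ρ ^ ((l : ℕ) + 1))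
      (fun l => le_trans (mul_le_mul_of_nonneg_left (pow_le_pow_right₀ hρ.le l.2) hε.le) hJ)
      (fun l p hp => (mem_cell.1 hp).2.2) hAB.1 hAB.2.1 ?_ hn).trans ?_
    · rw [hAB.2.2]
      exact (Real.rpow_le_rpow_of_exponent_le hN1.le hθ).trans hlev
    · refine (le_abs_self _).trans (hK.trans_eq ?_)
      rw [Real.norm_of_nonneg (by positivity)]
  · refine tendsto_const_nhds.congr' ?_
    filter_upwards [eventually_gt_atTop 0] with N hN
    have hN0 : (N : ℝ) ≠ 0 := by positivity
    exact (div_self hN0).symm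
  · have h1 := ((tendsto_rpow_neg_atTop (sub_pos.2 hC₁)).comp
      tendsto_natCast_log_atTop).const_mul K
    rw [mul_zero] at h1
    refine h1.congr' ?_
    filter_upwards [eventually_gt_atTop 0, tendsto_natCast_log_atTop.eventually_gt_atTop 0]
      with N hN hl
    have hN0 : (N : ℝ) ≠ 0 := by positivity
    simp only [Function.comp_apply]
    rw [neg_sub, Real.rpow_sub hl, show 2 * (H.card : ℝ) = ((2 * H.card : ℕ) : ℝ) by push_cast; ring,
      Real.rpow_natCast]
    have : Real.log N ^ C₁ ≠ 0 := by positivity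
    field_simp

end Asymptotics

/-! ### Comparison of the two weighted sums, and conclusion -/

/-- The squared sieve weight. -/
noncomputable def squareWeight {J : ℕ} (H : Finset ℤ) (D : Finset (Finset ℕ)) (P : Fin J → Finset ℕ)
    (K : Finset (Fin J → ℕ)) (lam : (Fin J → ℕ) → ℝ) (m : ℤ) : ℝ :=
  sieveWeight H D m * (∑ n ∈ K, lam n * multiChoose (hitCount H P m) n) ^ 2

/-- If the weighted count of primes exceeds the weighted count of integers, some translate of `H`
contains two primes. -/
lemma exists_two_primes_of_sum_lt {H : Finset ℤ} {b N : ℕ} (hb : ∀ h ∈ H, h.natAbs ≤ b) (hN : 0 < N)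
    {w : ℤ → ℝ} (hw : ∀ m, 0 ≤ w m)
    (hlt : Real.log (2 * N) * ∑ m ∈ Finset.Ioc ((N : ℤ) - b) (2 * N + b), w m <
      ∑ h ∈ H, ∑ q ∈ (Finset.Ioc N (2 * N)).filter Nat.Prime, Real.log q * w ((q : ℤ) - h)) :
    ∃ q q' : ℕ, q.Prime ∧ q'.Prime ∧ N < q ∧ q < q' ∧ q' ≤ q + 2 * b := by
  by_contra hcon
  push Not at hcon
  refine absurd hlt (not_lt.2 ?_)
  have hlog : 0 ≤ Real.log (2 * N) := Real.log_nonneg (by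
    have : (1 : ℝ) ≤ N := by exact_mod_cast hN
    linarith)
  set I := Finset.Ioc ((N : ℤ) - b) (2 * N + b) with hI
  set Pr := (Finset.Ioc N (2 * N)).filter Nat.Prime with hPr
  have h1 : ∀ h ∈ H, ∑ q ∈ Pr, Real.log q * w ((q : ℤ) - h) ≤
      ∑ m ∈ I, Real.log (2 * N) * (if ∃ q ∈ Pr, (q : ℤ) = m + h then w m else 0) := by
    intro h hh
    have hb' := hb h hh
    calc _ ≤ ∑ q ∈ Pr, Real.log (2 * N) * w ((q : ℤ) - h) := by
          refine Finset.sum_le_sum fun q hq => mul_le_mul_of_nonneg_right ?_ (hw _)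
          rw [hPr, Finset.mem_filter, Finset.mem_Ioc] at hq
          refine Real.log_le_log (by exact_mod_cast hq.2.pos) (by exact_mod_cast hq.1.2)
      _ = ∑ m ∈ Pr.image (fun q : ℕ => (q : ℤ) - h), Real.log (2 * N) * w m := by
          rw [Finset.sum_image]
          intro q _ q' _ heq
          have : (q : ℤ) - h = (q' : ℤ) - h := heq
          omega
      _ = ∑ m ∈ Pr.image (fun q : ℕ => (q : ℤ) - h), Real.log (2 * N) *
            (if ∃ q ∈ Pr, (q : ℤ) = m + h then w m else 0) := by
          refine Finset.sum_congr rfl fun m hm => ?_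
          obtain ⟨q, hq, rfl⟩ := Finset.mem_image.1 hm
          rw [if_pos ⟨q, hq, by ring⟩]
      _ ≤ _ := by
          refine Finset.sum_le_sum_of_subset_of_nonneg (fun m hm => ?_) fun m _ _ =>
            mul_nonneg hlog (by split_ifs <;> simp [hw m])
          obtain ⟨q, hq, rfl⟩ := Finset.mem_image.1 hm
          rw [hPr, Finset.mem_filter, Finset.mem_Ioc] at hq
          rw [hI, Finset.mem_Ioc]
          omega
  refine (Finset.sum_le_sum h1).trans ?_
  rw [Finset.sum_comm, Finset.mul_sum]
  refine Finset.sum_le_sum fun m _ => ?_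
  rw [← Finset.mul_sum]
  refine mul_le_mul_of_nonneg_left ?_ hlog
  -- If primes above N are never within 2b of each other, at most one h in H makes m + h a prime of
  -- the range, so m is counted at most once.
  by_cases hex : ∃ h ∈ H, ∃ q ∈ Pr, (q : ℤ) = m + h
  · obtain ⟨h, hh, q, hq, hqm⟩ := hex
    rw [Finset.sum_eq_single_of_mem h hh]
    · rw [if_pos ⟨q, hq, hqm⟩]
    · intro h' hh' hne
      refine if_neg ?_
      rintro ⟨q', hq', hqm'⟩
      rw [hPr, Finset.mem_filter, Finset.mem_Ioc] at hq hq'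
      have b1 := hb h hh
      have b2 := hb h' hh'
      rcases lt_trichotomy q q' with hlt' | heq | hlt'
      · have := hcon q q' hq.2 hq'.2 hq.1.1 hlt'
        omega
      · omega
      · have := hcon q' q hq'.2 hq.2 hq'.1.1 hlt'
        omega
  · rw [Finset.sum_eq_zero]
    · exact hw m
    · intro h hh
      exact if_neg fun hq => hex ⟨h, hh, hq⟩

/-- Infinitely many pairs of primes at bounded distance give a finite limit inferior. -/
lemma liminf_prime_gap_lt_top {d : ℕ}
    (h : ∀ᶠ N : ℕ in atTop, ∃ q q' : ℕ, q.Prime ∧ q'.Prime ∧ N < q ∧ q < q' ∧ q' ≤ q + d) :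
    liminf (fun n : ℕ =>
      (((Nat.nth Nat.Prime (n + 1) : ℝ) - (Nat.nth Nat.Prime n : ℝ) : ℝ) : EReal)) atTop < ⊤ := by
  refine lt_of_le_of_lt (b := (((d : ℕ) : ℝ) : EReal)) ?_ (EReal.coe_lt_top _)
  refine liminf_le_of_frequently_le' ?_
  rw [frequently_atTop]
  intro n₀
  obtain ⟨N₀, hN₀⟩ := eventually_atTop.1 h
  obtain ⟨q, q', hq, hq', hNq, hlt, hle⟩ := hN₀ (max N₀ (Nat.nth Nat.Prime n₀)) (le_max_left _ _)
  have hinf := Nat.infinite_setOfPred_prime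
  have e1 : Nat.nth Nat.Prime (Nat.count Nat.Prime q) = q := Nat.nth_count hq
  have e2 : Nat.nth Nat.Prime (Nat.count Nat.Prime q') = q' := Nat.nth_count hq'
  refine ⟨Nat.count Nat.Prime q, ?_, ?_⟩
  · refine ((Nat.nth_lt_nth hinf).1 ?_).le
    rw [e1]
    exact (le_max_right _ _).trans_lt hNq
  · have h1 : Nat.count Nat.Prime q + 1 ≤ Nat.count Nat.Prime q' :=
      (Nat.nth_lt_nth hinf).1 (by rw [e1, e2]; exact hlt)
    have h2 := (Nat.nth_le_nth hinf).2 h1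
    rw [e2] at h2
    rw [e1, EReal.coe_le_coe_iff, sub_le_iff_le_add']
    exact_mod_cast h2.trans hle

lemma typeWeight_le_of_mem {J : ℕ} {t : Fin J → ℝ} (ht : ∀ l, 0 < t l) {i j γ : Fin J → ℕ}
    (hi : i ∈ typesLE t (1 / 4)) (hj : j ∈ typesLE t (1 / 4)) :
    typeWeight t (i + j - γ) ≤ 1 / 2 := by
  rw [mem_typesLE ht] at hi hj
  have h1 : typeWeight t (i + j - γ) ≤ typeWeight t (i + j) :=
    typeWeight_mono (fun l => (ht l).le) tsub_le_self
  rw [typeWeight_add] at h1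
  linarith

/-- After normalisation the integer sum tends to Q1 and each prime sum to Q2. The comparison of the
forms, combined with V1 ≤ 1.01 V and V2 ≥ 1.61 ε V log N, puts the prime side ahead of log(2N) times
the integer side. -/
theorem eventually_exists_two_primes {H : Finset ℤ} (hH : H.Nonempty) (hadm : Admissible H)
    {θ ω C₁ c : ℝ} (hω : 0 ≤ ω) (hbil : BilinearErrorBound H θ ω C₁) (hC₁ : 2 * (H.card : ℝ) < C₁)
    (hc : 0 < c) (hc8 : c ≤ 1 / 8) (hθ : 1 / 2 + 4 * c ≤ θ)
    (hpar : ∀ ε₀ : ℝ, 0 < ε₀ → ∃ (J : ℕ) (ε ρ : ℝ) (g : Fin J → ℝ),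
      0 < ε ∧ ε ≤ ε₀ ∧ 1 < ρ ∧ ε * ρ ^ J ≤ c ∧
      1.02 * ∑ γ ∈ typesLE (fun l : Fin J => ε * ρ ^ ((l : ℕ) + 1)) (1 / 4),
          expMono (fun l => H.card * Real.log ρ * g l ^ 2) γ ≤
        H.card * (1.61 * ε) * ∑ γ ∈ typesLE (fun l : Fin J => ε * ρ ^ ((l : ℕ) + 1)) (1 / 4),
          expMono (fun l => (H.card * Real.log ρ - Real.log ρ) * g l ^ 2) γ *
          (∑ n ∈ (typesLE (fun l : Fin J => ε * ρ ^ ((l : ℕ) + 1)) (1 / 4)).filter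
            (fun n => γ ≤ n), expMono (fun l => g l * Real.log ρ) (n - γ)) ^ 2) :
    ∃ d : ℕ, ∀ᶠ N : ℕ in atTop,
      ∃ q q' : ℕ, q.Prime ∧ q'.Prime ∧ N < q ∧ q < q' ∧ q' ≤ q + d := by
  obtain ⟨s, hs, hBH⟩ := exists_brun_hooley_weights H.card (show (0 : ℝ) < 0.01 by norm_num)
  -- The sieve exponent s depends on k alone, so ε is chosen after it: ε ≤ c/s keeps the sieve
  -- moduli (N^ε)^s below N^c.
  obtain ⟨J, ε, ρ, g, hε, hε₀, hρ, hJ, hQ⟩ := hpar (min c (c / s)) (lt_min hc (div_pos hc hs))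
  have hεc : ε ≤ c := hε₀.trans (min_le_left _ _)
  have hεs : ε * s ≤ c := by
    rw [← le_div_iff₀ hs]; exact hε₀.trans (min_le_right _ _)
  set t : Fin J → ℝ := fun l => ε * ρ ^ ((l : ℕ) + 1) with ht
  have ht0 : ∀ l, 0 < t l := fun l => by have := hρ.trans' one_pos; positivity
  set K := typesLE t (1 / 4) with hK
  set k : ℝ := (H.card : ℝ) with hk
  have hlρ : 0 < Real.log ρ := Real.log_pos hρ
  set a : Fin J → ℝ := fun _ => k * Real.log ρ with ha
  -- The coefficients are fixed by diagonalising at the intensity of the integers; the prime form is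
  -- then evaluated at the intensity lowered by log ρ.
  set lam := invCoef K (fun n => ∏ l, (-g l) ^ n l) a with hlam
  have hKl : ∀ i ∈ K, ∀ γ ≤ i, γ ∈ K := typesLE_lower ht0
  set Q1 := sqForm K lam (expMono a) with hQ1
  set Q2 := sqForm K lam (expMono (fun _ => (k - 1) * Real.log ρ)) with hQ2
  have hQ1e := sqForm_invCoef_self hKl g a
  have hQ2e := sqForm_invCoef_sub hKl g a (fun _ => Real.log ρ)
  have haL : a - (fun _ => Real.log ρ) = fun _ => (k - 1) * Real.log ρ := by
    funext l; simp only [ha, Pi.sub_apply]; ring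
  rw [haL] at hQ2e
  have hQ12 : 1.02 * Q1 ≤ k * (1.61 * ε) * Q2 := by
    rw [hQ1, hQ2, hQ1e, hQ2e]; exact hQ
  have hQ1pos : 0 < Q1 := by
    have hnn : ∀ γ : Fin J → ℕ, 0 ≤ expMono (fun l => a l * g l ^ 2) γ := expMono_nonneg fun l => by
      simp only [ha, hk]; positivity
    rw [hQ1, hQ1e]
    refine Finset.sum_pos' (fun γ _ => hnn γ) ⟨0, ?_, ?_⟩
    · rw [hK, mem_typesLE ht0]; simp [typeWeight]
    · simp [expMono]
  -- the sieve weights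
  have hev : ∀ᶠ N : ℕ in atTop, ∃ D : Finset (Finset ℕ), _ :=
    (tendsto_natCast_rpow_atTop hε).eventually hBH
  obtain ⟨D, hD⟩ := hev.choice
  have hDs : ∀ᶠ N : ℕ in atTop, ∀ e ∈ D N, e ⊆ primesIoc 0 ((N : ℝ) ^ ε) ∧
      ∏ p ∈ e, (p : ℝ) ≤ (N : ℝ) ^ c := by
    filter_upwards [hD, eventually_ge_atTop 1] with N hN hN1 e he
    refine ⟨(hN.1 e he).1, (hN.1 e he).2.trans ?_⟩
    rw [← Real.rpow_mul (by positivity)]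
    exact Real.rpow_le_rpow_of_exponent_le (by exact_mod_cast hN1) hεs
  set V1 : ℕ → ℝ := fun N => ∑ e ∈ D N, ∏ p ∈ e, (-intDensity H p) with hV1
  set V2 : ℕ → ℝ := fun N => ∑ e ∈ D N, ∏ p ∈ e, (-primeDensity H p) with hV2
  set V : ℕ → ℝ := fun N => ∏ p ∈ primesIoc 0 ((N : ℝ) ^ ε), (1 - intDensity H p) with hV
  have hle1 : ∀ p : ℕ, p.Prime → intDensity H p ≤ 1 := fun p hp => by
    have := inv_le_one_sub_intDensity hadm hp
    have h2 : (0 : ℝ) ≤ 1 / p := by positivity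
    linarith
  have hV0 : ∀ N, 0 < V N := fun N => Finset.prod_pos fun p hp => by
    have hp' := prime_of_mem_primesIoc hp
    have hpos : (0 : ℝ) < p := by exact_mod_cast hp'.pos
    exact lt_of_lt_of_le (by positivity) (inv_le_one_sub_intDensity hadm hp')
  have hVV1 : ∀ᶠ N : ℕ in atTop, V N ≤ V1 N ∧ V1 N ≤ 1.01 * V N := by
    filter_upwards [hD] with N hN
    refine ⟨hN.2.1 _ fun p hp => ⟨intDensity_nonneg H p, hle1 p (prime_of_mem_primesIoc hp)⟩, ?_⟩
    have := hN.2.2 (intDensity H) fun p hp =>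
      ⟨intDensity_nonneg H p, hle1 p (prime_of_mem_primesIoc hp), intDensity_le H p⟩
    norm_num at this ⊢
    exact this
  have hVV2 : ∀ᶠ N : ℕ in atTop, V N * (1.61 * (ε * Real.log N)) ≤ V2 N := by
    filter_upwards [hD, (tendsto_natCast_rpow_atTop hε).eventually prod_primes_ge,
      eventually_gt_atTop 0] with N hN hM hN0
    refine le_trans ?_ (hN.2.1 (primeDensity H) fun p hp =>
      ⟨primeDensity_nonneg hH (prime_of_mem_primesIoc hp).one_le,
        primeDensity_le_one hadm (prime_of_mem_primesIoc hp)⟩)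
    rw [Finset.prod_congr rfl fun p hp => one_sub_primeDensity (prime_of_mem_primesIoc hp),
      Finset.prod_mul_distrib]
    rw [Real.log_rpow (by positivity)] at hM
    exact mul_le_mul_of_nonneg_left hM (hV0 N).le
  have hVV2' : ∀ᶠ N : ℕ in atTop, V N ≤ V2 N := by
    filter_upwards [hVV2, (tendsto_natCast_log_atTop.const_mul_atTop hε).eventually_ge_atTop 1]
      with N h1 h2
    refine le_trans (le_mul_of_one_le_right (hV0 N).le ?_) h1
    linarith
  -- the two sums
  set b : ℕ := ∑ h ∈ H, h.natAbs with hb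
  set w : ℕ → ℤ → ℝ := fun N => squareWeight H (D N) (cell ε ρ J N) K lam with hw
  -- The sieve inequality with g the 0-1 indicator of hitting bounds the sieve weight below by a
  -- product of zeros and ones.
  have hw0 : ∀ᶠ N : ℕ in atTop, ∀ m, 0 ≤ w N m := by
    filter_upwards [hD] with N hN m
    refine mul_nonneg (le_trans (Finset.prod_nonneg fun p _ => ?_)
      (hN.2.1 (hitInd H m) fun p _ => ?_)) (sq_nonneg _)
    · unfold hitInd; split_ifs <;> norm_num
    · unfold hitInd; split_ifs <;> norm_num
  set S1 : ℕ → ℝ := fun N => ∑ m ∈ Finset.Ioc ((N : ℤ) - b) (2 * N + b), w N m with hS1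
  set S2 : ℤ → ℕ → ℝ := fun h N => ∑ q ∈ (Finset.Ioc N (2 * N)).filter Nat.Prime,
    Real.log q * w N ((q : ℤ) - h) with hS2
  have hlim1 : Tendsto (fun N : ℕ => S1 N / (N * V1 N)) atTop (nhds Q1) := by
    have := tendsto_sqForm K lam (fun N n => (∑ m ∈ Finset.Ioc ((N : ℤ) - b) (2 * N + b),
      sieveWeight H (D N) m * multiChoose (hitCount H (cell ε ρ J N) m) n) / (N * V1 N)) (expMono a)
      fun i hi j hj γ _ => tendsto_intMoment hH hadm hε hρ hc8 hDs
        (hVV1.mono fun N h => h.1) b (typeWeight_le_of_mem ht0 hi hj)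
    refine this.congr fun N => ?_
    rw [sqForm_div, ← sum_mul_sq_multiChoose]
    rfl
  have hlim2 : ∀ h ∈ H, Tendsto (fun N : ℕ => S2 h N / (N * V2 N)) atTop (nhds Q2) := by
    intro h hh
    have := tendsto_sqForm K lam (fun N n => (∑ q ∈ (Finset.Ioc N (2 * N)).filter Nat.Prime,
      Real.log q * sieveWeight H (D N) ((q : ℤ) - h) *
      multiChoose (hitCount H (cell ε ρ J N) ((q : ℤ) - h)) n) / (N * V2 N))
      (expMono (fun _ => (k - 1) * Real.log ρ))
      fun i hi j hj γ _ => tendsto_primeMoment hadm hω hbil hC₁ hh hε hρ hc8 hθ hJ hεc hDs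
        hVV2' (typeWeight_le_of_mem ht0 hi hj)
    refine this.congr fun N => ?_
    rw [sqForm_div, ← sum_mul_sq_multiChoose]
    congr 1
    refine Finset.sum_congr rfl fun q _ => ?_
    simp only [hw, squareWeight, mul_assoc]
  have hlimX : Tendsto (fun N : ℕ => Real.log (2 * N) / Real.log N * (S1 N / (N * V1 N))) atTop
      (nhds Q1) := by
    have h1 : Tendsto (fun N : ℕ => Real.log 2 / Real.log N + 1) atTop (nhds (0 + 1)) :=
      (tendsto_const_nhds.div_atTop tendsto_natCast_log_atTop).add tendsto_const_nhds
    rw [zero_add] at h1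
    have h2 := h1.mul hlim1
    rw [one_mul] at h2
    refine h2.congr' ?_
    filter_upwards [tendsto_natCast_log_atTop.eventually_gt_atTop 0, eventually_gt_atTop 0]
      with N hl hN
    have hN0 : (N : ℝ) ≠ 0 := by positivity
    rw [Real.log_mul (by norm_num) hN0, add_div, div_self hl.ne']
  have hlimY : Tendsto (fun N : ℕ => 1.61 * ε / 1.01 * ∑ h ∈ H, S2 h N / (N * V2 N)) atTop
      (nhds (1.61 * ε / 1.01 * ∑ _h ∈ H, Q2)) :=
    (tendsto_finsetSum _ hlim2).const_mul _
  -- The margin 1.02 in the parameters exceeds the sieve loss 1.01; since Q1 > 0 the inequality is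
  -- strict, and it therefore persists for large N.
  have hlt : Q1 < 1.61 * ε / 1.01 * ∑ _h ∈ H, Q2 := by
    rw [Finset.sum_const, nsmul_eq_mul, ← hk]
    have e : 1.61 * ε / 1.01 * (k * Q2) = k * (1.61 * ε) * Q2 / 1.01 := by ring
    rw [e, lt_div_iff₀ (by norm_num)]
    linarith
  refine ⟨2 * b, ?_⟩
  filter_upwards [hlimX.eventually_lt hlimY hlt, hVV1, hVV2, hVV2', hw0,
    tendsto_natCast_log_atTop.eventually_gt_atTop 0, eventually_gt_atTop 0]
    with N hlt hVV1 hVV2 hVV2' hw0 hl hN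
  refine exists_two_primes_of_sum_lt (H := H) (fun h hh => Finset.single_le_sum
    (f := fun h : ℤ => h.natAbs) (fun _ _ => Nat.zero_le _) hh) hN hw0 ?_
  change Real.log (2 * N) * S1 N < ∑ h ∈ H, S2 h N
  have hN0 : (0 : ℝ) < N := by exact_mod_cast hN
  have hVN := hV0 N
  have hV1p : 0 < V1 N := hVN.trans_le hVV1.1
  have hV2p : 0 < V2 N := hVN.trans_le hVV2'
  have hS2nn : 0 ≤ ∑ h ∈ H, S2 h N := Finset.sum_nonneg fun h _ => Finset.sum_nonneg fun q _ =>
    mul_nonneg (Real.log_natCast_nonneg q) (hw0 _)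
  rw [← Finset.sum_div] at hlt
  have hpos : 0 < Real.log N * (N * V1 N) := by positivity
  calc Real.log (2 * N) * S1 N
      = (Real.log (2 * N) / Real.log N * (S1 N / (N * V1 N))) * (Real.log N * (N * V1 N)) := by
        field_simp
    _ < (1.61 * ε / 1.01 * ((∑ h ∈ H, S2 h N) / (N * V2 N))) * (Real.log N * (N * V1 N)) :=
        mul_lt_mul_of_pos_right hlt hpos
    _ = (∑ h ∈ H, S2 h N) * ((1.61 * (ε * Real.log N)) * V1 N / 1.01 / V2 N) := by
        field_simp
    _ ≤ (∑ h ∈ H, S2 h N) * 1 := by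
        refine mul_le_mul_of_nonneg_left ?_ hS2nn
        rw [div_le_one hV2p]
        refine le_trans ?_ hVV2
        rw [div_le_iff₀ (by norm_num)]
        have : 0 ≤ 1.61 * (ε * Real.log N) := by positivity
        nlinarith [mul_le_mul_of_nonneg_left hVV1.2 this]
    _ = _ := mul_one _

theorem mainTheorem3 :
    ∀ θ : ℝ, 1 / 2 < θ →
      ∃ k₀ ℓ₀ : ℕ, ∀ k ℓ : ℕ, k₀ ≤ k → ℓ₀ ≤ ℓ → 1 ≤ ℓ → ℓ ≤ k →
        ∀ ω : ℝ, 3 * Real.log k ≤ k * ω → k * ω ≤ (1 / 2 : ℝ) * k →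
        ∀ C₁ : ℝ, 2 * ((k : ℝ) + ℓ + 1) ≤ C₁ →
        ∀ H : Finset ℤ, H.card = k → SmoothedGPY.Admissible H →
          SmoothedGPY.BilinearErrorBound H θ ω C₁ →
          liminf (fun n : ℕ =>
            (((Nat.nth Nat.Prime (n + 1) : ℝ) - (Nat.nth Nat.Prime n : ℝ) : ℝ) : EReal)) atTop
            < ⊤ := by
  intro θ hθ
  -- This c satisfies 1/2 + 4c ≤ θ, the room for splitting moduli on the prime side, and 1/2 + 2c ≤
  -- 3/4, the room for the error on the integer side.
  have hc : 0 < min ((θ - 1 / 2) / 4) (1 / 8) := lt_min (by linarith) (by norm_num)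
  obtain ⟨k₀, hk₀⟩ := exists_sieve_parameters hc
  refine ⟨k₀, 1, fun k ℓ hk _ hℓ hℓk ω hω1 _ C₁ hC₁ H hcard hadm hbil => ?_⟩
  have hk1 : 1 ≤ k := hℓ.trans hℓk
  have hk1' : (1 : ℝ) ≤ k := by exact_mod_cast hk1
  have hω : 0 ≤ ω := by
    have := Real.log_nonneg hk1'
    exact nonneg_of_mul_nonneg_right (by linarith : 0 ≤ (k : ℝ) * ω) (by linarith)
  subst hcard
  have hℓ0 : (0 : ℝ) ≤ ℓ := by positivity
  have h4 := min_le_left ((θ - 1 / 2) / 4) (1 / 8)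
  obtain ⟨d, hd⟩ := eventually_exists_two_primes (Finset.card_pos.1 hk1) hadm hω hbil
    (by linarith) hc (min_le_right _ _) (by linarith) (hk₀ H.card hk)
  exact liminf_prime_gap_lt_top hd
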